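/- Conventions. A 2-category has small hom-categories; products, powers, and the diagrams and weights of weighted limits are small. For a 2-category $\mathcal K$, let $n\mathcal K$ be the simplicially enriched category with the same objects and with homs the nerves $N(\mathcal K(A,B))$ of the hom-categories of $\mathcal K$. Flexible limits. A weight is a 2-functor $W\colon\mathcal J\to\mathbf{Cat}$ with $\mathcal J$ a small 2-category. It is flexible if it is cofibrant in $[\mathcal J,\mathbf{Cat}]$: for every 2-natural $p\colon E\to F$ between 2-functors $\mathcal J\to\mathbf{Cat}$ whose components are all fully faithful and surjective on objects, every 2-natural $W\to F$ factors through $p$ by a 2-natural $W\to E$. The 2-category $\mathcal K$ has flexible limits if for every flexible $W$ and every 2-functor $D\colon\mathcal J\to\mathcal K$ the weighted limit exists, i.e. an object $L$ with isomorphisms of categories $\mathcal K(X,L)\cong[\mathcal J,\mathbf{Cat}](W,\mathcal K(X,D-))$, 2-natural in $X$. Normal isofibrations. A morphism $f\colon A\to B$ of $\mathcal K$ is a representable isofibration if for all $g\colon X\to A$, $h\colon X\to B$ and every invertible 2-cell $\alpha\colon fg\cong h$ there are $h'\colon X\to A$ and an invertible $\alpha'\colon g\cong h'$ with $fh'=h$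 and $f\alpha'=\alpha$. It is a normal isofibration if moreover such pairs $(\alpha',h')$ can be chosen, for all $(g,\alpha,h)$, naturally in $X$ (that is, compatibly with precomposition by morphisms $Y\to X$) and so that $\alpha'$ is an identity whenever $\alpha$ is. Cosmoi. An $\infty$-cosmos is a simplicially enriched category $\mathcal C$ with a class of morphisms, called isofibrations, closed under composition and containing the isomorphisms, such that: (i) each hom $\mathcal C(A,B)$ is a quasicategory; (ii) for each isofibration $p\colon B\to C$ and each object $A$, $\mathcal C(A,p)$ is an isofibration of quasicategories (it has the right lifting property against the inner horn inclusions and against the inclusion of a vertex into the nerve of the free-living isomorphism); (iii) $\mathcal C$ has, as simplicially enriched limits, products, powers by simplicial sets, pullbacks along isofibrations, and limits of towers $\cdots\to A_2\to A_1\to A_0$ of isofibrations; (iv) the isofibrations are stable under pullback and closed under products; the projections from the limit of a tower of isofibrations are isofibrations; for every monomorphism $i\colon X\to Y$ of simplicial sets and every isofibration $p\colon A\to B$ the Leibniz power $A^Y\to A^X\times_{B^X}B^Y$ is an isofibration; and every map with terminal codomain is an isofibration. An $\infty$-cosmos is Cauchy-complete if idempotents split in it and every retract of an isofibration is an isofibration.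 A (Cauchy-complete) 2-cosmos is a 2-category $\mathcal K$ together with a (Cauchy-complete) $\infty$-cosmos structure on $n\mathcal K$. Theorem. Let $\mathcal K$ be a 2-category. Then $\mathcal K$ has flexible limits if and only if the normal isofibrations equip $\mathcal K$ with the structure of a Cauchy-complete 2-cosmos. -/

import Mathlib

open CategoryTheory Bicategory Limits Opposite

universe v u

/-! ### 2-categories, 2-functors, 2-natural transformations

A 2-category is a strict bicategory, a 2-functor is a strict pseudofunctor. -/

/-- A 2-natural transformation between 2-functors: the 1-cells `app a` are strictly natural in the
1-cells and compatible with the 2-cells of the source.  The morphisms `eqToHom` only identify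
1-cells that are equal by strict naturality. -/
structure TwoNatTrans {J : Type*} [Bicategory J] {C : Type*} [Bicategory C]
    (F G : StrictPseudofunctor J C) where
  app (a : J) : F.obj a ⟶ G.obj a
  naturality {a b : J} (f : a ⟶ b) : F.map f ≫ app b = app a ≫ G.map f
  naturality₂ {a b : J} {f g : a ⟶ b} (η : f ⟶ g) :
    F.map₂ η ▷ app b ≫ eqToHom (naturality g) = eqToHom (naturality f) ≫ app a ◁ G.map₂ η

/-! ### Flexible weights and weighted limits -/

/-- A weight `W : J → Cat` is flexible (that is, a cofibrant object of `[J, Cat]`) if every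
2-natural transformation `u : W → F` lifts, by a 2-natural transformation, through every 2-natural
transformation `p : E → F` each of whose components is fully faithful and surjective on objects. -/
def IsFlexible {J : Type v} [Bicategory.{v, v} J] (W : StrictPseudofunctor J Cat.{v, v}) : Prop :=
  ∀ (E F : StrictPseudofunctor J Cat.{v, v}) (p : TwoNatTrans E F),
    (∀ a, (p.app a).toFunctor.Full ∧ (p.app a).toFunctor.Faithful ∧
      Function.Surjective (p.app a).toFunctor.obj) →
    ∀ u : TwoNatTrans W F, ∃ w : TwoNatTrans W E, ∀ a, w.app a ≫ p.app a = u.app a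

section WeightedLimits

variable {J : Type v} [Bicategory.{v, v} J] [Bicategory.Strict J]
  {K : Type u} [Bicategory.{v, v} K] [Bicategory.Strict K]

/-- A cylinder with vertex `X`: a 2-natural transformation from the weight `W` to the 2-functor
`K(X, D -) : J → Cat`.  Its components are functors `W a ⥤ K(X, D a)`, strictly natural in the
1-cells `f : a ⟶ b` of `J` and compatible with the 2-cells of `J`.  The 2-cells related by `HEq`
have equal boundaries by strict naturality. -/
structure Cylinder (W : StrictPseudofunctor J Cat.{v, v}) (D : StrictPseudofunctor J K)
    (X : K) where
  app (a : J) : W.obj a ⥤ (X ⟶ D.obj a)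
  naturality {a b : J} (f : a ⟶ b) :
    (W.map f).toFunctor ⋙ app b = app a ⋙ postcomp X (D.map f)
  naturality₂ {a b : J} {f g : a ⟶ b} (η : f ⟶ g) (w : W.obj a) :
    HEq ((app b).map ((W.map₂ η).toNatTrans.app w)) ((app a).obj w ◁ D.map₂ η)

/-- The cylinder `ξ` with vertex `L` exhibits `L` as the limit of the 2-functor `D` weighted by
`W`: for every `X`, composition with `ξ` is an isomorphism of categories from `K(X, L)` to the
category of 2-natural transformations `W → K(X, D -)` and modifications between them. -/
structure IsWeightedLimit {W : StrictPseudofunctor J Cat.{v, v}} {D : StrictPseudofunctor J K}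
    {L : K} (ξ : Cylinder W D L) : Prop where
  /-- bijectivity on objects -/
  existsUnique_hom (X : K) (ζ : Cylinder W D X) :
    ∃! x : X ⟶ L, ∀ a, ζ.app a = ξ.app a ⋙ precomp (D.obj a) x
  /-- bijectivity on morphisms: a modification `Γ` between the composites of `ξ` with `x` and with
  `y` is induced by a unique 2-cell `x ⟶ y` -/
  existsUnique_hom₂ {X : K} (x y : X ⟶ L)
    (Γ : ∀ a, ξ.app a ⋙ precomp (D.obj a) x ⟶ ξ.app a ⋙ precomp (D.obj a) y)
    (hΓ : ∀ {a b : J} (f : a ⟶ b) (w : W.obj a),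
      HEq ((Γ b).app ((W.map f).toFunctor.obj w)) ((Γ a).app w ▷ D.map f)) :
    ∃! α : x ⟶ y, ∀ a (w : W.obj a), (Γ a).app w = α ▷ (ξ.app a).obj w

end WeightedLimits

/-- A 2-category has flexible limits if it has all limits of small diagrams weighted by flexible
weights. -/
def HasFlexibleLimits (K : Type u) [Bicategory.{v, v} K] [Bicategory.Strict K] : Prop :=
  ∀ (J : Type v) [Bicategory.{v, v} J] [Bicategory.Strict J]
    (W : StrictPseudofunctor J Cat.{v, v}), IsFlexible W → ∀ D : StrictPseudofunctor J K,
      ∃ (L : K) (ξ : Cylinder W D L), IsWeightedLimit ξ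

/-! ### Normal isofibrations -/

section NormalIsofibrations

variable {K : Type u} [Bicategory.{v, v} K] [Bicategory.Strict K]

/-- A 1-cell `f : A ⟶ B` is a representable isofibration if every invertible 2-cell
`α : g ≫ f ≅ h` lifts to an invertible 2-cell `α' : g ≅ h'` with `h' ≫ f = h` and `α' ▷ f = α`. -/
def IsRepresentableIsofibration {A B : K} (f : A ⟶ B) : Prop :=
  ∀ (X : K) (g : X ⟶ A) (h : X ⟶ B) (α : g ≫ f ≅ h),
    ∃ (h' : X ⟶ A) (α' : g ≅ h') (e : h' ≫ f = h), α'.hom ▷ f ≫ eqToHom e = α.hom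

/-- A cleavage for `f`: a choice of liftings of invertible 2-cells `α : g ≫ f ≅ h` that is natural
in the domain `X` of `g` and `h`. -/
structure Cleavage {A B : K} (f : A ⟶ B) where
  lift {X : K} (g : X ⟶ A) (h : X ⟶ B) (α : g ≫ f ≅ h) : X ⟶ A
  liftIso {X : K} (g : X ⟶ A) (h : X ⟶ B) (α : g ≫ f ≅ h) : g ≅ lift g h α
  lift_comp {X : K} (g : X ⟶ A) (h : X ⟶ B) (α : g ≫ f ≅ h) : lift g h α ≫ f = h
  liftIso_whiskerRight {X : K} (g : X ⟶ A) (h : X ⟶ B) (α : g ≫ f ≅ h) :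
    (liftIso g h α).hom ▷ f ≫ eqToHom (lift_comp g h α) = α.hom
  lift_natural {X Y : K} (k : Y ⟶ X) (g : X ⟶ A) (h : X ⟶ B) (α : g ≫ f ≅ h) :
    lift (k ≫ g) (k ≫ h) (α_ k g f ≪≫ whiskerLeftIso k α) = k ≫ lift g h α
  liftIso_natural {X Y : K} (k : Y ⟶ X) (g : X ⟶ A) (h : X ⟶ B) (α : g ≫ f ≅ h) :
    (liftIso (k ≫ g) (k ≫ h) (α_ k g f ≪≫ whiskerLeftIso k α)).hom ≫
      eqToHom (lift_natural k g h α) = k ◁ (liftIso g h α).hom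

/-- A cleavage is normal if the chosen lifting of an identity 2-cell is an identity 2-cell. -/
def Cleavage.IsNormal {A B : K} {f : A ⟶ B} (c : Cleavage f) : Prop :=
  ∀ {X : K} (g : X ⟶ A), ∃ e : g = c.lift g (g ≫ f) (Iso.refl _),
    (c.liftIso g (g ≫ f) (Iso.refl _)).hom = eqToHom e

variable (K) in
/-- The class of normal isofibrations: representable isofibrations supporting a normal cleavage. -/
def normalIsofibrations : MorphismProperty K :=
  fun _ _ f => IsRepresentableIsofibration f ∧ ∃ c : Cleavage f, c.IsNormal

end NormalIsofibrations

/-! ### ∞-cosmoi -/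

/-- A map of quasicategories is an isofibration if it has the right lifting property against the
inner horn inclusions and against the inclusion of a vertex into the nerve of the walking
isomorphism. -/
def IsQCatIsofibration {X Y : SSet.{v}} (p : X ⟶ Y) : Prop :=
  SSet.innerFibrations p ∧ HasLiftingProperty (SSet.yonedaEquiv.symm SSet.coherentIso.x₀) p

section Simplicial

variable {C : Type u} [Category.{v} C] [SimplicialCategory C]

open SimplicialCategory
open scoped MonoidalCategory

/-- `P`, together with `c : X ⟶ C(P, A)`, is the power of the object `A` by the simplicial set `X`.
The condition says, through the Yoneda lemma in the variable `Z`, that the maps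
`C(B, P) ⟶ C(B, A)^X` induced by `c` are isomorphisms of simplicial sets. -/
def IsPower {X : SSet.{v}} {A P : C} (c : X ⟶ sHom P A) : Prop :=
  ∀ (B : C) (Z : SSet.{v}),
    Function.Bijective fun t : Z ⟶ sHom B P => (t ⊗ₘ c) ≫ sHomComp B P A

/-- `m : P ⟶ Q` is the map `p ^ i : A ^ Y ⟶ B ^ X` induced by `i : X ⟶ Y` and `p : A ⟶ B`,
for powers `c : Y ⟶ C(P, A)` and `d : X ⟶ C(Q, B)`. -/
def IsPowerMap {X Y : SSet.{v}} {A B P Q : C} (i : X ⟶ Y) (p : A ⟶ B)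
    (c : Y ⟶ sHom P A) (d : X ⟶ sHom Q B) (m : P ⟶ Q) : Prop :=
  i ≫ c ≫ eHomWhiskerLeft SSet P p = d ≫ eHomWhiskerRight SSet m B

/-- `ℓ` is a Leibniz power of `p : A ⟶ B` by `i : X ⟶ Y`: it is the map
`A ^ Y ⟶ A ^ X ×_{B ^ X} B ^ Y` induced by `A ^ i` and `p ^ Y`, for some choice of the powers and
of the pullback involved. -/
def IsLeibnizPower {X Y : SSet.{v}} (i : X ⟶ Y) {A B : C} (p : A ⟶ B)
    {AY Q : C} (ℓ : AY ⟶ Q) : Prop :=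
  ∃ (AX BX BY : C)
    (cAY : Y ⟶ sHom AY A) (cAX : X ⟶ sHom AX A) (cBX : X ⟶ sHom BX B) (cBY : Y ⟶ sHom BY B)
    (Ai : AY ⟶ AX) (pY : AY ⟶ BY) (pX : AX ⟶ BX) (Bi : BY ⟶ BX) (fst : Q ⟶ AX) (snd : Q ⟶ BY),
    IsPower cAY ∧ IsPower cAX ∧ IsPower cBX ∧ IsPower cBY ∧
    IsPowerMap i (𝟙 A) cAY cAX Ai ∧ IsPowerMap (𝟙 Y) p cAY cBY pY ∧
    IsPowerMap (𝟙 X) p cAX cBX pX ∧ IsPowerMap i (𝟙 B) cBY cBX Bi ∧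
    IsPullback fst snd pX Bi ∧ ℓ ≫ fst = Ai ∧ ℓ ≫ snd = pY

/-- A tower `⋯ ⟶ F 2 ⟶ F 1 ⟶ F 0` of morphisms in the class `W`. -/
def IsTower (W : MorphismProperty C) (F : ℕᵒᵖ ⥤ C) : Prop :=
  ∀ n : ℕ, W (F.map (homOfLE n.le_succ).op)

/-- The class `W` of isofibrations makes the simplicially enriched category `C` an ∞-cosmos.
Conical limits are limits of the underlying category preserved by all enriched representables. -/
structure IsInfinityCosmos (W : MorphismProperty C) : Prop where
  comp_mem : W.IsStableUnderComposition
  iso_mem : MorphismProperty.isomorphisms C ≤ W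
  quasicategory (A B : C) : SSet.Quasicategory (sHom A B)
  isofibration (A : C) {B B' : C} (p : B ⟶ B') :
    W p → IsQCatIsofibration (eHomWhiskerLeft SSet A p)
  hasProducts : Enriched.HasConicalProducts.{v} SSet C
  hasPowers (X : SSet.{v}) (A : C) : ∃ (P : C) (c : X ⟶ sHom P A), IsPower c
  hasPullbacks {A B B' : C} (p : A ⟶ B) (g : B' ⟶ B) : W p → Enriched.HasConicalPullback SSet p g
  hasTowerLimits (F : ℕᵒᵖ ⥤ C) : IsTower W F → Enriched.HasConicalLimit SSet F
  pullback_mem : W.IsStableUnderBaseChange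
  product_mem (I : Type v) : W.IsStableUnderProductsOfShape I
  /-- the projections from the limit of a tower of isofibrations are isofibrations -/
  tower_mem (F : ℕᵒᵖ ⥤ C) (c : Cone F) : IsTower W F → IsLimit c → ∀ n, W (c.π.app (op n))
  leibniz_mem {X Y : SSet.{v}} (i : X ⟶ Y) [Mono i] {A B : C} (p : A ⟶ B) {P Q : C} (ℓ : P ⟶ Q) :
    W p → IsLeibnizPower i p ℓ → W ℓ
  terminal_mem {A T : C} (f : A ⟶ T) : IsTerminal T → W f

/-- An ∞-cosmos is Cauchy-complete if idempotents split in it and retracts of isofibrations are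
isofibrations. -/
structure IsCauchyCompleteInfinityCosmos (W : MorphismProperty C) : Prop
    extends IsInfinityCosmos W where
  splitIdempotents : IsIdempotentComplete C
  retract_mem : W.IsStableUnderRetracts

end Simplicial

/-! ### 2-cosmoi -/

/-- The horizontal composition functor of a bicategory. -/
def compFunctor {K : Type u} [Bicategory.{v, v} K] (A B C : K) :
    (A ⟶ B) × (B ⟶ C) ⥤ (A ⟶ C) where
  obj x := x.1 ≫ x.2
  map {x y} α := α.1 ▷ x.2 ≫ y.1 ◁ α.2
  map_id := by simp
  map_comp := by simp [Bicategory.whisker_exchange_assoc]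

theorem compFunctor_assoc {K : Type u} [Bicategory.{v, v} K] [Bicategory.Strict K] {A B C D : K}
    {f f' : A ⟶ B} {g g' : B ⟶ C} {h h' : C ⟶ D} (α : f ⟶ f') (β : g ⟶ g') (γ : h ⟶ h') :
    (α ▷ g ≫ f' ◁ β) ▷ h ≫ (f' ≫ g') ◁ γ =
      eqToHom (Strict.assoc f g h) ≫ (α ▷ (g ≫ h) ≫ f' ◁ (β ▷ h ≫ g' ◁ γ)) ≫
        eqToHom (Strict.assoc f' g' h').symm := by
  rw [comp_whiskerRight, whiskerRight_comp, whisker_assoc, comp_whiskerLeft, whiskerLeft_comp]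
  simp only [Strict.associator_eqToIso]
  simp

/-- The simplicially enriched category `n K` of a 2-category `K`: it has the same underlying
category and its hom simplicial sets are the nerves of the hom categories of `K`. -/
@[reducible]
def nerveEnrichment (K : Type u) [Bicategory.{v, v} K] [Bicategory.Strict K] :
    SimplicialCategory K where
  Hom A B := nerve (A ⟶ B)
  id A := SSet.const (ComposableArrows.mk₀ (𝟙 A))
  comp A B C :=
    { app := fun n => ↾fun x => Functor.prod' x.1 x.2 ⋙ compFunctor A B C
      naturality := fun _ _ _ => rfl }
  id_comp A B := by
    ext n x
    refine CategoryTheory.Functor.ext (fun i => Strict.id_comp _) (fun i j f => ?_)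
    change (𝟙 (𝟙 A) : 𝟙 A ⟶ 𝟙 A) ▷ x.obj i ≫ 𝟙 A ◁ x.map f = eqToHom _ ≫ x.map f ≫ eqToHom _
    rw [id_whiskerRight, id_whiskerLeft, Strict.leftUnitor_eqToIso, Strict.leftUnitor_eqToIso]
    simp
  comp_id A B := by
    ext n x
    refine CategoryTheory.Functor.ext (fun i => Strict.comp_id _) (fun i j f => ?_)
    change x.map f ▷ 𝟙 B ≫ x.obj j ◁ (𝟙 (𝟙 B) : 𝟙 B ⟶ 𝟙 B) = eqToHom _ ≫ x.map f ≫ eqToHom _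
    rw [whiskerLeft_id, whiskerRight_id, Strict.rightUnitor_eqToIso, Strict.rightUnitor_eqToIso]
    simp
  assoc A B C D := by
    ext n ⟨x, y, z⟩
    refine CategoryTheory.Functor.ext (fun i => Strict.assoc _ _ _) (fun i j f => ?_)
    exact compFunctor_assoc (x.map f) (y.map f) (z.map f)
  homEquiv {A B} := nerveEquiv.symm.trans (SSet.unitHomEquiv (nerve (A ⟶ B))).symm
  homEquiv_id _ := rfl
  homEquiv_comp {A B C} f g := (SSet.unitHomEquiv (nerve (A ⟶ C))).symm_apply_eq.2
    (ComposableArrows.ext₀ rfl)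

/-- The class `W` makes the 2-category `K` a 2-cosmos, that is, `n K` an ∞-cosmos, and this
2-cosmos is Cauchy-complete. -/
def IsCauchyCompleteTwoCosmos {K : Type u} [Bicategory.{v, v} K] [Bicategory.Strict K]
    (W : MorphismProperty K) : Prop :=
  letI := nerveEnrichment K
  IsCauchyCompleteInfinityCosmos W

/-!
The invertible 2-cells of a hom-category `K(X, A)` are encoded as functors `FreeIso ⥤ K(X, A)`, and
two-dimensional limits are tested on functors `T ⥤ K(X, L)` for small categories `T`.  In this form
all the coherence 2-cells of the strict bicategory `K` disappear and both cleavages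
(`NormalLifting`, `normalIsofibrations_iff`) and universal properties become equations between
functors.  Since nerves are fully faithful and right adjoint to a product-preserving functor, the
enriched limits of the simplicially enriched category `n K` are these two-dimensional limits of `K`
(`hasConicalLimit_of_isTwoLimit`, `isTwoLimit_limitCone`, `isPower_toNerveEquiv`,
`IsPower.isTwoPower`), with powers by a simplicial set being powers by its fundamental category.

Suppose that `K` has flexible limits.  Powers and splittings of idempotents are flexible limits, as
are pseudolimits.  Products, pullbacks of normal isofibrations and limits of towers of normal
isofibrations are then obtained from pseudolimits: the chosen liftings of isomorphisms replace the
projections of the pseudolimit by a strict cone, naturality and normality of the liftings make the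
induced endomorphism of the pseudolimit idempotent, and splitting it gives the strict limit
(`IsWeightedTwoLimit.exists_isTwoLimit`).  The closure properties of normal isofibrations hold
because the liftings can be defined by the universal property of the limit in question.  For the
Leibniz power by a monomorphism `X ⟶ Y` (`normalLifting_leibniz`), the induced functor of
fundamental categories is injective on objects, and an isomorphism of functors out of a given
functor is freely determined by its components, so that the liftings at the remaining objects can
be taken from the given cleavage.

Conversely, suppose that the normal isofibrations of `K` form a Cauchy-complete 2-cosmos.  For a
functor `C ⥤ D` injective on objects, the restriction `B ^ D ⟶ B ^ C` is a normal isofibration, as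
a Leibniz power of the map from `B` to the terminal object.  Its pullbacks exist, and hence functors
`C ⥤ K(L, B)` can be extended universally along `C ⥤ D` (`HasCosmosLimits.exists_extension`).  This
allows one to adjoin morphisms between given 1-cells, by extending from the discrete category on
the objects of `D`, and to impose equations between 2-cells, by extending from two parallel arrows
to a single one.  Starting from a product, these two operations construct every limit weighted by
the free cover `coverWeight W` of a weight `W`: the category `coverWeight W b` has the pairs of a
1-cell `f : a ⟶ b` and an object `x` of `W a` as objects, and the morphisms of `W b`
(`HasCosmosLimits.exists_cover_limit`).  The projection `coverWeight W ⟶ W` is fully faithful and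
surjective on objects, so that a flexible `W` is a retract of `coverWeight W`, and the limit
weighted by `W` is obtained by splitting an idempotent (`IsWeightedLimitOnFunctors.exists_of_retract`).
-/

/-! ### Functors into the hom-categories of a 2-category -/

section FunctorCalculus

theorem heq_comp_of_heq {C : Type*} [Category* C] {X X' Y Y' Z Z' : C} (hX : X = X') (hY : Y = Y')
    (hZ : Z = Z') {f : X ⟶ Y} {f' : X' ⟶ Y'} {g : Y ⟶ Z} {g' : Y' ⟶ Z'} (hf : HEq f f')
    (hg : HEq g g') : HEq (f ≫ g) (f' ≫ g') := by
  subst hX hY hZ; cases hf; cases hg; rfl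

theorem heq_id_of_eq {C : Type*} [Category* C] {X Y : C} (h : X = Y) : HEq (𝟙 X) (𝟙 Y) := by
  subst h; rfl

theorem heq_map_of_eq {C D : Type*} [Category* C] [Category* D] {F G : C ⥤ D} (h : F = G)
    {X Y : C} (f : X ⟶ Y) : HEq (F.map f) (G.map f) := by
  subst h; rfl

theorem heq_map_of_heq {C D : Type*} [Category* C] [Category* D] (F : C ⥤ D)
    {X X' Y Y' : C} (hX : X = X') (hY : Y = Y') {f : X ⟶ Y} {f' : X' ⟶ Y'} (h : HEq f f') :
    HEq (F.map f) (F.map f') := by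
  subst hX hY; cases h; rfl

theorem eq_comp_eqToHom_iff_heq {C : Type*} [Category* C] {X Y Z : C} {f : X ⟶ Y}
    (h : Y = Z) {g : X ⟶ Z} : f ≫ eqToHom h = g ↔ HEq f g := by
  subst h; simp

variable {K : Type u} [Bicategory.{v, v} K]

theorem heq_whiskerRight {A B C : K} {f f' g g' : A ⟶ B} (hf : f = f') (hg : g = g')
    {α : f ⟶ g} {α' : f' ⟶ g'} (h : HEq α α') {k k' : B ⟶ C} (hk : k = k') :
    HEq (α ▷ k) (α' ▷ k') := by
  subst hf hg hk; cases h; rfl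

theorem heq_whiskerLeft {A B C : K} {f f' g g' : B ⟶ C} (hf : f = f') (hg : g = g')
    {α : f ⟶ g} {α' : f' ⟶ g'} (h : HEq α α') {k k' : A ⟶ B} (hk : k = k') :
    HEq (k ◁ α) (k' ◁ α') := by
  subst hf hg hk; cases h; rfl

variable [Bicategory.Strict K]

theorem whiskerRight_comp_heq {A B C D : K} {f g : A ⟶ B} (α : f ⟶ g) (h : B ⟶ C) (k : C ⟶ D) :
    HEq (α ▷ (h ≫ k)) ((α ▷ h) ▷ k) := by
  rw [whiskerRight_comp, Strict.associator_eqToIso, Strict.associator_eqToIso]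
  simp

theorem comp_whiskerLeft_heq {A B C D : K} (h : A ⟶ B) (k : B ⟶ C) {f g : C ⟶ D} (α : f ⟶ g) :
    HEq ((h ≫ k) ◁ α) (h ◁ k ◁ α) := by
  rw [comp_whiskerLeft, Strict.associator_eqToIso, Strict.associator_eqToIso]
  simp

theorem whisker_assoc_heq {A B C D : K} (h : A ⟶ B) {f g : B ⟶ C} (α : f ⟶ g) (k : C ⟶ D) :
    HEq ((h ◁ α) ▷ k) (h ◁ (α ▷ k)) := by
  rw [whisker_assoc, Strict.associator_eqToIso, Strict.associator_eqToIso]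
  simp

theorem id_whiskerLeft_heq {A B : K} {f g : A ⟶ B} (α : f ⟶ g) : HEq (𝟙 A ◁ α) α := by
  rw [id_whiskerLeft, Strict.leftUnitor_eqToIso, Strict.leftUnitor_eqToIso]
  simp

theorem whiskerRight_id_heq {A B : K} {f g : A ⟶ B} (α : f ⟶ g) : HEq (α ▷ 𝟙 B) α := by
  rw [whiskerRight_id, Strict.rightUnitor_eqToIso, Strict.rightUnitor_eqToIso]
  simp

/-- In a 2-category, composition with 1-cells is strictly functorial. -/
theorem postcomp_comp (X : K) {A B C : K} (f : A ⟶ B) (g : B ⟶ C) :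
    postcomp X (f ≫ g) = postcomp X f ⋙ postcomp X g :=
  Functor.hext (fun x => (Strict.assoc x f g).symm) fun _ _ α => whiskerRight_comp_heq α f g

theorem postcomp_id (X A : K) : postcomp X (𝟙 A) = 𝟭 _ :=
  Functor.hext (fun x => Strict.comp_id x) fun _ _ α => whiskerRight_id_heq α

theorem precomp_comp {X Y Z : K} (A : K) (k : Z ⟶ Y) (l : Y ⟶ X) :
    precomp A (k ≫ l) = precomp A l ⋙ precomp A k :=
  Functor.hext (fun x => Strict.assoc k l x) fun _ _ α => comp_whiskerLeft_heq k l α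

theorem precomp_postcomp {X Y A B : K} (k : Y ⟶ X) (f : A ⟶ B) :
    precomp A k ⋙ postcomp Y f = postcomp X f ⋙ precomp B k :=
  Functor.hext (fun x => Strict.assoc k x f) fun _ _ α => whisker_assoc_heq k α f

/-- The pointwise horizontal composite `T × W ⥤ K(X, A)` of functors `h : T ⥤ K(X, L)` and
`ξ : W ⥤ K(L, A)`. -/
abbrev hcomp {T W : Type*} [Category* T] [Category* W] {X L A : K} (h : T ⥤ (X ⟶ L))
    (ξ : W ⥤ (L ⟶ A)) : T × W ⥤ (X ⟶ A) :=
  h.prod ξ ⋙ compFunctor X L A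

section

variable {T W : Type*} [Category* T] [Category* W] {X L A : K} (h : T ⥤ (X ⟶ L))
    (ξ : W ⥤ (L ⟶ A))

theorem hcomp_postcomp {B : K} (f : A ⟶ B) :
    hcomp h ξ ⋙ postcomp X f = hcomp h (ξ ⋙ postcomp L f) :=
  Functor.hext (fun x => Strict.assoc _ _ _) fun x y α => by
    change HEq ((h.map α.1 ▷ ξ.obj x.2 ≫ h.obj y.1 ◁ ξ.map α.2) ▷ f)
      (h.map α.1 ▷ (ξ.obj x.2 ≫ f) ≫ h.obj y.1 ◁ (ξ.map α.2 ▷ f))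
    rw [comp_whiskerRight]
    exact heq_comp_of_heq (Strict.assoc _ _ _) (Strict.assoc _ _ _) (Strict.assoc _ _ _)
      (whiskerRight_comp_heq _ _ _).symm (whisker_assoc_heq _ _ _)

theorem hcomp_precomp {M : K} (k : L ⟶ M) (ξ : W ⥤ (M ⟶ A)) :
    hcomp h (ξ ⋙ precomp A k) = hcomp (h ⋙ postcomp X k) ξ :=
  Functor.hext (fun x => (Strict.assoc _ _ _).symm) fun x y α => by
    change HEq (h.map α.1 ▷ (k ≫ ξ.obj x.2) ≫ h.obj y.1 ◁ (k ◁ ξ.map α.2))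
      ((h.map α.1 ▷ k) ▷ ξ.obj x.2 ≫ (h.obj y.1 ≫ k) ◁ ξ.map α.2)
    exact heq_comp_of_heq (Strict.assoc _ _ _).symm (Strict.assoc _ _ _).symm
      (Strict.assoc _ _ _).symm
      (whiskerRight_comp_heq _ _ _) (comp_whiskerLeft_heq _ _ _).symm

theorem hcomp_const (g : L ⟶ A) :
    hcomp h ((Functor.const W).obj g) = CategoryTheory.Prod.fst T W ⋙ h ⋙ postcomp X g :=
  Functor.hext (fun _ => rfl) fun x y α => heq_of_eq <| by
    change h.map α.1 ▷ g ≫ h.obj y.1 ◁ 𝟙 g = h.map α.1 ▷ g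
    simp

theorem const_hcomp (x : X ⟶ L) :
    hcomp ((Functor.const T).obj x) ξ = CategoryTheory.Prod.snd T W ⋙ ξ ⋙ precomp A x :=
  Functor.hext (fun _ => rfl) fun a b α => heq_of_eq <| by
    change 𝟙 x ▷ _ ≫ x ◁ ξ.map α.2 = x ◁ ξ.map α.2
    simp

theorem const_comp_postcomp (g : X ⟶ L) (f : L ⟶ A) :
    (Functor.const T).obj g ⋙ postcomp X f = (Functor.const T).obj (g ≫ f) :=
  Functor.hext (fun _ => rfl) fun _ _ _ => heq_of_eq (id_whiskerRight g f)

theorem const_comp_precomp (k : X ⟶ L) (f : L ⟶ A) :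
    (Functor.const T).obj f ⋙ precomp A k = (Functor.const T).obj (k ≫ f) :=
  Functor.hext (fun _ => rfl) fun _ _ _ => heq_of_eq (whiskerLeft_id k f)

end

end FunctorCalculus

/-! ### The walking isomorphism -/

/-- The category with object set `A` and a unique morphism between any two objects.  It differs
from `Codiscrete A` only in the universe of its hom-types. -/
structure Chaotic (A : Type v) : Type v where
  as : A

namespace Chaotic

instance (A : Type v) : Category.{v} (Chaotic A) where
  Hom _ _ := PUnit
  id _ := ⟨⟩
  comp _ _ := ⟨⟩

/-- The unique morphism between two objects of a chaotic category. -/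
def hom {A : Type v} (x y : Chaotic A) : x ⟶ y := ⟨⟩

/-- The functor between chaotic categories given by a map of their objects. -/
def map {A B : Type v} (f : A → B) : Chaotic A ⥤ Chaotic B where
  obj x := ⟨f x.as⟩
  map _ := ⟨⟩

end Chaotic

/-- The walking isomorphism, with hom-types in the same universe as its objects. -/
abbrev FreeIso : Type v := Chaotic.{v} (ULift.{v} Bool)

namespace FreeIso

/-- The source of the walking isomorphism. -/
abbrev src : FreeIso.{v} := ⟨⟨false⟩⟩

/-- The target of the walking isomorphism. -/
abbrev tgt : FreeIso.{v} := ⟨⟨true⟩⟩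

variable {C : Type*} [Category* C]

/-- The isomorphism picked out by a functor from the walking isomorphism. -/
@[simps]
def toIso (F : FreeIso.{v} ⥤ C) : F.obj src ≅ F.obj tgt where
  hom := F.map (Chaotic.hom _ _)
  inv := F.map (Chaotic.hom _ _)
  hom_inv_id := by rw [← F.map_comp, ← F.map_id]; rfl
  inv_hom_id := by rw [← F.map_comp, ← F.map_id]; rfl

/-- The functor from the walking isomorphism that picks out a given isomorphism. -/
def ofIso {X Y : C} (e : X ≅ Y) : FreeIso.{v} ⥤ C where
  obj x := match x with
    | ⟨⟨false⟩⟩ => X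
    | ⟨⟨true⟩⟩ => Y
  map {x y} _ := match x, y with
    | ⟨⟨false⟩⟩, ⟨⟨false⟩⟩ => 𝟙 X
    | ⟨⟨false⟩⟩, ⟨⟨true⟩⟩ => e.hom
    | ⟨⟨true⟩⟩, ⟨⟨false⟩⟩ => e.inv
    | ⟨⟨true⟩⟩, ⟨⟨true⟩⟩ => 𝟙 Y
  map_id x := by rcases x with ⟨⟨_ | _⟩⟩ <;> rfl
  map_comp {x y z} _ _ := by
    rcases x with ⟨⟨_ | _⟩⟩ <;> rcases y with ⟨⟨_ | _⟩⟩ <;> rcases z with ⟨⟨_ | _⟩⟩ <;> simp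

theorem functor_ext {F G : FreeIso.{v} ⥤ C} (h₀ : F.obj src = G.obj src)
    (h : HEq (F.map (Chaotic.hom src tgt)) (G.map (Chaotic.hom src tgt)))
    (h₁ : F.obj tgt = G.obj tgt) : F = G := by
  have key : ∀ {X Y X' Y' : C} (e : X ≅ Y) (e' : X' ≅ Y') (_ : X = X') (_ : Y = Y')
      (_ : HEq e.hom e'.hom), HEq e.inv e'.inv := by
    rintro X Y _ _ e e' rfl rfl he
    rw [heq_eq_eq] at he ⊢
    exact (Iso.inv_eq_inv e e').2 he
  have hobj : ∀ x, F.obj x = G.obj x := by rintro ⟨⟨_ | _⟩⟩ <;> assumption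
  refine Functor.hext hobj fun x y f => ?_
  rcases x with ⟨⟨_ | _⟩⟩ <;> rcases y with ⟨⟨_ | _⟩⟩
  · rw [show f = 𝟙 _ from rfl, F.map_id, G.map_id]; exact heq_id_of_eq h₀
  · exact h
  · exact key (toIso F) (toIso G) h₀ h₁ h
  · rw [show f = 𝟙 _ from rfl, F.map_id, G.map_id]; exact heq_id_of_eq h₁

theorem ofIso_comp {D : Type*} [Category* D] {X Y : C} (e : X ≅ Y) (F : C ⥤ D) :
    ofIso.{v} e ⋙ F = ofIso (F.mapIso e) :=
  functor_ext rfl HEq.rfl rfl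

theorem ofIso_refl (X : C) : ofIso.{v} (Iso.refl X) = (Functor.const _).obj X :=
  functor_ext rfl HEq.rfl rfl

/-- A functor on `FreeIso × D` is the same thing as a functor `G` on `D` together with
isomorphisms, one for each object `d` of `D`, with source `G d`. -/
theorem existsUnique_glue {D : Type*} [Category* D] (G : D ⥤ C) (s : D → FreeIso.{v} ⥤ C)
    (hs : ∀ d, (s d).obj src = G.obj d) :
    ∃! Γ : FreeIso.{v} × D ⥤ C, Functor.prod' ((Functor.const D).obj src) (𝟭 D) ⋙ Γ = G ∧
      ∀ d, Functor.prod' (𝟭 _) ((Functor.const _).obj d) ⋙ Γ = s d := by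
  -- the prescribed isomorphism from `G d` to `s d i`, along which `G` is transported to `i`
  let e : ∀ (i : FreeIso.{v}) (d : D), G.obj d ≅ (s d).obj i := fun i d =>
    eqToIso (hs d).symm ≪≫ (s d).mapIso ⟨Chaotic.hom src i, Chaotic.hom i src, rfl, rfl⟩
  refine ⟨{ obj := fun x => (s x.2).obj x.1
            map := fun {x y} f => (e x.1 x.2).inv ≫ G.map f.2 ≫ (e y.1 y.2).hom
            map_id := fun x => ?_
            map_comp := fun {x y z} f g => ?_ }, ⟨?_, ?_⟩, ?_⟩
  · rw [CategoryTheory.prod_id_snd, G.map_id, Category.id_comp, Iso.inv_hom_id]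
  · rw [CategoryTheory.prod_comp_snd, G.map_comp]
    simp only [Category.assoc, Iso.hom_inv_id_assoc]
  · refine CategoryTheory.Functor.ext (fun d => hs d) fun a b f => ?_
    have hsrc : (Chaotic.hom src src : src.{v} ⟶ src) = 𝟙 _ := rfl
    simp [e, hsrc]
  · intro d
    refine Functor.hext (fun d => rfl) fun a b f => heq_of_eq ?_
    change (e a d).inv ≫ G.map (𝟙 d) ≫ (e b d).hom = (s d).map f
    rw [G.map_id, Category.id_comp]
    simp only [e, Iso.trans_inv, Functor.mapIso_inv, eqToIso.inv, Iso.trans_hom,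
      Functor.mapIso_hom, eqToIso.hom, Category.assoc, eqToHom_trans_assoc, eqToHom_refl,
      Category.id_comp]
    rw [← Functor.map_comp]; rfl
  · rintro Γ ⟨h₁, h₂⟩
    subst h₁
    obtain rfl : (fun d => Functor.prod' (𝟭 _) ((Functor.const _).obj d) ⋙ Γ) = s := funext h₂
    refine CategoryTheory.Functor.ext (fun _ => rfl) fun x y f => ?_
    simp only [e, Functor.comp_map, Functor.prod'_map, Functor.const_obj_map, Iso.trans_inv,
      Functor.mapIso_inv, eqToIso.inv, Iso.trans_hom, Functor.mapIso_hom, eqToIso.hom,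
      Functor.id_map, eqToHom_refl, Category.id_comp, Category.comp_id]
    simp only [← Γ.map_comp]
    congr 1
    ext
    · rfl
    · simp

/-- Functors on `FreeIso × D` are equal if they agree on `{src} × D` and on the isomorphisms
`FreeIso × {d}`. -/
theorem glue_ext {D : Type*} [Category* D] {Γ Γ' : FreeIso.{v} × D ⥤ C}
    (h : Functor.prod' ((Functor.const D).obj src) (𝟭 D) ⋙ Γ =
      Functor.prod' ((Functor.const D).obj src) (𝟭 D) ⋙ Γ')
    (h' : ∀ d, Functor.prod' (𝟭 _) ((Functor.const _).obj d) ⋙ Γ =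
      Functor.prod' (𝟭 _) ((Functor.const _).obj d) ⋙ Γ') : Γ = Γ' :=
  (existsUnique_glue (Functor.prod' ((Functor.const D).obj src) (𝟭 D) ⋙ Γ')
    (fun d => Functor.prod' (𝟭 _) ((Functor.const _).obj d) ⋙ Γ') fun _ => rfl).unique
    ⟨h, h'⟩ ⟨rfl, fun _ => rfl⟩

end FreeIso

/-! ### Normal isofibrations as liftings of walking isomorphisms -/

section NormalLiftings

variable {K : Type u} [Bicategory.{v, v} K] [Bicategory.Strict K]

/-- A normal cleavage, reformulated without coherence 2-cells: invertible 2-cells are encoded as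
functors on the walking isomorphism, and all the conditions are equations between functors. -/
structure NormalLifting {A B : K} (f : A ⟶ B) where
  lift {X : K} (g : X ⟶ A) (β : FreeIso.{v} ⥤ (X ⟶ B)) (h : β.obj FreeIso.src = g ≫ f) :
    FreeIso.{v} ⥤ (X ⟶ A)
  lift_src {X : K} (g : X ⟶ A) (β : FreeIso.{v} ⥤ (X ⟶ B)) (h : β.obj FreeIso.src = g ≫ f) :
    (lift g β h).obj FreeIso.src = g
  lift_postcomp {X : K} (g : X ⟶ A) (β : FreeIso.{v} ⥤ (X ⟶ B))
    (h : β.obj FreeIso.src = g ≫ f) : lift g β h ⋙ postcomp X f = β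
  lift_precomp {X Y : K} (k : Y ⟶ X) (g : X ⟶ A) (β : FreeIso.{v} ⥤ (X ⟶ B))
    (h : β.obj FreeIso.src = g ≫ f) (h' : (β ⋙ precomp B k).obj FreeIso.src = (k ≫ g) ≫ f) :
    lift g β h ⋙ precomp A k = lift (k ≫ g) (β ⋙ precomp B k) h'
  lift_const {X : K} (g : X ⟶ A) :
    lift g ((Functor.const _).obj (g ≫ f)) rfl = (Functor.const _).obj g

theorem NormalLifting.lift_congr {A B : K} {f : A ⟶ B} (s : NormalLifting f) {X : K}
    {g g' : X ⟶ A} {β β' : FreeIso.{v} ⥤ (X ⟶ B)} (hg : g = g') (hβ : β = β')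
    (h : β.obj FreeIso.src = g ≫ f) (h' : β'.obj FreeIso.src = g' ≫ f) :
    s.lift g β h = s.lift g' β' h' := by
  subst hg hβ; rfl

theorem NormalLifting.lift_eq_const {A B : K} {f : A ⟶ B} (s : NormalLifting f) {X : K}
    {g : X ⟶ A} {β : FreeIso.{v} ⥤ (X ⟶ B)} (hβ : β = (Functor.const _).obj (g ≫ f))
    (h : β.obj FreeIso.src = g ≫ f) : s.lift g β h = (Functor.const _).obj g :=
  (s.lift_congr rfl hβ h rfl).trans (s.lift_const g)

/-- A normal cleavage gives liftings of walking isomorphisms. -/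
def Cleavage.normalLifting {A B : K} {f : A ⟶ B} (c : Cleavage f) (hc : c.IsNormal) :
    NormalLifting f where
  lift g β h := FreeIso.ofIso (c.liftIso g (β.obj .tgt) (eqToIso h.symm ≪≫ FreeIso.toIso β))
  lift_src _ _ _ := rfl
  lift_postcomp g β h := by
    refine FreeIso.functor_ext h.symm ?_ (c.lift_comp _ _ _)
    have := c.liftIso_whiskerRight g (β.obj .tgt) (eqToIso h.symm ≪≫ FreeIso.toIso β)
    rw [eq_comp_eqToHom_iff_heq] at this
    refine this.trans ?_
    simp
  lift_precomp {X Y} k g β h h' := by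
    rw [FreeIso.ofIso_comp]
    have e : eqToIso h'.symm ≪≫ FreeIso.toIso (β ⋙ precomp B k) =
        α_ k g f ≪≫ whiskerLeftIso k (eqToIso h.symm ≪≫ FreeIso.toIso β) := by
      ext
      simp only [Iso.trans_hom, eqToIso.hom, FreeIso.toIso_hom, Strict.associator_eqToIso,
        whiskerLeftIso_hom, Bicategory.whiskerLeft_comp, whiskerLeft_eqToHom, eqToHom_trans_assoc]
      rfl
    have h₁ := c.lift_natural k g (β.obj .tgt) (eqToIso h.symm ≪≫ FreeIso.toIso β)
    have h₂ := c.liftIso_natural k g (β.obj .tgt) (eqToIso h.symm ≪≫ FreeIso.toIso β)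
    rw [eq_comp_eqToHom_iff_heq] at h₂
    change _ = FreeIso.ofIso (c.liftIso (k ≫ g) (k ≫ β.obj .tgt) _)
    rw [e]
    exact FreeIso.functor_ext rfl h₂.symm h₁.symm
  lift_const g := by
    obtain ⟨e, he⟩ := hc g
    have e' : eqToIso rfl ≪≫ FreeIso.toIso
        ((Functor.const FreeIso.{v}).obj (g ≫ f)) = Iso.refl (g ≫ f) := by
      ext; simp
    change FreeIso.ofIso (c.liftIso g (g ≫ f) _) = _
    rw [e']
    refine FreeIso.functor_ext rfl ?_ e.symm
    change HEq (c.liftIso g (g ≫ f) (Iso.refl _)).hom (𝟙 g)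
    rw [he]
    exact eqToHom_heq_id_dom _ _ e

/-- Liftings of walking isomorphisms assemble to a cleavage. -/
def NormalLifting.cleavage {A B : K} {f : A ⟶ B} (s : NormalLifting f) : Cleavage f where
  lift g h α := (s.lift g (FreeIso.ofIso α) rfl).obj .tgt
  liftIso g h α := eqToIso (s.lift_src _ _ _).symm ≪≫ FreeIso.toIso (s.lift g (FreeIso.ofIso α) rfl)
  lift_comp g h α := Functor.congr_obj (s.lift_postcomp g (FreeIso.ofIso α) rfl) .tgt
  liftIso_whiskerRight {X} g h α := by
    refine (eq_comp_eqToHom_iff_heq _).2 ?_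
    have := heq_map_of_eq (s.lift_postcomp g (FreeIso.ofIso α) rfl)
      (Chaotic.hom FreeIso.src FreeIso.tgt)
    refine HEq.trans ?_ this
    rw [Iso.trans_hom, eqToIso.hom, comp_whiskerRight, eqToHom_whiskerRight]
    exact eqToHom_comp_heq _ _
  lift_natural {X Y} k g h α := by
    have e : FreeIso.ofIso.{v} (α_ k g f ≪≫ whiskerLeftIso k α) =
        FreeIso.ofIso α ⋙ precomp B k := by
      rw [FreeIso.ofIso_comp]
      refine FreeIso.functor_ext (Strict.assoc _ _ _) ?_ rfl
      rw [Strict.associator_eqToIso]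
      exact eqToHom_comp_heq _ (Strict.assoc _ _ _)
    have h' : (FreeIso.ofIso.{v} α ⋙ precomp B k).obj .src = (k ≫ g) ≫ f :=
      (Strict.assoc _ _ _).symm
    rw [s.lift_congr rfl e rfl h', ← s.lift_precomp k g _ rfl]
    rfl
  liftIso_natural {X Y} k g h α := by
    have e : FreeIso.ofIso.{v} (α_ k g f ≪≫ whiskerLeftIso k α) =
        FreeIso.ofIso α ⋙ precomp B k := by
      rw [FreeIso.ofIso_comp]
      refine FreeIso.functor_ext (Strict.assoc _ _ _) ?_ rfl
      rw [Strict.associator_eqToIso]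
      exact eqToHom_comp_heq _ (Strict.assoc _ _ _)
    have h' : (FreeIso.ofIso.{v} α ⋙ precomp B k).obj .src = (k ≫ g) ≫ f :=
      (Strict.assoc _ _ _).symm
    have e' := (s.lift_congr rfl e rfl h').trans (s.lift_precomp k g _ rfl _).symm
    refine (eq_comp_eqToHom_iff_heq _).2 ?_
    have := heq_map_of_eq e' (Chaotic.hom FreeIso.src FreeIso.tgt)
    rw [Iso.trans_hom, Iso.trans_hom, eqToIso.hom, eqToIso.hom, Bicategory.whiskerLeft_comp,
      whiskerLeft_eqToHom, eqToHom_comp_heq_iff, heq_eqToHom_comp_iff]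
    exact this

theorem NormalLifting.cleavage_isNormal {A B : K} {f : A ⟶ B} (s : NormalLifting f) :
    s.cleavage.IsNormal := by
  intro X g
  have e : FreeIso.ofIso (Iso.refl (g ≫ f)) = (Functor.const FreeIso.{v}).obj (g ≫ f) :=
    FreeIso.ofIso_refl _
  have e' := (s.lift_congr rfl e rfl rfl).trans (s.lift_const g)
  refine ⟨(Functor.congr_obj e' FreeIso.tgt).symm, ?_⟩
  have := heq_map_of_eq e' (Chaotic.hom FreeIso.src FreeIso.tgt)
  refine eq_of_heq ((eqToHom_comp_heq _ (s.lift_src _ _ _).symm).trans (this.trans ?_))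
  exact (eqToHom_heq_id_dom _ _ (Functor.congr_obj e' FreeIso.tgt).symm).symm

/-- The property of being a representable isofibration is implied by the existence of liftings. -/
theorem normalIsofibrations_iff {A B : K} (f : A ⟶ B) :
    normalIsofibrations K f ↔ Nonempty (NormalLifting f) := by
  refine ⟨fun ⟨_, c, hc⟩ => ⟨c.normalLifting hc⟩, fun ⟨s⟩ => ⟨fun X g h α => ?_, s.cleavage,
    s.cleavage_isNormal⟩⟩
  exact ⟨_, s.cleavage.liftIso g h α, s.cleavage.lift_comp g h α,
    s.cleavage.liftIso_whiskerRight g h α⟩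

/-- Liftings that are characterised by a property stable under precomposition are automatically
natural. -/
theorem NormalLifting.nonempty_of_existsUnique {A B : K} {f : A ⟶ B}
    (R : ∀ {X : K} (_ : X ⟶ A) (_ : FreeIso.{v} ⥤ (X ⟶ B)) (_ : FreeIso.{v} ⥤ (X ⟶ A)), Prop)
    (exists_unique : ∀ {X : K} (g : X ⟶ A) (β : FreeIso.{v} ⥤ (X ⟶ B)),
      β.obj FreeIso.src = g ≫ f → ∃! γ, R g β γ)
    (src_eq : ∀ {X : K} {g : X ⟶ A} {β : FreeIso.{v} ⥤ (X ⟶ B)} {γ},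
      β.obj FreeIso.src = g ≫ f → R g β γ → γ.obj FreeIso.src = g)
    (postcomp_eq : ∀ {X : K} {g : X ⟶ A} {β : FreeIso.{v} ⥤ (X ⟶ B)} {γ},
      β.obj FreeIso.src = g ≫ f → R g β γ → γ ⋙ postcomp X f = β)
    (precomp_rel : ∀ {X Y : K} (k : Y ⟶ X) {g : X ⟶ A} {β : FreeIso.{v} ⥤ (X ⟶ B)} {γ},
      β.obj FreeIso.src = g ≫ f → R g β γ → R (k ≫ g) (β ⋙ precomp B k) (γ ⋙ precomp A k))
    (const_rel : ∀ {X : K} (g : X ⟶ A),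
      R g ((Functor.const _).obj (g ≫ f)) ((Functor.const _).obj g)) :
    Nonempty (NormalLifting f) :=
  ⟨{ lift := fun g β h => (exists_unique g β h).choose
     lift_src := fun g β h => src_eq h (exists_unique g β h).choose_spec.1
     lift_postcomp := fun g β h => postcomp_eq h (exists_unique g β h).choose_spec.1
     lift_precomp := fun k g β h h' => (exists_unique _ _ h').unique
      (precomp_rel k h (exists_unique g β h).choose_spec.1) (exists_unique _ _ h').choose_spec.1
     lift_const := fun g => (exists_unique g _ rfl).unique
      (exists_unique g _ rfl).choose_spec.1 (const_rel g) }⟩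

theorem comp_postcomp_postcomp {T : Type*} [Category* T] {X A B C : K} (h : T ⥤ (X ⟶ A))
    (f : A ⟶ B) (g : B ⟶ C) :
    (h ⋙ postcomp X f) ⋙ postcomp X g = h ⋙ postcomp X (f ≫ g) := by
  rw [postcomp_comp]; rfl

theorem comp_precomp_postcomp {T : Type*} [Category* T] {X Y A B : K} (h : T ⥤ (X ⟶ A))
    (k : Y ⟶ X) (f : A ⟶ B) :
    (h ⋙ precomp A k) ⋙ postcomp Y f = (h ⋙ postcomp X f) ⋙ precomp B k := by
  rw [Functor.assoc, precomp_postcomp]; rfl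

theorem comp_precomp_precomp {T : Type*} [Category* T] {X Y Z A : K} (h : T ⥤ (X ⟶ A))
    (k : Y ⟶ X) (l : Z ⟶ Y) :
    (h ⋙ precomp A k) ⋙ precomp A l = h ⋙ precomp A (l ≫ k) := by
  rw [precomp_comp]; rfl

theorem comp_postcomp_id {T : Type*} [Category* T] {X A : K} (h : T ⥤ (X ⟶ A)) :
    h ⋙ postcomp X (𝟙 A) = h := by
  rw [postcomp_id]; rfl

theorem NormalLifting.of_iso {A B : K} (f : A ⟶ B) (f' : B ⟶ A) (h : f ≫ f' = 𝟙 A)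
    (h' : f' ≫ f = 𝟙 B) : Nonempty (NormalLifting f) :=
  ⟨{ lift := fun {X} g β _ => β ⋙ postcomp X f'
     lift_src := fun g β hg => by
      change β.obj _ ≫ f' = g
      rw [hg, Strict.assoc, h, Strict.comp_id]
     lift_postcomp := fun g β _ => by rw [comp_postcomp_postcomp, h', comp_postcomp_id]
     lift_precomp := fun k g β _ _ => (comp_precomp_postcomp _ _ _).symm
     lift_const := fun g => by rw [const_comp_postcomp, Strict.assoc, h, Strict.comp_id] }⟩

theorem NormalLifting.comp {A B C : K} {f : A ⟶ B} {g : B ⟶ C} (s : NormalLifting f)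
    (t : NormalLifting g) : Nonempty (NormalLifting (f ≫ g)) :=
  ⟨{ lift := fun {X} x β h => s.lift x (t.lift (x ≫ f) β (by rw [h, Strict.assoc]))
      (t.lift_src _ _ _)
     lift_src := fun x β h => s.lift_src _ _ _
     lift_postcomp := fun x β h => by
      rw [← comp_postcomp_postcomp, s.lift_postcomp, t.lift_postcomp]
     lift_precomp := fun k x β h h' => by
      rw [s.lift_precomp _ _ _ _ ((congrArg (k ≫ ·) (t.lift_src _ _ _)).trans
        (Strict.assoc _ _ _).symm)]
      refine s.lift_congr rfl ?_ _ _
      rw [t.lift_precomp _ _ _ _ (by rw [h', Strict.assoc, Strict.assoc, Strict.assoc])]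
      exact t.lift_congr (Strict.assoc _ _ _).symm rfl _ _
     lift_const := fun x => s.lift_eq_const (t.lift_eq_const (by rw [Strict.assoc]) _) _ }⟩

/-- A retract of a normal isofibration is a normal isofibration: lift in the larger 1-cell and
retract the result. -/
theorem NormalLifting.of_retract {A B A' B' : K} {f : A ⟶ B} {p : A' ⟶ B'} (s : NormalLifting p)
    (i : A ⟶ A') (r : A' ⟶ A) (i' : B ⟶ B') (r' : B' ⟶ B) (hi : i ≫ p = f ≫ i')
    (hr : r ≫ f = p ≫ r') (h : i ≫ r = 𝟙 A) (h' : i' ≫ r' = 𝟙 B) :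
    Nonempty (NormalLifting f) :=
  have aux {X : K} (x : X ⟶ A) (β : FreeIso.{v} ⥤ (X ⟶ B)) (hβ : β.obj .src = x ≫ f) :
      (β ⋙ postcomp X i').obj .src = (x ≫ i) ≫ p := by
    change β.obj _ ≫ i' = _
    rw [hβ, Strict.assoc, Strict.assoc, hi]
  ⟨{ lift := fun {X} x β hβ => s.lift (x ≫ i) (β ⋙ postcomp X i') (aux x β hβ) ⋙ postcomp X r
     lift_src := fun x β hβ => by
      change (s.lift _ _ _).obj _ ≫ r = x
      rw [s.lift_src, Strict.assoc, h, Strict.comp_id]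
     lift_postcomp := fun x β hβ => by
      rw [comp_postcomp_postcomp, hr, ← comp_postcomp_postcomp, s.lift_postcomp,
        comp_postcomp_postcomp, h', comp_postcomp_id]
     lift_precomp := fun k x β hβ hβ' => by
      rw [← comp_precomp_postcomp, s.lift_precomp k _ _ _
        (by rw [← comp_precomp_postcomp, aux (k ≫ x) _ hβ', Strict.assoc k])]
      congr 1
      exact s.lift_congr (Strict.assoc _ _ _).symm (comp_precomp_postcomp _ _ _).symm _ _
     lift_const := fun x => by
      rw [s.lift_eq_const (by rw [const_comp_postcomp, Strict.assoc, Strict.assoc, hi]),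
        const_comp_postcomp, Strict.assoc, h, Strict.comp_id] }⟩

/-- Every 1-cell into an object which is terminal with respect to isomorphisms is a normal
isofibration, by lifting to identities. -/
theorem NormalLifting.of_subsingleton {A B : K} (f : A ⟶ B)
    (h : ∀ X : K, Subsingleton (FreeIso.{v} ⥤ (X ⟶ B))) : Nonempty (NormalLifting f) :=
  ⟨{ lift := fun x _ _ => (Functor.const _).obj x
     lift_src := fun _ _ _ => rfl
     lift_postcomp := fun {X} _ _ _ => (h X).elim _ _
     lift_precomp := fun _ _ _ _ _ => const_comp_precomp _ _
     lift_const := fun _ => rfl }⟩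

end NormalLiftings

/-! ### Two-dimensional limits and powers, tested on functors -/

section TwoLimits

variable {K : Type u} [Bicategory.{v, v} K] [Bicategory.Strict K]

/-- The cone `c` is a limit cone in the 2-category `K`: for every small category `T` and every `X`
it induces a bijection between functors `T ⥤ K(X, c.pt)` and compatible families of functors
`T ⥤ K(X, F j)`, i.e. an isomorphism from `K(X, c.pt)` to the limit of the categories
`K(X, F j)`. -/
def IsTwoLimit {J : Type*} [Category* J] {F : J ⥤ K} (c : Cone F) : Prop :=
  ∀ (T : Type v) [Category.{v} T] (X : K) (h : ∀ j, T ⥤ (X ⟶ F.obj j)),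
    (∀ {i j : J} (a : i ⟶ j), h i ⋙ postcomp X (F.map a) = h j) →
      ∃! y : T ⥤ (X ⟶ c.pt), ∀ j, y ⋙ postcomp X (c.π.app j) = h j

/-- The commutative square formed by `fst`, `snd`, `p` and `g` is a pullback in the 2-category
`K`. -/
structure IsTwoPullback {P A B' B : K} (fst : P ⟶ A) (snd : P ⟶ B') (p : A ⟶ B) (g : B' ⟶ B) :
    Prop where
  w : fst ≫ p = snd ≫ g
  existsUnique (T : Type v) [Category.{v} T] (X : K) (h₁ : T ⥤ (X ⟶ A)) (h₂ : T ⥤ (X ⟶ B')) :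
    h₁ ⋙ postcomp X p = h₂ ⋙ postcomp X g →
      ∃! y : T ⥤ (X ⟶ P), y ⋙ postcomp X fst = h₁ ∧ y ⋙ postcomp X snd = h₂

/-- The 1-cells `π i` exhibit `P` as a product in the 2-category `K`. -/
def IsTwoProduct {I : Type*} {A : I → K} {P : K} (π : ∀ i, P ⟶ A i) : Prop :=
  ∀ (T : Type v) [Category.{v} T] (X : K) (h : ∀ i, T ⥤ (X ⟶ A i)),
      ∃! y : T ⥤ (X ⟶ P), ∀ i, y ⋙ postcomp X (π i) = h i

/-- The functor `ξ` exhibits `P` as the power of `A` by the category `W`. -/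
def IsTwoPower {W : Type*} [Category* W] {A P : K} (ξ : W ⥤ (P ⟶ A)) : Prop :=
  ∀ (T : Type v) [Category.{v} T] (X : K) (G : T × W ⥤ (X ⟶ A)),
    ∃! y : T ⥤ (X ⟶ P), hcomp y ξ = G

theorem const_free_injective {C : Type*} [Category* C] {x y : C}
    (h : (Functor.const FreeIso.{v}).obj x = (Functor.const FreeIso.{v}).obj y) : x = y :=
  Functor.congr_obj h FreeIso.src

section

variable {J : Type*} [Category* J] {F : J ⥤ K} {c : Cone F}

theorem IsTwoLimit.functor_ext (hc : IsTwoLimit c) {T : Type v} [Category.{v} T] {X : K}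
    {y y' : T ⥤ (X ⟶ c.pt)}
    (h : ∀ j, y ⋙ postcomp X (c.π.app j) = y' ⋙ postcomp X (c.π.app j)) : y = y' :=
  (hc T X (fun j => y' ⋙ postcomp X (c.π.app j))
    fun a => by rw [comp_postcomp_postcomp, ← c.w a]).unique h fun _ => rfl

theorem IsTwoLimit.isLimit (hc : IsTwoLimit c) : Nonempty (IsLimit c) := by
  have ex (s : Cone F) := (hc FreeIso.{v} s.pt (fun j => (Functor.const _).obj (s.π.app j))
    fun a => by rw [const_comp_postcomp, ← s.w a]).exists
  choose y hy using ex
  refine ⟨⟨fun s => (y s).obj .src, fun s j => ?_, fun s m hm => ?_⟩⟩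
  · exact Functor.congr_obj (hy s j) .src
  · refine const_free_injective.{v} (hc.functor_ext fun j => ?_)
    rw [const_comp_postcomp, const_comp_postcomp, hm j]
    exact congrArg _ (Functor.congr_obj (hy s j) .src).symm

/-- A limit cone of the underlying category of a diagram that admits a two-dimensional limit is
itself a two-dimensional limit. -/
theorem IsTwoLimit.of_isLimit {c' : Cone F} (hc : IsTwoLimit c) (hc' : IsLimit c') :
    IsTwoLimit c' := by
  obtain ⟨hl⟩ := hc.isLimit
  let e := hl.conePointUniqueUpToIso hc'
  have he (j : J) : e.inv ≫ c.π.app j = c'.π.app j :=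
    hl.conePointUniqueUpToIso_inv_comp hc' j
  have he' (j : J) : e.hom ≫ c'.π.app j = c.π.app j :=
    hl.conePointUniqueUpToIso_hom_comp hc' j
  intro T _ X h hh
  obtain ⟨y, hy, hu⟩ := hc T X h hh
  refine ⟨y ⋙ postcomp X e.hom, fun j => ?_, fun z hz => ?_⟩
  · rw [comp_postcomp_postcomp, ← hy j]
    exact congrArg (fun t => y ⋙ postcomp X t) (he' j)
  · rw [← hu (z ⋙ postcomp X e.inv) fun j => ?_, comp_postcomp_postcomp]
    · exact (comp_postcomp_id z).symm.trans
        (congrArg (fun t => z ⋙ postcomp X t) e.inv_hom_id.symm)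
    · rw [comp_postcomp_postcomp, ← hz j]
      exact congrArg (fun t => z ⋙ postcomp X t) (he j)

end

section

variable {P A B' B : K} {fst : P ⟶ A} {snd : P ⟶ B'} {p : A ⟶ B} {g : B' ⟶ B}

theorem IsTwoPullback.functor_ext (hP : IsTwoPullback fst snd p g) {T : Type v} [Category.{v} T]
    {X : K} {y y' : T ⥤ (X ⟶ P)} (h : y ⋙ postcomp X fst = y' ⋙ postcomp X fst)
    (h' : y ⋙ postcomp X snd = y' ⋙ postcomp X snd) : y = y' :=
  (hP.existsUnique T X (y' ⋙ postcomp X fst) (y' ⋙ postcomp X snd) (by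
    rw [comp_postcomp_postcomp, comp_postcomp_postcomp, hP.w])).unique ⟨h, h'⟩ ⟨rfl, rfl⟩

theorem IsTwoPullback.hom_ext (hP : IsTwoPullback fst snd p g) {X : K} {x x' : X ⟶ P}
    (h : x ≫ fst = x' ≫ fst) (h' : x ≫ snd = x' ≫ snd) : x = x' :=
  const_free_injective.{v} (hP.functor_ext (by rw [const_comp_postcomp, const_comp_postcomp, h])
    (by rw [const_comp_postcomp, const_comp_postcomp, h']))

theorem isTwoPullback_of_isTwoLimit {c : PullbackCone p g} (hc : IsTwoLimit c) :
    IsTwoPullback c.fst c.snd p g where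
  w := c.condition
  existsUnique T _ X h₁ h₂ h := by
    let H : ∀ j, T ⥤ (X ⟶ (cospan p g).obj j) := fun j => match j with
      | none => h₁ ⋙ postcomp X p
      | some .left => h₁
      | some .right => h₂
    have := hc T X H (fun {i j} a => ?_)
    · refine (existsUnique_congr fun y => ?_).1 this
      refine ⟨fun hy => ⟨hy .left, hy .right⟩, fun hy j => ?_⟩
      rcases j with _ | _ | _
      · change _ = h₁ ⋙ postcomp X p
        rw [← hy.1, comp_postcomp_postcomp]
        exact congrArg (fun t => y ⋙ postcomp X t) (c.condition_one)
      · exact hy.1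
      · exact hy.2
    · rcases a with _ | _ | _
      · have := (cospan p g).map_id i
        change H i ⋙ postcomp X ((cospan p g).map (𝟙 i)) = H i
        rw [this]; exact comp_postcomp_id _
      · rfl
      · exact h.symm

theorem IsTwoPullback.isTwoLimit (hP : IsTwoPullback fst snd p g) :
    IsTwoLimit (PullbackCone.mk fst snd hP.w) := by
  intro T _ X h hh
  refine (existsUnique_congr fun y => ?_).1 (hP.existsUnique T X (h .left) (h .right)
    ((hh WalkingCospan.Hom.inl).trans (hh WalkingCospan.Hom.inr).symm))
  refine ⟨fun hy j => ?_, fun hy => ⟨hy .left, hy .right⟩⟩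
  rcases j with _ | _ | _
  · rw [← hh WalkingCospan.Hom.inl]
    change y ⋙ postcomp X (fst ≫ p) = _
    exact (comp_postcomp_postcomp _ _ _).symm.trans (congrArg (· ⋙ postcomp X p) hy.1)
  · exact hy.1
  · exact hy.2

/-- Normal isofibrations are stable under pullback. -/
theorem IsTwoPullback.normalLifting (hP : IsTwoPullback fst snd p g) (s : NormalLifting p) :
    Nonempty (NormalLifting snd) := by
  have aux {X : K} (x : X ⟶ P) (β : FreeIso.{v} ⥤ (X ⟶ B')) (h : β.obj .src = x ≫ snd) :
      (β ⋙ postcomp X g).obj .src = (x ≫ fst) ≫ p := by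
    change β.obj _ ≫ g = _
    rw [h, Strict.assoc, Strict.assoc, hP.w]
  refine NormalLifting.nonempty_of_existsUnique (fun {X} x β γ => γ ⋙ postcomp X snd = β ∧
    ∃ h, γ ⋙ postcomp X fst = s.lift (x ≫ fst) (β ⋙ postcomp X g) h) ?_ ?_ ?_ ?_ ?_
  · intro X x β h
    refine (existsUnique_congr fun y => ?_).1 (hP.existsUnique _ X (s.lift (x ≫ fst) _ (aux x β h))
      β (s.lift_postcomp _ _ _))
    exact ⟨fun h' => ⟨h'.2, aux x β h, h'.1⟩, fun ⟨h₁, _, h₂⟩ => ⟨h₂, h₁⟩⟩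
  · rintro X x β γ h ⟨h₁, h', h₂⟩
    refine hP.hom_ext ?_ ?_
    · exact (Functor.congr_obj h₂ .src).trans (s.lift_src _ _ _)
    · exact (Functor.congr_obj h₁ .src).trans h
  · rintro X x β γ h ⟨h₁, -⟩
    exact h₁
  · rintro X Y k x β γ h ⟨h₁, h', h₂⟩
    refine ⟨by rw [comp_precomp_postcomp, h₁], aux _ _ (by rw [Strict.assoc, ← h]; rfl), ?_⟩
    rw [comp_precomp_postcomp, h₂, s.lift_precomp k _ _ _ (by
      rw [← comp_precomp_postcomp, aux (k ≫ x) _ (by rw [Strict.assoc, ← h]; rfl), Strict.assoc k])]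
    exact s.lift_congr (Strict.assoc _ _ _).symm (comp_precomp_postcomp _ _ _).symm _ _
  · intro X x
    refine ⟨const_comp_postcomp _ _, aux _ _ rfl, ?_⟩
    rw [s.lift_eq_const (by rw [const_comp_postcomp, Strict.assoc, Strict.assoc, hP.w]),
      const_comp_postcomp]

end

section

variable {I : Type*} {A : I → K} {P : K} {π : ∀ i, P ⟶ A i}

theorem IsTwoProduct.functor_ext (hP : IsTwoProduct π) {T : Type v} [Category.{v} T]
    {X : K} {y y' : T ⥤ (X ⟶ P)} (h : ∀ i, y ⋙ postcomp X (π i) = y' ⋙ postcomp X (π i)) :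
    y = y' :=
  (hP T X fun i => y' ⋙ postcomp X (π i)).unique h fun _ => rfl

theorem IsTwoProduct.hom_ext (hP : IsTwoProduct π) {X : K} {x x' : X ⟶ P}
    (h : ∀ i, x ≫ π i = x' ≫ π i) : x = x' :=
  const_free_injective.{v} (hP.functor_ext fun i => by
    rw [const_comp_postcomp, const_comp_postcomp, h])

theorem isTwoProduct_of_isTwoLimit {F : Discrete I ⥤ K} {c : Cone F} (hc : IsTwoLimit c) :
    IsTwoProduct fun i => c.π.app ⟨i⟩ := by
  intro T _ X h
  refine (existsUnique_congr fun y => ?_).1 (hc T X (fun j => h j.as) ?_)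
  · exact ⟨fun h i => h ⟨i⟩, fun h i => h i.as⟩
  · rintro ⟨i⟩ ⟨j⟩ a
    obtain rfl : i = j := Discrete.eq_of_hom a
    have : F.map a = 𝟙 _ := F.map_id _
    rw [this]; exact comp_postcomp_id _

/-- Normal isofibrations are closed under products. -/
theorem IsTwoProduct.normalLifting (hP : IsTwoProduct π) {A' : I → K} {P' : K} {π' : ∀ i, P' ⟶ A' i}
    (hP' : IsTwoProduct π') (f : ∀ i, A i ⟶ A' i) (s : ∀ i, NormalLifting (f i)) (φ : P ⟶ P')
    (hφ : ∀ i, φ ≫ π' i = π i ≫ f i) : Nonempty (NormalLifting φ) := by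
  have aux {X : K} (i : I) (x : X ⟶ P) (β : FreeIso.{v} ⥤ (X ⟶ P')) (h : β.obj .src = x ≫ φ) :
      (β ⋙ postcomp X (π' i)).obj .src = (x ≫ π i) ≫ f i := by
    change β.obj _ ≫ π' i = _
    rw [h, Strict.assoc, Strict.assoc, hφ]
  refine NormalLifting.nonempty_of_existsUnique (fun {X} x β γ => ∀ i, ∃ h,
    γ ⋙ postcomp X (π i) = (s i).lift (x ≫ π i) (β ⋙ postcomp X (π' i)) h) ?_ ?_ ?_ ?_ ?_
  · intro X x β h
    refine (existsUnique_congr fun y => ?_).1 (hP _ X fun i => (s i).lift _ _ (aux i x β h))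
    exact ⟨fun h' i => ⟨aux i x β h, h' i⟩, fun h' i => (h' i).2⟩
  · rintro X x β γ h h'
    refine hP.hom_ext fun i => ?_
    obtain ⟨h₁, h₂⟩ := h' i
    exact (Functor.congr_obj h₂ .src).trans ((s i).lift_src _ _ _)
  · rintro X x β γ h h'
    refine hP'.functor_ext fun i => ?_
    obtain ⟨h₁, h₂⟩ := h' i
    rw [comp_postcomp_postcomp, hφ, ← comp_postcomp_postcomp, h₂, (s i).lift_postcomp]
  · rintro X Y k x β γ h h' i
    obtain ⟨h₁, h₂⟩ := h' i
    have e : (β ⋙ precomp P' k).obj .src = (k ≫ x) ≫ φ := by rw [Strict.assoc, ← h]; rfl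
    refine ⟨aux i _ _ e, ?_⟩
    rw [comp_precomp_postcomp, h₂, (s i).lift_precomp k _ _ _ (by
      rw [← comp_precomp_postcomp, aux i (k ≫ x) _ e, Strict.assoc k])]
    exact (s i).lift_congr (Strict.assoc _ _ _).symm (comp_precomp_postcomp _ _ _).symm _ _
  · intro X x i
    refine ⟨aux i _ _ rfl, ?_⟩
    rw [(s i).lift_eq_const (by rw [const_comp_postcomp, Strict.assoc, Strict.assoc, hφ]),
      const_comp_postcomp]

end

section

variable {W : Type*} [Category* W] {A P : K} {ξ : W ⥤ (P ⟶ A)}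

theorem IsTwoPower.functor_ext (hξ : IsTwoPower ξ) {T : Type v} [Category.{v} T] {X : K}
    {y y' : T ⥤ (X ⟶ P)} (h : hcomp y ξ = hcomp y' ξ) : y = y' :=
  (hξ T X (hcomp y' ξ)).unique h rfl

theorem IsTwoPower.hom_ext (hξ : IsTwoPower ξ) {X : K} {x x' : X ⟶ P}
    (h : ξ ⋙ precomp A x = ξ ⋙ precomp A x') : x = x' :=
  const_free_injective.{v} (hξ.functor_ext (by rw [const_hcomp, const_hcomp, h]))

end

section

variable {T W : Type*} [Category* T] [Category* W] {X L A : K}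

theorem prod'_const_hcomp (h : T ⥤ (X ⟶ L)) (ξ : W ⥤ (L ⟶ A)) (w : W) :
    Functor.prod' (𝟭 T) ((Functor.const T).obj w) ⋙ hcomp h ξ = h ⋙ postcomp X (ξ.obj w) :=
  Functor.hext (fun _ => rfl) fun x y α => heq_of_eq <| by
    change h.map α ▷ ξ.obj w ≫ h.obj y ◁ ξ.map (𝟙 w) = h.map α ▷ ξ.obj w
    rw [ξ.map_id, whiskerLeft_id, Category.comp_id]

theorem const_prod'_hcomp (h : T ⥤ (X ⟶ L)) (ξ : W ⥤ (L ⟶ A)) (t : T) :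
    Functor.prod' ((Functor.const W).obj t) (𝟭 W) ⋙ hcomp h ξ = ξ ⋙ precomp A (h.obj t) :=
  Functor.hext (fun _ => rfl) fun x y α => heq_of_eq <| by
    change h.map (𝟙 t) ▷ ξ.obj x ≫ h.obj t ◁ ξ.map α = h.obj t ◁ ξ.map α
    rw [h.map_id, id_whiskerRight, Category.id_comp]

/-- Equality of horizontal composites with a functor on the walking isomorphism is tested at the
source of the isomorphism and at the objects of the other category. -/
theorem hcomp_glue_ext {y y' : FreeIso.{v} ⥤ (X ⟶ L)} {ξ ξ' : W ⥤ (L ⟶ A)}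
    (h : ξ ⋙ precomp A (y.obj .src) = ξ' ⋙ precomp A (y'.obj .src))
    (h' : ∀ w, y ⋙ postcomp X (ξ.obj w) = y' ⋙ postcomp X (ξ'.obj w)) :
    hcomp y ξ = hcomp y' ξ' :=
  FreeIso.glue_ext (by rw [const_prod'_hcomp, const_prod'_hcomp, h])
    fun w => by rw [prod'_const_hcomp, prod'_const_hcomp, h']

end

/-- The Leibniz power of a normal isofibration `p : A ⟶ B` by a functor `i : C ⥤ D` which is
injective on objects is a normal isofibration: the liftings at the objects in the image of `i`
are prescribed, those at the other objects are taken from the cleavage of `p`, and the values at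
the objects determine an invertible transformation out of a given functor. -/
theorem normalLifting_leibniz {C D : Type*} [Category* C] [Category* D] (i : C ⥤ D)
    (hi : Function.Injective i.obj) {A B AD AC BD BC Q : K} {p : A ⟶ B} (s : NormalLifting p)
    {ξAD : D ⥤ (AD ⟶ A)} (hAD : IsTwoPower ξAD) {ξAC : C ⥤ (AC ⟶ A)} (hAC : IsTwoPower ξAC)
    {ξBD : D ⥤ (BD ⟶ B)} (hBD : IsTwoPower ξBD) {ξBC : C ⥤ (BC ⟶ B)}
    {pC : AC ⟶ BC} {Bi : BD ⟶ BC} {fst : Q ⟶ AC} {snd : Q ⟶ BD}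
    (hQ : IsTwoPullback fst snd pC Bi) (ℓ : AD ⟶ Q)
    (hAi : ∀ c, ξAD.obj (i.obj c) = (ℓ ≫ fst) ≫ ξAC.obj c)
    (hp : ∀ d, ξAD.obj d ≫ p = (ℓ ≫ snd) ≫ ξBD.obj d)
    (hpC : ∀ c, ξAC.obj c ≫ p = pC ≫ ξBC.obj c)
    (hBi : ∀ c, ξBD.obj (i.obj c) = Bi ≫ ξBC.obj c) :
    Nonempty (NormalLifting ℓ) := by
  have aux {X : K} {x : X ⟶ AD} {β : FreeIso.{v} ⥤ (X ⟶ Q)} (h : β.obj .src = x ≫ ℓ) (d : D) :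
      (β ⋙ postcomp X (snd ≫ ξBD.obj d)).obj .src = (x ≫ ξAD.obj d) ≫ p := by
    change β.obj _ ≫ _ = _
    rw [h, Strict.assoc, Strict.assoc, hp, Strict.assoc]
  have hC {X : K} (γ : FreeIso.{v} ⥤ (X ⟶ AD)) (c : C) : γ ⋙ postcomp X (ξAD.obj (i.obj c)) =
      (γ ⋙ postcomp X ℓ) ⋙ postcomp X (fst ≫ ξAC.obj c) := by
    rw [comp_postcomp_postcomp, hAi, Strict.assoc]
  refine NormalLifting.nonempty_of_existsUnique (fun {X} x β γ => γ.obj .src = x ∧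
    γ ⋙ postcomp X ℓ = β ∧ ∀ d, (¬ ∃ c, i.obj c = d) → ∃ h, γ ⋙ postcomp X (ξAD.obj d) =
      s.lift (x ≫ ξAD.obj d) (β ⋙ postcomp X (snd ≫ ξBD.obj d)) h) ?_ ?_ ?_ ?_ ?_
  · intro X x β h
    refine existsUnique_of_exists_of_unique ?_ ?_
    -- the lifting at each object `d` of `D`: prescribed by `β` in the image of `i`, chosen outside
    · let σ : D → FreeIso.{v} ⥤ (X ⟶ A) := Function.extend i.obj
        (fun c => β ⋙ postcomp X (fst ≫ ξAC.obj c))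
        (fun d => s.lift (x ≫ ξAD.obj d) (β ⋙ postcomp X (snd ≫ ξBD.obj d)) (aux h d))
      have σi (c : C) : σ (i.obj c) = β ⋙ postcomp X (fst ≫ ξAC.obj c) := hi.extend_apply _ _ _
      have σd (d : D) (hd : ¬ ∃ c, i.obj c = d) : σ d = s.lift (x ≫ ξAD.obj d)
          (β ⋙ postcomp X (snd ≫ ξBD.obj d)) (aux h d) := Function.extend_apply' _ _ _ hd
      have hσ (d : D) : (σ d).obj .src = (ξAD ⋙ precomp A x).obj d := by
        by_cases hd : ∃ c, i.obj c = d
        · obtain ⟨c, rfl⟩ := hd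
          rw [σi]
          change β.obj _ ≫ _ = x ≫ ξAD.obj (i.obj c)
          rw [h, hAi, Strict.assoc, Strict.assoc]
        · rw [σd d hd, s.lift_src]; rfl
      obtain ⟨Γ, hΓ, hΓ'⟩ := (FreeIso.existsUnique_glue (ξAD ⋙ precomp A x) σ hσ).exists
      obtain ⟨y, rfl⟩ := (hAD _ X Γ).exists
      rw [const_prod'_hcomp] at hΓ
      simp only [prod'_const_hcomp] at hΓ'
      have hy := hAD.hom_ext hΓ
      refine ⟨y, hy, ?_, fun d hd => ⟨aux h d, (hΓ' d).trans (σd d hd)⟩⟩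
      have hsrc : (y ⋙ postcomp X ℓ).obj .src = β.obj .src := by
        rw [h, ← hy]; rfl
      have hfst : ∀ c, (y ⋙ postcomp X ℓ) ⋙ postcomp X (fst ≫ ξAC.obj c) =
          β ⋙ postcomp X (fst ≫ ξAC.obj c) := fun c => by rw [← hC, hΓ', σi]
      refine hQ.functor_ext (hAC.functor_ext (hcomp_glue_ext ?_ fun c => ?_))
        (hBD.functor_ext (hcomp_glue_ext ?_ fun d => ?_))
      · exact congrArg (fun t => ξAC ⋙ precomp A (t ≫ fst)) hsrc
      · rw [comp_postcomp_postcomp, hfst, comp_postcomp_postcomp]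
      · exact congrArg (fun t => ξBD ⋙ precomp B (t ≫ snd)) hsrc
      · rw [comp_postcomp_postcomp, comp_postcomp_postcomp, comp_postcomp_postcomp,
          ← Strict.assoc, ← hp, ← comp_postcomp_postcomp, hΓ']
        by_cases hd : ∃ c, i.obj c = d
        · obtain ⟨c, rfl⟩ := hd
          rw [σi, comp_postcomp_postcomp, hBi, Strict.assoc, hpC, ← Strict.assoc, hQ.w,
            Strict.assoc]
        · rw [σd d hd, s.lift_postcomp]
    · rintro y y' ⟨h₁, h₂, h₃⟩ ⟨h₁', h₂', h₃'⟩
      refine hAD.functor_ext (hcomp_glue_ext (by rw [h₁, h₁']) fun d => ?_)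
      by_cases hd : ∃ c, i.obj c = d
      · obtain ⟨c, rfl⟩ := hd
        rw [hC, hC, h₂, h₂']
      · rw [(h₃ d hd).2, (h₃' d hd).2]
  · exact fun _ h => h.1
  · exact fun _ h => h.2.1
  · rintro X Y k x β γ h ⟨h₁, h₂, h₃⟩
    have e : (β ⋙ precomp Q k).obj .src = (k ≫ x) ≫ ℓ := by rw [Strict.assoc, ← h]; rfl
    refine ⟨by rw [← h₁]; rfl, by rw [comp_precomp_postcomp, h₂], fun d hd => ⟨aux e d, ?_⟩⟩
    rw [comp_precomp_postcomp, (h₃ d hd).2, s.lift_precomp k _ _ _ (by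
      rw [← comp_precomp_postcomp, aux e, Strict.assoc k])]
    exact s.lift_congr (Strict.assoc _ _ _).symm (comp_precomp_postcomp _ _ _).symm _ _
  · intro X x
    refine ⟨rfl, const_comp_postcomp _ _, fun d hd => ⟨aux rfl _, ?_⟩⟩
    rw [s.lift_eq_const (by rw [const_comp_postcomp, Strict.assoc, Strict.assoc, hp, Strict.assoc]),
      const_comp_postcomp]

/-- The projections from the limit of a tower of normal isofibrations are normal isofibrations. -/
theorem IsTwoLimit.normalLifting_tower {F : ℕᵒᵖ ⥤ K}
    (s : ∀ n : ℕ, NormalLifting (F.map (homOfLE n.le_succ).op)) {c : Cone F} (hc : IsTwoLimit c)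
    (n : ℕ) : Nonempty (NormalLifting (c.π.app (op n))) := by
  have hw (m : ℕ) : c.π.app (op (m + 1)) ≫ F.map (homOfLE m.le_succ).op = c.π.app (op m) := c.w _
  have hw' (m : ℕ) : c.π.app (op (n + m)) ≫ F.map (homOfLE (Nat.le_add_left m n)).op =
    c.π.app (op m) := c.w _
  have aux {X : K} {x : X ⟶ c.pt} {m : ℕ} {γ : FreeIso.{v} ⥤ (X ⟶ F.obj (op m))}
      (h : γ.obj .src = x ≫ c.π.app (op m)) :
      γ.obj .src = (x ≫ c.π.app (op (m + 1))) ≫ F.map (homOfLE m.le_succ).op := by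
    rw [h, Strict.assoc, hw]
  refine NormalLifting.nonempty_of_existsUnique (fun {X} x β y => y.obj .src = x ∧
    y ⋙ postcomp X (c.π.app (op n)) = β ∧ ∀ m, ∃ h, y ⋙ postcomp X (c.π.app (op (n + m + 1))) =
      (s (n + m)).lift (x ≫ c.π.app (op (n + m + 1))) (y ⋙ postcomp X (c.π.app (op (n + m)))) h)
      ?_ ?_ ?_ ?_ ?_
  · intro X x β h
    refine existsUnique_of_exists_of_unique ?_ ?_
    -- above the stage `n`, the isomorphisms are lifted one step at a time
    · let γ : ∀ m, { γ : FreeIso.{v} ⥤ (X ⟶ F.obj (op (n + m))) //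
          γ.obj .src = x ≫ c.π.app (op (n + m)) } := fun m => Nat.rec ⟨β, h⟩
        (fun m γ => ⟨(s (n + m)).lift (x ≫ c.π.app (op (n + m + 1))) γ.1 (aux γ.2),
          (s (n + m)).lift_src _ _ _⟩) m
      have γs (m : ℕ) : (γ (m + 1)).1 = (s (n + m)).lift (x ≫ c.π.app (op (n + m + 1))) (γ m).1
        (aux (γ m).2) := rfl
      have hγ {m k : ℕ} (hmk : m ≤ k) : (γ k).1 ⋙ postcomp X
          (F.map (homOfLE (Nat.add_le_add_left hmk n)).op) = (γ m).1 := by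
        induction k, hmk using Nat.le_induction with
        | base =>
          have : F.map (homOfLE (Nat.add_le_add_left le_rfl n)).op = 𝟙 (F.obj (op (n + m))) :=
            F.map_id _
          rw [this, comp_postcomp_id]
        | succ k hmk ih =>
          have : F.map (homOfLE (Nat.add_le_add_left (Nat.le_succ_of_le hmk) n)).op =
              F.map (homOfLE (n + k).le_succ).op ≫
                F.map (homOfLE (Nat.add_le_add_left hmk n)).op := by
            rw [← F.map_comp]; rfl
          rw [this, ← comp_postcomp_postcomp, γs, (s (n + k)).lift_postcomp, ih]
      obtain ⟨y, hy⟩ := (hc _ X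
        (fun j => (γ j.unop).1 ⋙ postcomp X (F.map (homOfLE (Nat.le_add_left j.unop n)).op))
        (fun {i j} a => by
          have hij : j.unop ≤ i.unop := leOfHom a.unop
          rw [← hγ hij, comp_postcomp_postcomp, comp_postcomp_postcomp, ← F.map_comp,
            ← F.map_comp]
          rfl)).exists
      have hyγ (m : ℕ) : y ⋙ postcomp X (c.π.app (op (n + m))) = (γ m).1 := by
        rw [hy, ← hγ (Nat.le_add_left m n)]
      refine ⟨y, ?_, hyγ 0, fun m => ⟨(Functor.congr_obj (hyγ m) .src).trans (aux (γ m).2), ?_⟩⟩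
      · obtain ⟨hl⟩ := hc.isLimit
        refine hl.hom_ext fun j => ?_
        refine (Functor.congr_obj (hy j) .src).trans ?_
        change (γ j.unop).1.obj .src ≫ _ = _
        rw [(γ j.unop).2, Strict.assoc, hw']
      · exact (hyγ (m + 1)).trans ((s (n + m)).lift_congr rfl (hyγ m).symm _ _)
    · rintro y y' ⟨-, h₂, h₃⟩ ⟨-, h₂', h₃'⟩
      have key (m : ℕ) : y ⋙ postcomp X (c.π.app (op (n + m))) =
          y' ⋙ postcomp X (c.π.app (op (n + m))) := by
        induction m with
        | zero => exact h₂.trans h₂'.symm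
        | succ m ih =>
          refine (h₃ m).2.trans (.trans ?_ (h₃' m).2.symm)
          exact (s (n + m)).lift_congr rfl ih _ _
      refine hc.functor_ext fun j => ?_
      obtain ⟨m⟩ := j
      rw [← hw' m, ← comp_postcomp_postcomp, key, comp_postcomp_postcomp]
  · exact fun _ h => h.1
  · exact fun _ h => h.2.1
  · rintro X Y k x β γ h ⟨h₁, h₂, h₃⟩
    refine ⟨by rw [← h₁]; rfl, by rw [comp_precomp_postcomp, h₂], fun m => ?_⟩
    have e : ((γ ⋙ precomp c.pt k) ⋙ postcomp Y (c.π.app (op (n + m)))).obj .src =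
        ((k ≫ x) ≫ c.π.app (op (n + m + 1))) ≫ F.map (homOfLE (n + m).le_succ).op :=
      aux (by rw [← h₁]; rfl)
    refine ⟨e, ?_⟩
    rw [comp_precomp_postcomp, (h₃ m).2, (s _).lift_precomp k _ _ _ (by
      rw [← comp_precomp_postcomp]; exact e.trans (by rw [Strict.assoc k]))]
    exact (s _).lift_congr (Strict.assoc _ _ _).symm (comp_precomp_postcomp _ _ _).symm _ _
  · intro X x
    refine ⟨rfl, const_comp_postcomp _ _, fun m => ⟨aux rfl, ?_⟩⟩
    rw [(s _).lift_eq_const (by rw [const_comp_postcomp, Strict.assoc, hw]), const_comp_postcomp]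

end TwoLimits

/-! ### Functors on fundamental categories and maps into nerves -/

section Nerve

open MonoidalCategory

/-- Functors on the fundamental category of `Z` correspond to maps from `Z` to the nerve. -/
noncomputable def toNerveEquiv (Z : SSet.{v}) (C : Type v) [Category.{v} C] :
    (SSet.hoFunctor.obj Z ⥤ C) ≃ (Z ⟶ nerve C) :=
  (Functor.equivCatHom _ _).trans (nerveAdjunction.homEquiv Z (Cat.of C))

variable {Z : SSet.{v}} {C : Type v} [Category.{v} C]

theorem toNerveEquiv_eq (F : SSet.hoFunctor.obj Z ⥤ C) :
    toNerveEquiv Z C F = nerveAdjunction.unit.app Z ≫ nerveMap F :=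
  nerveAdjunction.homEquiv_unit _ _ _

theorem toNerveEquiv_comp {D : Type v} [Category.{v} D] (F : SSet.hoFunctor.obj Z ⥤ C)
    (G : C ⥤ D) : toNerveEquiv Z D (F ⋙ G) = toNerveEquiv Z C F ≫ nerveMap G := by
  rw [toNerveEquiv_eq, toNerveEquiv_eq]; rfl

theorem toNerveEquiv_precomp {Z' : SSet.{v}} (f : Z' ⟶ Z) (F : SSet.hoFunctor.obj Z ⥤ C) :
    toNerveEquiv Z' C ((SSet.hoFunctor.map f).toFunctor ⋙ F) = f ≫ toNerveEquiv Z C F :=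
  nerveAdjunction.homEquiv_naturality_left f F.toCatHom

theorem nerveMap_bijective (C D : Type v) [Category.{v} C] [Category.{v} D] :
    Function.Bijective (nerveMap : (C ⥤ D) → (nerve C ⟶ nerve D)) := by
  refine ⟨fun F G h => ?_, fun f => ?_⟩
  · have := nerveFunctor.map_injective (X := Cat.of C) (Y := Cat.of D)
      (a₁ := F.toCatHom) (a₂ := G.toCatHom) h
    exact congrArg Cat.Hom.toFunctor this
  · obtain ⟨F, hF⟩ := nerveFunctor.map_surjective (X := Cat.of C) (Y := Cat.of D) f
    exact ⟨F.toFunctor, hF⟩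

/-- The comparison from the fundamental category of a product to the product of the fundamental
categories. -/
noncomputable abbrev hoProd (Z X : SSet.{v}) :
    SSet.hoFunctor.obj (Z ⊗ X) ⥤ SSet.hoFunctor.obj Z × SSet.hoFunctor.obj X :=
  (SSet.hoFunctor.map (SemiCartesianMonoidalCategory.fst Z X)).toFunctor.prod'
    (SSet.hoFunctor.map (SemiCartesianMonoidalCategory.snd Z X)).toFunctor

/-- The fundamental category functor preserves binary products strictly. -/
theorem exists_hoProd_inverse (Z X : SSet.{v}) :
    ∃ G : SSet.hoFunctor.obj Z × SSet.hoFunctor.obj X ⥤ SSet.hoFunctor.obj (Z ⊗ X),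
      hoProd Z X ⋙ G = 𝟭 _ ∧ G ⋙ hoProd Z X = 𝟭 _ :=
  ⟨SSet.Truncated.HomotopyCategory.BinaryProduct.inverse ((SSet.truncation 2).obj Z)
    ((SSet.truncation 2).obj X),
    SSet.Truncated.HomotopyCategory.BinaryProduct.functor_comp_inverse ((SSet.truncation 2).obj Z)
      ((SSet.truncation 2).obj X),
    SSet.Truncated.HomotopyCategory.BinaryProduct.inverse_comp_functor ((SSet.truncation 2).obj Z)
      ((SSet.truncation 2).obj X)⟩

end Nerve

/-! ### Conical limits and powers in the nerve enrichment -/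

section Enriched

variable {K : Type u} [Bicategory.{v, v} K] [Bicategory.Strict K]

attribute [local instance] nerveEnrichment

open SimplicialCategory

theorem eHomWhiskerLeft_eq_nerveMap (X : K) {A B : K} (f : A ⟶ B) :
    eHomWhiskerLeft SSet X f = nerveMap (postcomp X f) := by
  ext n x
  refine Functor.hext (fun _ => rfl) fun i j a => heq_of_eq ?_
  change x.map a ▷ f ≫ x.obj j ◁ 𝟙 f = x.map a ▷ f
  simp

theorem eHomWhiskerRight_eq_nerveMap {X Y : K} (k : Y ⟶ X) (A : K) :
    eHomWhiskerRight SSet k A = nerveMap (precomp A k) := by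
  ext n x
  refine Functor.hext (fun _ => rfl) fun i j a => heq_of_eq ?_
  change 𝟙 k ▷ x.obj i ≫ k ◁ x.map a = k ◁ x.map a
  simp

theorem toNerveEquiv_app {Z : SSet.{v}} {C : Type v} [Category.{v} C]
    (F : SSet.hoFunctor.obj Z ⥤ C) (n : SimplexCategoryᵒᵖ) (z : Z.obj n) :
    (toNerveEquiv Z C F).app n z = ((nerveAdjunction.unit.app Z).app n z : _ ⥤ _) ⋙ F := by
  rw [toNerveEquiv_eq]; rfl

theorem nerveAdjunction_unit_app {Z Z' : SSet.{v}} (f : Z ⟶ Z') (n : SimplexCategoryᵒᵖ)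
    (z : Z.obj n) : (nerveAdjunction.unit.app Z').app n (f.app n z) =
      ((nerveAdjunction.unit.app Z).app n z : _ ⥤ _) ⋙ (SSet.hoFunctor.map f).toFunctor :=
  ConcreteCategory.congr_hom (NatTrans.congr_app (nerveAdjunction.unit.naturality f) n) z

open MonoidalCategory in
/-- Under the adjunction between fundamental categories and nerves, horizontal composition of
functors corresponds to composition in the enriched category `n K`. -/
theorem toNerveEquiv_hcomp {Z W : SSet.{v}} {X L A : K} (y : SSet.hoFunctor.obj Z ⥤ (X ⟶ L))
    (ξ : SSet.hoFunctor.obj W ⥤ (L ⟶ A)) :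
    toNerveEquiv (Z ⊗ W) _ (hoProd Z W ⋙ hcomp y ξ) =
      (toNerveEquiv Z _ y ⊗ₘ toNerveEquiv W _ ξ) ≫ sHomComp X L A := by
  ext n ⟨z, w⟩
  have e₁ := nerveAdjunction_unit_app (SemiCartesianMonoidalCategory.fst Z W) n (z, w)
  have e₂ := nerveAdjunction_unit_app (SemiCartesianMonoidalCategory.snd Z W) n (z, w)
  refine (toNerveEquiv_app (hoProd Z W ⋙ hcomp y ξ) n (show (Z ⊗ W).obj n from (z, w))).trans ?_
  change _ = Functor.prod' ((toNerveEquiv Z _ y).app n z : _ ⥤ _)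
    ((toNerveEquiv W _ ξ).app n w : _ ⥤ _) ⋙ compFunctor X L A
  refine Eq.trans ?_ (congrArg₂ (fun a b => Functor.prod' a b ⋙ compFunctor X L A)
    (toNerveEquiv_app y n z).symm (toNerveEquiv_app ξ n w).symm)
  refine Eq.trans ?_ (congrArg₂ (fun (a : _ ⥤ _) (b : _ ⥤ _) =>
    Functor.prod' (a ⋙ y) (b ⋙ ξ) ⋙ compFunctor X L A) e₁.symm e₂.symm)
  rfl

/-- Maps from a simplicial set `Z` to the nerve of `K(X, -)` are functors on the fundamental
category of `Z`, so that two-dimensional limits in `K` are enriched conical limits in `n K`. -/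
theorem hasConicalLimit_of_isTwoLimit {J : Type*} [Category* J] {F : J ⥤ K} {c : Cone F}
    (hc : IsTwoLimit c) : Enriched.HasConicalLimit SSet.{v} F := by
  obtain ⟨hl⟩ := hc.isLimit
  have : HasLimit F := ⟨⟨⟨c, hl⟩⟩⟩
  refine { preservesLimit_eCoyoneda := fun X => ?_ }
  refine preservesLimit_of_preserves_limit_cone hl ?_
  have ex (s : Cone (F ⋙ eCoyoneda SSet X)) := (hc (SSet.hoFunctor.obj s.pt) X
    (fun j => (toNerveEquiv s.pt (X ⟶ F.obj j)).symm (s.π.app j)) (fun {i j} a =>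
      (Equiv.eq_symm_apply _).2 <| (toNerveEquiv_comp _ _).trans <|
        (congrArg (· ≫ nerveMap (postcomp X (F.map a))) (Equiv.apply_symm_apply _ _)).trans <|
          (congrArg (s.π.app i ≫ ·) (eHomWhiskerLeft_eq_nerveMap X (F.map a)).symm).trans (s.w a)))
  refine ⟨fun s => toNerveEquiv _ _ (ex s).choose, fun s j => ?_, fun s m hm => ?_⟩
  · refine Eq.trans ?_ ((Equiv.eq_symm_apply _).1 ((ex s).choose_spec.1 j))
    refine Eq.trans ?_ (toNerveEquiv_comp _ _).symm
    exact congrArg (_ ≫ ·) (eHomWhiskerLeft_eq_nerveMap X (c.π.app j))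
  · refine (Equiv.symm_apply_eq _).1 ((ex s).choose_spec.2 _ fun j => ?_)
    refine (Equiv.eq_symm_apply _).2 ((toNerveEquiv_comp _ _).trans ?_)
    refine (congrArg (· ≫ nerveMap (postcomp X (c.π.app j))) (Equiv.apply_symm_apply _ _)).trans ?_
    exact (congrArg (m ≫ ·) (eHomWhiskerLeft_eq_nerveMap X (c.π.app j)).symm).trans (hm j)

/-- The nerve is fully faithful, so that enriched conical limits in `n K` are two-dimensional limits
in `K`. -/
theorem isTwoLimit_limitCone {J : Type*} [Category* J] (F : J ⥤ K)
    [Enriched.HasConicalLimit SSet.{v} F] : IsTwoLimit (limit.cone F) := by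
  intro T _ X h hh
  have hl := isLimitOfPreserves (eCoyoneda SSet X) (limit.isLimit F)
  let s : Cone (F ⋙ eCoyoneda SSet.{v} X) :=
    { pt := nerve T
      π := { app := fun j => nerveMap (h j)
             naturality := fun i j a => by
              rw [← hh a]
              exact (congrArg (nerveMap (h i) ≫ ·)
                (eHomWhiskerLeft_eq_nerveMap X (F.map a))).symm } }
  obtain ⟨y, hy⟩ := (nerveMap_bijective T (X ⟶ limit F)).2 (hl.lift s)
  refine ⟨y, fun j => (nerveMap_bijective _ _).1 ?_, fun z hz => (nerveMap_bijective _ _).1 ?_⟩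
  · refine Eq.trans ?_ (hl.fac s j)
    rw [← hy]
    exact congrArg (nerveMap y ≫ ·) (eHomWhiskerLeft_eq_nerveMap X _).symm
  · rw [hy]
    refine hl.uniq s _ fun j => ?_
    change _ = nerveMap (h j)
    rw [← hz j]
    exact congrArg (nerveMap z ≫ ·) (eHomWhiskerLeft_eq_nerveMap X _)

open MonoidalCategory in
/-- A power in `K` by the fundamental category of `W` is a power in `n K` by the simplicial set
`W`. -/
theorem isPower_toNerveEquiv {W : SSet.{v}} {A P : K} {ξ : SSet.hoFunctor.obj W ⥤ (P ⟶ A)}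
    (hξ : IsTwoPower ξ) : IsPower (X := W) (A := A) (P := P) (toNerveEquiv W _ ξ) := by
  intro X Z
  obtain ⟨G, hG, hG'⟩ := exists_hoProd_inverse Z W
  refine (Function.bijective_iff_existsUnique _).2 fun g => ?_
  obtain ⟨y, hy, hu⟩ := hξ (SSet.hoFunctor.obj Z) X (G ⋙ (toNerveEquiv (Z ⊗ W) _).symm g)
  refine ⟨toNerveEquiv Z _ y, ?_, fun t ht => ?_⟩
  · have e : hoProd Z W ⋙ hcomp y ξ = (toNerveEquiv (Z ⊗ W) _).symm g := by
      rw [hy, ← Functor.assoc, hG]; rfl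
    exact (toNerveEquiv_hcomp y ξ).symm.trans ((Equiv.eq_symm_apply _).1 e)
  · refine (Equiv.symm_apply_eq (toNerveEquiv Z (X ⟶ P))).1 (hu _ ?_)
    have e : toNerveEquiv (Z ⊗ W) _ (hoProd Z W ⋙ hcomp ((toNerveEquiv Z _).symm t) ξ) = g := by
      refine (toNerveEquiv_hcomp _ ξ).trans (Eq.trans ?_ ht)
      exact congrArg (fun s => (s ⊗ₘ toNerveEquiv W _ ξ) ≫ sHomComp X P A)
        (Equiv.apply_symm_apply _ _)
    rw [← (Equiv.eq_symm_apply _).2 e]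
    change _ = (G ⋙ hoProd Z W) ⋙ hcomp ((toNerveEquiv Z (X ⟶ P)).symm t) ξ
    rw [hG']
    rfl

/-- The fundamental category of the nerve of `T` is isomorphic to `T`. -/
theorem exists_hoFunctor_nerve_iso (T : Type v) [Category.{v} T] :
    ∃ (p : SSet.hoFunctor.obj (nerve T) ⥤ T) (q : T ⥤ SSet.hoFunctor.obj (nerve T)),
      p ⋙ q = 𝟭 _ ∧ q ⋙ p = 𝟭 _ :=
  let e := nerveFunctorCompHoFunctorIso.app (Cat.of T)
  ⟨e.hom.toFunctor, e.inv.toFunctor, congrArg Cat.Hom.toFunctor e.hom_inv_id,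
    congrArg Cat.Hom.toFunctor e.inv_hom_id⟩

open MonoidalCategory in
/-- A power in `n K` by the simplicial set `W` is a power in `K` by the fundamental category of
`W`. -/
theorem IsPower.isTwoPower {W : SSet.{v}} {A P : K} {c : W ⟶ sHom P A} (hc : IsPower c) :
    IsTwoPower ((toNerveEquiv W (P ⟶ A)).symm c) := by
  intro T _ X g
  obtain ⟨p, q, hpq, hqp⟩ := exists_hoFunctor_nerve_iso T
  obtain ⟨G, hG, hG'⟩ := exists_hoProd_inverse (nerve T) W
  set ξ := (toNerveEquiv W (P ⟶ A)).symm c with hξ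
  have key (y : T ⥤ (X ⟶ P)) : hcomp y ξ = g ↔
      (toNerveEquiv _ _ (p ⋙ y) ⊗ₘ c) ≫ sHomComp X P A =
        toNerveEquiv (nerve T ⊗ W) _ (hoProd (nerve T) W ⋙ p.prod (𝟭 _) ⋙ g) := by
    have e : (toNerveEquiv _ _ (p ⋙ y) ⊗ₘ c) ≫ sHomComp X P A =
        toNerveEquiv (nerve T ⊗ W) _ (hoProd (nerve T) W ⋙ p.prod (𝟭 _) ⋙ hcomp y ξ) := by
      refine Eq.trans ?_ (toNerveEquiv_hcomp (p ⋙ y) ξ).symm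
      rw [hξ]
      exact congrArg (fun s => (toNerveEquiv _ _ (p ⋙ y) ⊗ₘ s) ≫ sHomComp X P A)
        (Equiv.apply_symm_apply _ _).symm
    rw [e]
    refine ⟨fun h => by rw [h], fun h => ?_⟩
    have h := (toNerveEquiv _ _).injective h
    have h' := congrArg (fun F => (q.prod (𝟭 _) ⋙ G) ⋙ F) h
    have e' (F : T × SSet.hoFunctor.obj W ⥤ (X ⟶ A)) :
        (q.prod (𝟭 _) ⋙ G) ⋙ hoProd (nerve T) W ⋙ p.prod (𝟭 _) ⋙ F = F := by
      change q.prod (𝟭 _) ⋙ (G ⋙ hoProd (nerve T) W) ⋙ p.prod (𝟭 _) ⋙ F = F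
      rw [hG']
      change (q ⋙ p).prod (𝟭 _) ⋙ F = F
      rw [hqp]
      rfl
    exact (e' _).symm.trans (h'.trans (e' _))
  obtain ⟨t, ht, hu⟩ := (Function.bijective_iff_existsUnique _).1 (hc X (nerve T))
    (toNerveEquiv (nerve T ⊗ W) _ (hoProd (nerve T) W ⋙ p.prod (𝟭 _) ⋙ g))
  have hp (F : SSet.hoFunctor.obj (nerve T) ⥤ (X ⟶ P)) : p ⋙ q ⋙ F = F := by
    change (p ⋙ q) ⋙ F = F
    rw [hpq]; rfl
  refine ⟨q ⋙ (toNerveEquiv _ _).symm t, (key _).2 ?_, fun y hy => ?_⟩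
  · rw [hp]
    refine Eq.trans ?_ ht
    exact congrArg (fun s => (s ⊗ₘ c) ≫ sHomComp X P A) (Equiv.apply_symm_apply _ _)
  · have := hu _ ((key y).1 hy)
    rw [← (Equiv.eq_symm_apply _).2 this]
    change _ = (q ⋙ p) ⋙ y
    rw [hqp]; rfl

theorem IsPowerMap.comp_eq {W Z : SSet.{v}} {A B P Q : K} {i : W ⟶ Z} {p : A ⟶ B}
    {c : Z ⟶ sHom P A} {d : W ⟶ sHom Q B} {m : P ⟶ Q} (h : IsPowerMap i p c d m) :
    (SSet.hoFunctor.map i).toFunctor ⋙ (toNerveEquiv Z (P ⟶ A)).symm c ⋙ postcomp P p =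
      (toNerveEquiv W (Q ⟶ B)).symm d ⋙ precomp B m := by
  refine (toNerveEquiv W (P ⟶ B)).injective ?_
  refine (toNerveEquiv_precomp i _).trans ?_
  refine (congrArg (i ≫ ·) (toNerveEquiv_comp _ _)).trans ?_
  refine Eq.trans ?_ (toNerveEquiv_comp _ _).symm
  refine (congrArg (fun s => i ≫ s ≫ nerveMap (postcomp P p)) (Equiv.apply_symm_apply _ c)).trans ?_
  refine Eq.trans ?_ (congrArg (· ≫ nerveMap (precomp B m)) (Equiv.apply_symm_apply _ d).symm)
  refine Eq.trans ?_ (h.trans ?_)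
  · exact congrArg (fun s => i ≫ c ≫ s) (eHomWhiskerLeft_eq_nerveMap P p).symm
  · exact congrArg (d ≫ ·) (eHomWhiskerRight_eq_nerveMap m B)

end Enriched

/-! ### Monomorphisms of simplicial sets and isofibrations of nerves -/

section Homotopy

/-- The objects of the fundamental category are the vertices. -/
theorem hoFunctor_map_obj_injective {X Y : SSet.{v}} (i : X ⟶ Y) [Mono i] :
    Function.Injective (SSet.hoFunctor.map i).toFunctor.obj := by
  have hi : Function.Injective (i.app (op (SimplexCategory.mk 0))) :=
    (mono_iff_injective _).1 inferInstance
  intro x y h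
  obtain ⟨x, rfl⟩ := (SSet.hoFunctor.obj.equiv X).symm.surjective x
  obtain ⟨y, rfl⟩ := (SSet.hoFunctor.obj.equiv X).symm.surjective y
  exact congrArg _ (hi ((SSet.hoFunctor.obj.equiv Y).symm.injective h))

/-- Maps out of an inner horn into the nerve of a category extend in at most one way to the
simplex. -/
theorem nerve_hom_ext_of_horn {C : Type v} [Category.{v} C] {n : ℕ} {i : Fin (n + 3)} (h₀ : 0 < i)
    (hₙ : i < Fin.last (n + 2))
    {f g : SSet.stdSimplex.{v}.obj (SimplexCategory.mk (n + 2)) ⟶ nerve C}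
    (h : (SSet.horn.{v} (n + 2) i).ι ≫ f = (SSet.horn.{v} (n + 2) i).ι ≫ g) : f = g := by
  refine SSet.yonedaEquiv.injective ((SSet.StrictSegal.ofIsStrictSegal (nerve C)).spineInjective ?_)
  have key (f : SSet.stdSimplex.{v}.obj (SimplexCategory.mk (n + 2)) ⟶ nerve C) :
      (nerve C).spine _ (SSet.yonedaEquiv f) =
        (SSet.horn.spineId.{v} i h₀ hₙ).map ((SSet.horn.{v} (n + 2) i).ι ≫ f) :=
    SSet.Path.ext' fun j => (NatTrans.naturality_apply f _ _).symm
  change (nerve C).spine _ _ = (nerve C).spine _ _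
  rw [key, key, h]

/-- The nerve of a functor along which isomorphisms lift is an isofibration of quasicategories. -/
theorem isQCatIsofibration_nerveMap {C D : Type v} [Category.{v} C] [Category.{v} D] (F : C ⥤ D)
    (hF : ∀ (x : C) (β : FreeIso.{v} ⥤ D), β.obj .src = F.obj x →
      ∃ γ : FreeIso.{v} ⥤ C, γ.obj .src = x ∧ γ ⋙ F = β) :
    IsQCatIsofibration (nerveMap F) := by
  constructor
  · rintro _ _ _ ⟨i, h₀, hₙ⟩
    refine ⟨fun {f g} sq => ?_⟩
    obtain ⟨l, hl⟩ := SSet.Quasicategory.hornFilling h₀ hₙ f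
    exact ⟨⟨⟨l, hl.symm, nerve_hom_ext_of_horn h₀ hₙ (by
      rw [← Category.assoc, ← hl, sq.w])⟩⟩⟩
  · refine ⟨fun {f g} sq => ?_⟩
    -- `SSet.coherentIso` is the nerve of `WalkingIso`, which is isomorphic to `FreeIso`
    let a : FreeIso.{v} ⥤ WalkingIso.{v} := { obj := fun x => ⟨x.as⟩, map := fun _ => ⟨⟩ }
    let b : WalkingIso.{v} ⥤ FreeIso.{v} := { obj := fun x => ⟨x.as⟩, map := fun _ => ⟨⟩ }
    let Na : nerve FreeIso.{v} ⟶ SSet.coherentIso.{v} := { app := fun n => ↾fun x => x ⋙ a }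
    let Nb : SSet.coherentIso.{v} ⟶ nerve FreeIso.{v} := { app := fun n => ↾fun x => x ⋙ b }
    have hb : Nb.app _ SSet.coherentIso.x₀ = ComposableArrows.mk₀ FreeIso.src.{v} :=
      ComposableArrows.ext₀ rfl
    have ha : Na.app (op (SimplexCategory.mk 0)) (ComposableArrows.mk₀ FreeIso.src.{v}) =
        SSet.coherentIso.x₀ :=
      ComposableArrows.ext₀ rfl
    obtain ⟨β, hβ⟩ := (nerveMap_bijective _ _).2 (Na ≫ g)
    let x : C := (SSet.yonedaEquiv f).obj 0
    have hx : SSet.yonedaEquiv f = ComposableArrows.mk₀ x := ComposableArrows.ext₀ rfl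
    have hw := congrArg SSet.yonedaEquiv sq.w
    rw [SSet.yonedaEquiv_comp, SSet.yonedaEquiv_comp, Equiv.apply_symm_apply, hx] at hw
    have hβ' := congrArg (fun h => h.app (op (SimplexCategory.mk 0))
      (ComposableArrows.mk₀ FreeIso.src.{v})) hβ
    replace hβ' := hβ'.trans (congrArg (fun y => g.app _ y) ha)
    obtain ⟨γ, hγ, hγ'⟩ := hF x β (Functor.congr_obj (hβ'.trans hw.symm) 0)
    refine ⟨⟨⟨Nb ≫ nerveMap γ, ?_, ?_⟩⟩⟩
    · refine SSet.yonedaEquiv.injective ?_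
      rw [SSet.yonedaEquiv_comp, Equiv.apply_symm_apply, hx]
      refine (congrArg (fun y => (nerveMap γ).app _ y) hb).trans ?_
      exact ComposableArrows.ext₀ hγ
    · change Nb ≫ nerveMap (γ ⋙ F) = g
      rw [hγ', hβ]
      rfl

end Homotopy

/-! ### The universal property of weighted limits for functors out of small categories -/

section WeightedUniversal

variable {J : Type v} [Bicategory.{v, v} J] [Bicategory.Strict J]
  {K : Type u} [Bicategory.{v, v} K] [Bicategory.Strict K]
  {W : StrictPseudofunctor J Cat.{v, v}} {D : StrictPseudofunctor J K} {L : K} {ξ : Cylinder W D L}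

/-- A functor from `T` to the category of cylinders with vertex `X`, written as a family of functors
`G a : T × W a ⥤ K(X, D a)`, is induced by a unique functor from `T` to `K(X, L)`. -/
theorem IsWeightedLimit.existsUnique (hξ : IsWeightedLimit ξ) {T : Type*} [Category* T] {X : K}
    (G : ∀ a, T × W.obj a ⥤ (X ⟶ D.obj a))
    (hG : ∀ {a b : J} (f : a ⟶ b),
      (𝟭 T).prod (W.map f).toFunctor ⋙ G b = G a ⋙ postcomp X (D.map f))
    (hG₂ : ∀ {a b : J} {f g : a ⟶ b} (η : f ⟶ g) (t : T) (w : W.obj a),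
      HEq ((Functor.prod' ((Functor.const _).obj t) (𝟭 _) ⋙ G b).map ((W.map₂ η).toNatTrans.app w))
        ((G a).obj (t, w) ◁ D.map₂ η)) :
    ∃! y : T ⥤ (X ⟶ L), ∀ a, hcomp y (ξ.app a) = G a := by
  let S (a : J) (t : T) : W.obj a ⥤ (X ⟶ D.obj a) :=
    Functor.prod' ((Functor.const _).obj t) (𝟭 _) ⋙ G a
  have ex (t : T) := hξ.existsUnique_hom X
    { app := fun a => S a t
      naturality := fun f =>
        congrArg (fun F => Functor.prod' ((Functor.const _).obj t) (𝟭 _) ⋙ F) (hG f)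
      naturality₂ := fun η w => hG₂ η t w }
  choose x hx hxu using ex
  have hx' (t : T) (a : J) (w : W.obj a) : (G a).obj (t, w) = x t ≫ (ξ.app a).obj w :=
    Functor.congr_obj (hx t a) w
  -- the modification given by a morphism of `T`, and its transport to the composites with `ξ`
  let N (a : J) {t t' : T} (α : t ⟶ t') : S a t ⟶ S a t' :=
    { app := fun w => (G a).map ((α, 𝟙 w) : (t, w) ⟶ (t', w))
      naturality := fun w w' m => by
        change (G a).map _ ≫ (G a).map _ = (G a).map _ ≫ (G a).map _
        rw [← (G a).map_comp, ← (G a).map_comp]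
        exact congrArg _ (Prod.ext ((Category.id_comp α).trans (Category.comp_id α).symm)
          ((Category.comp_id m).trans (Category.id_comp m).symm)) }
  let Γ {t t' : T} (α : t ⟶ t') (a : J) :
      ξ.app a ⋙ precomp (D.obj a) (x t) ⟶ ξ.app a ⋙ precomp (D.obj a) (x t') :=
    eqToHom (hx t a).symm ≫ N a α ≫ eqToHom (hx t' a)
  have hΓ {t t' : T} (α : t ⟶ t') (a : J) (w : W.obj a) :
      HEq ((Γ α a).app w) ((G a).map ((α, 𝟙 w) : (t, w) ⟶ (t', w))) := by
    simp only [Γ, NatTrans.comp_app, eqToHom_app]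
    rw [eqToHom_comp_heq_iff, comp_eqToHom_heq_iff]
  have ex₂ {t t' : T} (α : t ⟶ t') := hξ.existsUnique_hom₂ (x t) (x t') (Γ α) (fun {a b} f w => by
    refine (hΓ α b _).trans (HEq.trans ?_ (heq_whiskerRight (hx' t a w) (hx' t' a w)
      (hΓ α a w).symm (rfl : D.map f = D.map f)))
    have := heq_map_of_eq (hG f) ((α, 𝟙 w) : (t, w) ⟶ (t', w))
    refine HEq.trans (heq_of_eq ?_) this
    exact congrArg (G b).map (Prod.ext rfl ((W.map f).toFunctor.map_id w).symm))
  choose y hy hyu using @ex₂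
  have hy' {t t' : T} (α : t ⟶ t') (a : J) (w : W.obj a) :
      HEq (y α ▷ (ξ.app a).obj w) ((G a).map ((α, 𝟙 w) : (t, w) ⟶ (t', w))) := by
    rw [← hy α a w]; exact hΓ α a w
  have hyu' {t t' : T} (α : t ⟶ t') (β : x t ⟶ x t') (h : ∀ a w,
      HEq (β ▷ (ξ.app a).obj w) ((G a).map ((α, 𝟙 w) : (t, w) ⟶ (t', w)))) : β = y α :=
    hyu α β fun a w => eq_of_heq ((hΓ α a w).trans (h a w).symm)
  let Y : T ⥤ (X ⟶ L) :=
    { obj := x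
      map := fun α => y α
      map_id := fun t => (hyu' _ _ fun a w => by
        rw [id_whiskerRight]
        refine (heq_id_of_eq (hx' t a w)).symm.trans (heq_of_eq ?_)
        exact ((G a).map_id (t, w)).symm).symm
      map_comp := fun {t t' t''} α β => (hyu' _ _ fun a w => by
        rw [comp_whiskerRight]
        refine (heq_comp_of_heq (hx' t a w).symm (hx' t' a w).symm (hx' t'' a w).symm (hy' α a w)
          (hy' β a w)).trans (heq_of_eq ?_)
        rw [← (G a).map_comp]
        exact congrArg (G a).map (Prod.ext rfl (Category.id_comp _))).symm }
  refine ⟨Y, fun a => Functor.hext (fun z => (hx' z.1 a z.2).symm) ?_, fun Y' hY' => ?_⟩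
  · rintro ⟨t, w⟩ ⟨t', w'⟩ ⟨α, m⟩
    let f₁ : (t, w) ⟶ (t', w) := (α, 𝟙 w)
    let f₂ : (t', w) ⟶ (t', w') := (𝟙 t', m)
    have e : f₁ ≫ f₂ = (α, m) := congrArg₂ Prod.mk (Category.comp_id α) (Category.id_comp m)
    rw [← e, (G a).map_comp, e]
    exact heq_comp_of_heq (hx' t a w).symm (hx' t' a w).symm (hx' t' a w').symm (hy' α a w)
      (heq_map_of_eq (hx t' a).symm m)
  · have hobj (t : T) : Y'.obj t = x t := hxu t _ fun a => by
      rw [← const_prod'_hcomp, hY' a]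
    refine Functor.hext hobj fun t t' α => ?_
    have : eqToHom (hobj t).symm ≫ Y'.map α ≫ eqToHom (hobj t') = y α := hyu' α _ fun a w => by
      refine (heq_whiskerRight (hobj t).symm (hobj t').symm (α' := Y'.map α) ?_ rfl).trans ?_
      · rw [eqToHom_comp_heq_iff, comp_eqToHom_heq_iff]
      · refine HEq.trans (heq_of_eq ?_) (heq_map_of_eq (hY' a) ((α, 𝟙 w) : (t, w) ⟶ (t', w)))
        change _ = Y'.map α ▷ _ ≫ Y'.obj t' ◁ (ξ.app a).map (𝟙 w)
        rw [(ξ.app a).map_id, whiskerLeft_id, Category.comp_id]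
    change HEq (Y'.map α) (y α)
    rw [← this, heq_eqToHom_comp_iff, heq_comp_eqToHom_iff]

end WeightedUniversal

/-! ### Limits of functors weighted by functors -/

section Conical

/-- A functor from a category to a 2-category, as a 2-functor on the locally discrete
2-category. -/
def twoFunctorOfFunctor {J : Type*} [Category* J] {B : Type*} [Bicategory B] [Bicategory.Strict B]
    (F : J ⥤ B) : StrictPseudofunctor (LocallyDiscrete J) B :=
  StrictPseudofunctor.mk''
    { obj := fun j => F.obj j.as
      map := fun f => F.map f.as
      map₂ := @fun a b f g η => eqToHom (congrArg (fun f : Discrete (a.as ⟶ b.as) => F.map f.as)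
        (LocallyDiscrete.eq_of_hom η))
      map_id := fun j => F.map_id j.as
      map_comp := fun f g => F.map_comp f.as g.as
      map₂_id := fun _ => rfl
      map₂_comp := fun _ _ => by simp
      map₂_whisker_left := @fun _ _ _ f g g' η => by
        obtain rfl := LocallyDiscrete.eq_of_hom η
        simp
      map₂_whisker_right := @fun _ _ _ f f' η g => by
        obtain rfl := LocallyDiscrete.eq_of_hom η
        simp }

variable {J : Type v} [Category.{v} J] {K : Type u} [Bicategory.{v, v} K] [Bicategory.Strict K]

/-- The functors `ξ j : W j ⥤ K(L, D j)` exhibit `L` as the limit of `D : J ⥤ K` weighted by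
`W : J ⥤ Cat`, where `J` is an ordinary category. -/
structure IsWeightedTwoLimit (W : J ⥤ Cat.{v, v}) (D : J ⥤ K) {L : K}
    (ξ : ∀ j, W.obj j ⥤ (L ⟶ D.obj j)) : Prop where
  naturality {i j : J} (f : i ⟶ j) : (W.map f).toFunctor ⋙ ξ j = ξ i ⋙ postcomp L (D.map f)
  existsUnique (T : Type v) [Category.{v} T] (X : K) (h : ∀ j, T × W.obj j ⥤ (X ⟶ D.obj j)) :
    (∀ {i j : J} (f : i ⟶ j),
      (𝟭 T).prod (W.map f).toFunctor ⋙ h j = h i ⋙ postcomp X (D.map f)) →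
      ∃! y : T ⥤ (X ⟶ L), ∀ j, hcomp y (ξ j) = h j

theorem functor_eq_of_comp_faithful {A B C : Type*} [Category* A] [Category* B] [Category* C]
    (p : A ⥤ B) (hp : p.Faithful) {F G : C ⥤ A} (h : ∀ c, F.obj c = G.obj c)
    (h' : F ⋙ p = G ⋙ p) : F = G := by
  refine CategoryTheory.Functor.ext h fun c d m => p.map_injective (eq_of_heq ?_)
  refine (heq_map_of_eq h' m).trans ?_
  simp only [Functor.map_comp, eqToHom_map]
  rw [heq_eqToHom_comp_iff, heq_comp_eqToHom_iff]
  rfl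

/-- A functor lifts through a fully faithful functor if its action on objects does. -/
theorem exists_lift_functor {A B C : Type*} [Category* A] [Category* B] [Category* C]
    (p : A ⥤ B) (_ : p.Full) (_ : p.Faithful) (u : C ⥤ B) (o : C → A)
    (ho : ∀ c, p.obj (o c) = u.obj c) :
    ∃ w : C ⥤ A, (∀ c, w.obj c = o c) ∧ w ⋙ p = u :=
  ⟨{ obj := o
     map := fun {c d} m => p.preimage (eqToHom (ho c) ≫ u.map m ≫ eqToHom (ho d).symm)
     map_id := fun c => p.map_injective (by simp)
     map_comp := fun m n => p.map_injective (by simp) }, fun _ => rfl,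
   CategoryTheory.Functor.ext ho fun c d m => by simp⟩

/-- A weight is flexible if its underlying functor to sets of objects is projective. -/
theorem isFlexible_of_projective {W : J ⥤ Cat.{v, v}}
    (hW : ∀ (E F : J → Type v) (E' : ∀ {i j : J}, (i ⟶ j) → E i → E j)
      (F' : ∀ {i j : J}, (i ⟶ j) → F i → F j)
      (_ : ∀ i x, E' (𝟙 i) x = x)
      (_ : ∀ {i j k} (f : i ⟶ j) (g : j ⟶ k) x, E' (f ≫ g) x = E' g (E' f x))
      (p : ∀ j, E j → F j) (_ : ∀ {i j} (f : i ⟶ j) x, p j (E' f x) = F' f (p i x))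
      (_ : ∀ j, Function.Surjective (p j))
      (u : ∀ j, W.obj j → F j)
      (_ : ∀ {i j} (f : i ⟶ j) x, u j ((W.map f).toFunctor.obj x) = F' f (u i x)),
      ∃ w : ∀ j, W.obj j → E j, (∀ j x, p j (w j x) = u j x) ∧
        ∀ {i j} (f : i ⟶ j) x, w j ((W.map f).toFunctor.obj x) = E' f (w i x)) :
    IsFlexible (twoFunctorOfFunctor W) := by
  intro E F p hp u
  have pn {i j : J} (f : i ⟶ j) := congrArg Cat.Hom.toFunctor
    (p.naturality (Discrete.mk f : LocallyDiscrete.mk i ⟶ LocallyDiscrete.mk j))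
  have un {i j : J} (f : i ⟶ j) := congrArg Cat.Hom.toFunctor
    (u.naturality (Discrete.mk f : LocallyDiscrete.mk i ⟶ LocallyDiscrete.mk j))
  obtain ⟨w, hw, hwn⟩ := hW (fun j => E.obj ⟨j⟩) (fun j => F.obj ⟨j⟩)
    (fun {i j} f =>
      (E.map (Discrete.mk f : LocallyDiscrete.mk i ⟶ LocallyDiscrete.mk j)).toFunctor.obj)
    (fun {i j} f =>
      (F.map (Discrete.mk f : LocallyDiscrete.mk i ⟶ LocallyDiscrete.mk j)).toFunctor.obj)
    (fun i x => Functor.congr_obj (congrArg Cat.Hom.toFunctor (E.map_id ⟨i⟩)) x)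
    (fun f g x => Functor.congr_obj (congrArg Cat.Hom.toFunctor
      (E.map_comp (Discrete.mk f : LocallyDiscrete.mk _ ⟶ LocallyDiscrete.mk _)
        (Discrete.mk g : LocallyDiscrete.mk _ ⟶ LocallyDiscrete.mk _))) x)
    (fun j => (p.app ⟨j⟩).toFunctor.obj) (fun f x => Functor.congr_obj (pn f) x)
    (fun j => (hp ⟨j⟩).2.2) (fun j => (u.app ⟨j⟩).toFunctor.obj)
    (fun f x => Functor.congr_obj (un f) x)
  choose φ hφ hφ' using fun j => exists_lift_functor (p.app ⟨j⟩).toFunctor (hp ⟨j⟩).1 (hp ⟨j⟩).2.1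
    (u.app ⟨j⟩).toFunctor (w j) (hw j)
  refine ⟨{ app := fun j => (φ j.as).toCatHom, naturality := fun {i j} f => ?_,
            naturality₂ := fun {i j f g} η => ?_ }, fun j => Cat.ext (hφ' j.as)⟩
  · refine Cat.ext (functor_eq_of_comp_faithful (p.app j).toFunctor (hp j).2.1 (fun x => ?_) ?_)
    · refine (hφ j.as _).trans ((hwn f.as x).trans ?_)
      exact congrArg (E.map f).toFunctor.obj (hφ i.as x).symm
    · have e₁ := congrArg Cat.Hom.toFunctor (u.naturality f)
      have e₂ := congrArg Cat.Hom.toFunctor (p.naturality f)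
      refine (congrArg (fun F => (W.map f.as).toFunctor ⋙ F) (hφ' j.as)).trans (e₁.trans ?_)
      refine (congrArg (· ⋙ (F.map f).toFunctor) (hφ' i.as)).symm.trans ?_
      exact congrArg (φ i.as ⋙ ·) e₂.symm
  · obtain rfl := LocallyDiscrete.eq_of_hom η
    obtain rfl : η = 𝟙 f := Subsingleton.elim _ _
    rw [PrelaxFunctor.map₂_id, PrelaxFunctor.map₂_id]
    exact (congrArg (· ≫ _) (id_whiskerRight _ _)).trans ((Category.id_comp _).trans
      ((Category.comp_id _).symm.trans (congrArg (_ ≫ ·) (whiskerLeft_id _ _).symm)))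

theorem isWeightedTwoLimit_of_isWeightedLimit {W : J ⥤ Cat.{v, v}} {D : J ⥤ K} {L : K}
    {ξ : Cylinder (twoFunctorOfFunctor W) (twoFunctorOfFunctor D) L} (hξ : IsWeightedLimit ξ) :
    IsWeightedTwoLimit W D fun j => ξ.app ⟨j⟩ where
  naturality {i j} f := ξ.naturality (Discrete.mk f : LocallyDiscrete.mk i ⟶ LocallyDiscrete.mk j)
  existsUnique T _ X h hh := by
    obtain ⟨y, hy, hu⟩ := hξ.existsUnique (fun j => h j.as) (fun f => hh f.as)
      (fun {i j f g} η t w => by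
        obtain rfl := LocallyDiscrete.eq_of_hom η
        obtain rfl : η = 𝟙 f := Subsingleton.elim _ _
        rw [PrelaxFunctor.map₂_id, PrelaxFunctor.map₂_id, whiskerLeft_id]
        refine (heq_of_eq (CategoryTheory.Functor.map_id _ _)).trans (heq_id_of_eq ?_)
        exact Functor.congr_obj (hh f.as) (t, w))
    exact ⟨y, fun j => hy ⟨j⟩, fun y' h => hu y' fun j => h j.as⟩

end Conical

/-! ### Strictification of limits -/

section Flexible

variable {K : Type u} [Bicategory.{v, v} K] [Bicategory.Strict K]

/-- Limits weighted by a weight on an ordinary category whose functor of objects is projective. -/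
theorem HasFlexibleLimits.exists_isWeightedTwoLimit (hK : HasFlexibleLimits K) {J : Type v}
    [Category.{v} J] (W : J ⥤ Cat.{v, v}) (hW : IsFlexible (twoFunctorOfFunctor W)) (D : J ⥤ K) :
    ∃ (L : K) (ξ : ∀ j, W.obj j ⥤ (L ⟶ D.obj j)), IsWeightedTwoLimit W D ξ := by
  obtain ⟨L, ξ, h⟩ := hK _ (twoFunctorOfFunctor W) hW (twoFunctorOfFunctor D)
  exact ⟨L, _, isWeightedTwoLimit_of_isWeightedLimit h⟩

/-- Every category is a flexible weight on the terminal category, so that powers exist. -/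
theorem HasFlexibleLimits.exists_isTwoPower (hK : HasFlexibleLimits K) (C : Type v) [Category.{v} C]
    (A : K) : ∃ (P : K) (ξ : C ⥤ (P ⟶ A)), IsTwoPower ξ := by
  obtain ⟨L, ξ, h⟩ := hK.exists_isWeightedTwoLimit
    ((Functor.const (Discrete PUnit.{v + 1})).obj (Cat.of C))
    (isFlexible_of_projective fun E F E' F' hE hE' p hp hp' u hu => by
      choose w hw using fun j x => hp' j (u j x)
      refine ⟨w, hw, ?_⟩
      rintro ⟨i⟩ ⟨j⟩ f x
      obtain rfl : i = j := rfl
      obtain rfl : f = 𝟙 _ := Subsingleton.elim _ _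
      exact (hE _ _).symm)
    ((Functor.const (Discrete PUnit.{v + 1})).obj A)
  refine ⟨L, ξ ⟨⟨⟩⟩, fun T _ X G => ?_⟩
  obtain ⟨y, hy, hu⟩ := h.existsUnique T X (fun _ => G) (fun f => (comp_postcomp_id G).symm)
  exact ⟨y, hy ⟨⟨⟩⟩, fun y' hy' => hu y' fun _ => hy'⟩

/-- The walking idempotent: the category with one object and one non-identity morphism, which is
idempotent. -/
structure FreeIdempotent : Type v where

instance : Category.{v} FreeIdempotent.{v} where
  Hom _ _ := ULift.{v} Bool
  id _ := ⟨true⟩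
  comp f g := ⟨f.down && g.down⟩
  comp_id f := congrArg ULift.up (Bool.and_true f.down)
  assoc f g h := congrArg ULift.up (Bool.and_assoc f.down g.down h.down)

/-- The functor picking out an idempotent. -/
def FreeIdempotent.functor {C : Type*} [Category* C] {A : C} (e : A ⟶ A) (he : e ≫ e = e) :
    FreeIdempotent.{v} ⥤ C where
  obj _ := A
  map f := match f with
    | ⟨true⟩ => 𝟙 A
    | ⟨false⟩ => e
  map_id _ := rfl
  map_comp f g := by
    rcases f with ⟨_ | _⟩ <;> rcases g with ⟨_ | _⟩
    · exact he.symm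
    · exact (Category.comp_id e).symm
    · exact (Category.id_comp e).symm
    · exact (Category.id_comp _).symm

/-- The conical weight on the walking idempotent is a retract of a representable, so that
idempotents split. -/
theorem HasFlexibleLimits.isIdempotentComplete (hK : HasFlexibleLimits K) :
    IsIdempotentComplete K := by
  refine ⟨fun A e he => ?_⟩
  obtain ⟨L, ξ, h⟩ := hK.exists_isWeightedTwoLimit
    ((Functor.const FreeIdempotent.{v}).obj (Cat.of (Discrete PUnit.{v + 1})))
    (isFlexible_of_projective fun E F E' F' hE hE' p hp hp' u hu => by
      let q : FreeIdempotent.{v} := ⟨⟩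
      let f : q ⟶ q := ⟨false⟩
      obtain ⟨x, hx⟩ := hp' q (u q ⟨⟨⟩⟩)
      refine ⟨fun j _ => E' f x, fun j y => ?_, ?_⟩
      · exact (hp f x).trans ((congrArg (F' f) hx).trans (hu f ⟨⟨⟩⟩).symm)
      · rintro i j ⟨_ | _⟩ y
        · exact hE' f f x
        · exact (hE _ _).symm)
    (FreeIdempotent.functor e he)
  let s : L ⟶ A := (ξ ⟨⟩).obj ⟨⟨⟩⟩
  have hs : s ≫ e = s :=
    (Functor.congr_obj (h.naturality (⟨false⟩ : (⟨⟩ : FreeIdempotent.{v}) ⟶ ⟨⟩)) ⟨⟨⟩⟩).symm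
  have key (X : K) (x : X ⟶ A) (hx : x ≫ e = x) : ∃! y : X ⟶ L, y ≫ s = x := by
    obtain ⟨y, hy, hu⟩ := h.existsUnique (Discrete PUnit.{v + 1}) X
      (fun _ => (Functor.const _).obj x) (by
        rintro i j ⟨_ | _⟩
        · refine Eq.trans ?_ (const_comp_postcomp x e).symm
          rw [hx]; rfl
        · exact (comp_postcomp_id _).symm)
    refine ⟨y.obj ⟨⟨⟩⟩, Functor.congr_obj (hy ⟨⟩) (⟨⟨⟩⟩, ⟨⟨⟩⟩), fun y' hy' => ?_⟩
    refine Functor.congr_obj (hu ((Functor.const _).obj y') fun j => ?_) ⟨⟨⟩⟩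
    rw [const_hcomp]
    refine Functor.hext (fun _ => hy') fun a b m => ?_
    obtain rfl : a = b := Subsingleton.elim (α := Discrete PUnit × Discrete PUnit) _ _
    obtain rfl : m = 𝟙 a :=
      Prod.ext (Subsingleton.elim _ _) (Subsingleton.elim (α := ULift (PLift _)) _ _)
    rw [CategoryTheory.Functor.map_id, CategoryTheory.Functor.map_id]
    exact heq_id_of_eq hy'
  obtain ⟨r, hr, -⟩ := key A e he
  refine ⟨L, s, r, ?_, hr⟩
  exact (key L s hs).unique (by rw [Strict.assoc, hr, hs]) (Strict.id_comp s)

variable {J : Type v} [Category.{v} J] {W : J ⥤ Cat.{v, v}} {D : J ⥤ K} {L : K}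
  {ξ : ∀ j, W.obj j ⥤ (L ⟶ D.obj j)}

/-- Let `L` be the limit of `D` weighted by `W`, and let `b` be a cone over `D` with vertex `L`
whose projections are isomorphic to components `ξ j (w j)` of the universal cylinder, by
isomorphisms that become identities after composition with each morphism `x` for which `ξ` becomes
constant. Then the endomorphism of `L` corresponding to the cone `b` is idempotent, and
splitting it yields the conical limit of `D`. -/
theorem IsWeightedTwoLimit.exists_isTwoLimit [IsIdempotentComplete K]
    (hξ : IsWeightedTwoLimit W D ξ) (w : ∀ j, W.obj j) (b : ∀ j, L ⟶ D.obj j)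
    (hb : ∀ {i j} (f : i ⟶ j), b i ≫ D.map f = b j) (Ψ : ∀ j, FreeIso.{v} ⥤ (L ⟶ D.obj j))
    (hΨ : ∀ j, (Ψ j).obj .src = (ξ j).obj (w j)) (hΨ' : ∀ j, (Ψ j).obj .tgt = b j)
    (H : ∀ {X : K} (x : X ⟶ L) (c : ∀ j, X ⟶ D.obj j),
      (∀ {i j} (f : i ⟶ j), c i ≫ D.map f = c j) →
      (∀ j, ξ j ⋙ precomp (D.obj j) x = (Functor.const _).obj (c j)) →
        ∀ j, Ψ j ⋙ precomp (D.obj j) x = (Functor.const _).obj (c j)) :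
    ∃ c : Cone D, IsTwoLimit c := by
  have hcs {X : K} (c : ∀ j, X ⟶ D.obj j) (hc : ∀ {i j} (f : i ⟶ j), c i ≫ D.map f = c j) :
      ∃ x : X ⟶ L, ∀ j, ξ j ⋙ precomp (D.obj j) x = (Functor.const _).obj (c j) := by
    obtain ⟨y, hy, -⟩ := hξ.existsUnique FreeIso.{v} X (fun j => (Functor.const _).obj (c j))
      (fun f => by rw [const_comp_postcomp, hc]; rfl)
    refine ⟨y.obj .src, fun j => ?_⟩
    rw [← const_prod'_hcomp, hy]; rfl
  -- the functor `y` that classifies a cone `h` is mapped to `h` by the projections `b`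
  have hlim {T : Type v} [Category.{v} T] {X : K} (y : T ⥤ (X ⟶ L)) (h : ∀ j, T ⥤ (X ⟶ D.obj j))
      (hh : ∀ {i j} (f : i ⟶ j), h i ⋙ postcomp X (D.map f) = h j)
      (hy : ∀ j, hcomp y (ξ j) = CategoryTheory.Prod.fst _ _ ⋙ h j) (j : J) :
      y ⋙ postcomp X (b j) = h j := by
    have e : CategoryTheory.Prod.swap _ _ ⋙ hcomp y (Ψ j) = CategoryTheory.Prod.snd _ _ ⋙ h j := by
      refine FreeIso.glue_ext ?_ fun t => ?_
      · change Functor.prod' (𝟭 T) ((Functor.const T).obj FreeIso.src) ⋙ hcomp y (Ψ j) = h j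
        rw [prod'_const_hcomp, hΨ, ← prod'_const_hcomp, hy]; rfl
      · change Functor.prod' ((Functor.const FreeIso).obj t) (𝟭 FreeIso) ⋙ hcomp y (Ψ j) =
          (Functor.const _ ).obj t ⋙ h j
        have hc (j : J) : ξ j ⋙ precomp (D.obj j) (y.obj t) =
            (Functor.const _).obj ((h j).obj t) := by
          rw [← const_prod'_hcomp, hy]
          exact Functor.hext (fun _ => rfl) fun _ _ _ => heq_of_eq ((h j).map_id t)
        rw [const_prod'_hcomp, H (y.obj t) (fun j => (h j).obj t)
          (fun f => Functor.congr_obj (hh f) t) hc]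
        exact Functor.hext (fun _ => rfl) fun _ _ _ => heq_of_eq ((h j).map_id t).symm
    have := congrArg (fun F => Functor.prod' (𝟭 T) ((Functor.const T).obj FreeIso.tgt) ⋙
      CategoryTheory.Prod.swap _ _ ⋙ F) e
    change Functor.prod' (𝟭 T) ((Functor.const T).obj FreeIso.tgt) ⋙ hcomp y (Ψ j) = h j at this
    rwa [prod'_const_hcomp, hΨ'] at this
  -- the idempotent to be split classifies the cone `b`
  obtain ⟨e, he⟩ := hcs b hb
  have hext {X : K} {T : Type v} [Category.{v} T] {y y' : T ⥤ (X ⟶ L)}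
      (h : ∀ j, hcomp y (ξ j) = hcomp y' (ξ j)) : y = y' :=
    (hξ.existsUnique T X (fun j => hcomp y' (ξ j)) (fun f => by
      rw [hcomp_postcomp, ← hξ.naturality]; rfl)).unique h fun _ => rfl
  have hee : e ≫ e = e := by
    refine const_free_injective.{v} (hext fun j => ?_)
    rw [const_hcomp, const_hcomp, ← comp_precomp_precomp, he, const_comp_precomp]
    have : e ≫ (Ψ j).obj .tgt = b j := Functor.congr_obj (H e b hb he j) FreeIso.tgt
    rw [hΨ'] at this
    rw [this]
  obtain ⟨M, t, s, hts, hst⟩ := IsIdempotentComplete.idempotents_split L e hee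
  have hte : t ≫ e = t := by rw [← hst, ← Strict.assoc, hts, Strict.id_comp]
  refine ⟨⟨M, ⟨fun j => t ≫ b j, fun i j f => ?_⟩⟩, fun T _ X h hh => ?_⟩
  · exact (Strict.id_comp _).trans ((congrArg (t ≫ ·) (hb f)).symm.trans (Strict.assoc _ _ _).symm)
  · obtain ⟨y, hy, hu⟩ := hξ.existsUnique T X (fun j => CategoryTheory.Prod.fst _ _ ⋙ h j)
      (fun f => (congrArg (CategoryTheory.Prod.fst _ _ ⋙ ·) (hh f)).symm)
    have hyb := hlim y h hh hy
    have hye : y ⋙ postcomp X e = y := hext fun j => by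
      rw [← hcomp_precomp, he, hcomp_const, hyb, hy]
    refine ⟨y ⋙ postcomp X s, fun j => ?_, fun z hz => ?_⟩
    · change (y ⋙ postcomp X s) ⋙ postcomp X (t ≫ b j) = h j
      rw [comp_postcomp_postcomp, ← Strict.assoc, hst, ← comp_postcomp_postcomp, hye, hyb]
    · have hz' : z ⋙ postcomp X t = y := hu _ fun j => by
        have := hz j
        change z ⋙ postcomp X (t ≫ b j) = h j at this
        rw [← hte, ← comp_postcomp_postcomp, ← hcomp_precomp, he, hcomp_const,
          comp_postcomp_postcomp, this]
      rw [← hz', comp_postcomp_postcomp, hts, comp_postcomp_id]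

/-- The weight for pseudolimits: its value at `j` is the chaotic category on the set of morphisms
with target `j`. -/
def pseudoWeight (J : Type v) [Category.{v} J] : J ⥤ Cat.{v, v} where
  obj j := Cat.of (Chaotic (Σ i, i ⟶ j))
  map f := (Chaotic.map fun x => ⟨x.1, x.2 ≫ f⟩).toCatHom
  map_id _ := Cat.ext <| Functor.hext
    (fun ⟨x⟩ => congrArg Chaotic.mk (Sigma.ext rfl (heq_of_eq (Category.comp_id x.2))))
    fun _ _ _ => HEq.rfl
  map_comp f g := Cat.ext <| Functor.hext
    (fun ⟨x⟩ => congrArg Chaotic.mk (Sigma.ext rfl (heq_of_eq (Category.assoc x.2 f g).symm)))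
    fun _ _ _ => HEq.rfl

/-- The functor of objects of the weight for pseudolimits is a coproduct of representables. -/
theorem isFlexible_pseudoWeight (J : Type v) [Category.{v} J] :
    IsFlexible (twoFunctorOfFunctor (pseudoWeight J)) :=
  isFlexible_of_projective fun E F E' F' hE hE' p hp hp' u hu => by
    choose x hx using fun i => hp' i (u i ⟨⟨i, 𝟙 i⟩⟩)
    refine ⟨fun j f => E' f.as.2 (x f.as.1), fun j f => ?_, fun g f => hE' _ _ _⟩
    refine (hp _ _).trans ((congrArg (F' f.as.2) (hx _)).trans ((hu f.as.2 _).symm.trans ?_))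
    exact congrArg (u j) (congrArg Chaotic.mk
      (Sigma.ext rfl (heq_of_eq (Category.id_comp f.as.2))))

/-- A functor on a chaotic category, evaluated at two objects. -/
abbrev Chaotic.pair {A : Type v} (x y : A) : FreeIso.{v} ⥤ Chaotic A :=
  Chaotic.map fun i => cond i.down y x

theorem IsWeightedTwoLimit.pseudoWeight_obj {J : Type v} [Category.{v} J] {D : J ⥤ K} {L : K}
    {ξ : ∀ j, (pseudoWeight J).obj j ⥤ (L ⟶ D.obj j)} (hξ : IsWeightedTwoLimit (pseudoWeight J) D ξ)
    {i j : J} (f : i ⟶ j) : (ξ j).obj ⟨⟨i, f⟩⟩ = (ξ i).obj ⟨⟨i, 𝟙 i⟩⟩ ≫ D.map f := by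
  refine Eq.trans ?_ (Functor.congr_obj (hξ.naturality f) ⟨⟨i, 𝟙 i⟩⟩)
  exact congrArg (ξ j).obj (congrArg Chaotic.mk
    (Sigma.ext rfl (heq_of_eq (Category.id_comp f).symm)))

/-- Products are pseudolimits up to splitting an idempotent. -/
theorem HasFlexibleLimits.exists_isTwoLimit_discrete (hK : HasFlexibleLimits K) {I : Type v}
    (D : Discrete I ⥤ K) : ∃ c : Cone D, IsTwoLimit c := by
  have := hK.isIdempotentComplete
  obtain ⟨L, ξ, hξ⟩ := hK.exists_isWeightedTwoLimit _ (isFlexible_pseudoWeight (Discrete I)) D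
  refine hξ.exists_isTwoLimit (fun j => ⟨⟨j, 𝟙 j⟩⟩) (fun j => (ξ j).obj ⟨⟨j, 𝟙 j⟩⟩) ?_
    (fun j => (Functor.const _).obj ((ξ j).obj ⟨⟨j, 𝟙 j⟩⟩)) (fun _ => rfl) (fun _ => rfl) ?_
  · intro i j f
    obtain rfl : i = j := Discrete.ext (Discrete.eq_of_hom f)
    obtain rfl : f = 𝟙 _ := Subsingleton.elim _ _
    exact (congrArg (_ ≫ ·) (D.map_id i)).trans (Strict.comp_id _)
  · intro X x c _ hx j
    rw [const_comp_precomp]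
    exact congrArg _ (Functor.congr_obj (hx j) _)

theorem FreeIso.comp_const {C : Type*} [Category* C] {B : Type*} [Category* B] (F : B ⥤ C) (c : C)
    (hF : F = (Functor.const _).obj c) (G : FreeIso.{v} ⥤ B) :
    G ⋙ F = (Functor.const _).obj c := by
  rw [hF]; rfl

/-- The pullback of a normal isofibration `p` along `g` is obtained from the pseudopullback of `p`
and `g` by lifting along `p` the universal isomorphism. -/
theorem HasFlexibleLimits.exists_isTwoPullback (hK : HasFlexibleLimits K) {A B B' : K}
    (p : A ⟶ B) (g : B' ⟶ B) (s : NormalLifting p) :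
    ∃ (P : K) (fst : P ⟶ A) (snd : P ⟶ B'), IsTwoPullback fst snd p g := by
  have := hK.isIdempotentComplete
  let J := AsSmall.{v} WalkingCospan
  let D : J ⥤ K := AsSmall.down ⋙ cospan p g
  obtain ⟨L, ξ, hξ⟩ := hK.exists_isWeightedTwoLimit _ (isFlexible_pseudoWeight J) D
  let l : J := ⟨.left⟩
  let r : J := ⟨.right⟩
  let o : J := ⟨.one⟩
  let fl : l ⟶ o := ⟨WalkingCospan.Hom.inl⟩
  let fr : r ⟶ o := ⟨WalkingCospan.Hom.inr⟩
  let a : L ⟶ A := (ξ l).obj ⟨⟨l, 𝟙 l⟩⟩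
  let b : L ⟶ B' := (ξ r).obj ⟨⟨r, 𝟙 r⟩⟩
  let β : FreeIso.{v} ⥤ (L ⟶ B) := Chaotic.pair ⟨l, fl⟩ ⟨r, fr⟩ ⋙ ξ o
  have hβl : (ξ o).obj ⟨⟨l, fl⟩⟩ = a ≫ p := hξ.pseudoWeight_obj fl
  have hβr : (ξ o).obj ⟨⟨r, fr⟩⟩ = b ≫ g := hξ.pseudoWeight_obj fr
  -- lifting `β` replaces the projection `a` by one that makes the square commute strictly
  let Ψ := s.lift a β hβl
  have hΨ : Ψ.obj .tgt ≫ p = b ≫ g :=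
    (Functor.congr_obj (s.lift_postcomp a β hβl) .tgt).trans hβr
  obtain ⟨c, hc⟩ := hξ.exists_isTwoLimit
    (fun j => match j with
      | ⟨.left⟩ => ⟨⟨l, 𝟙 l⟩⟩
      | ⟨.right⟩ => ⟨⟨r, 𝟙 r⟩⟩
      | ⟨.one⟩ => ⟨⟨r, fr⟩⟩)
    (fun j => match j with
      | ⟨.left⟩ => Ψ.obj .tgt
      | ⟨.right⟩ => b
      | ⟨.one⟩ => b ≫ g)
    (by
      rintro ⟨_ | _ | _⟩ ⟨_ | _ | _⟩ ⟨_ | _⟩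
      · exact Strict.comp_id _
      · exact hΨ
      · exact Strict.comp_id _
      · rfl
      · exact Strict.comp_id _)
    (fun j => match j with
      | ⟨.left⟩ => Ψ
      | ⟨.right⟩ => (Functor.const _).obj b
      | ⟨.one⟩ => (Functor.const _).obj (b ≫ g))
    (by
      rintro ⟨_ | _ | _⟩
      · exact hβr.symm
      · exact s.lift_src _ _ _
      · rfl)
    (by
      rintro ⟨_ | _ | _⟩ <;> rfl)
    (by
      intro X x c hc hx
      have hl : x ≫ a = c l := Functor.congr_obj (hx l) _
      have hr : x ≫ b = c r := Functor.congr_obj (hx r) _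
      have ho : x ≫ b ≫ g = c o :=
        (congrArg (x ≫ ·) hβr).symm.trans (Functor.congr_obj (hx o) ⟨⟨r, fr⟩⟩)
      rintro ⟨_ | _ | _⟩
      · exact (const_comp_precomp _ _).trans (congrArg _ ho)
      · have e : (β ⋙ precomp B x).obj .src = (x ≫ a) ≫ p := by
          change x ≫ (ξ o).obj ⟨⟨l, fl⟩⟩ = _
          rw [hβl, Strict.assoc]; rfl
        refine (s.lift_precomp x a β hβl e).trans
          ((s.lift_eq_const ?_ e).trans (congrArg _ hl))
        refine (FreeIso.comp_const _ _ (hx o) (Chaotic.pair ⟨l, fl⟩ ⟨r, fr⟩)).trans (congrArg _ ?_)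
        exact (hc fl).symm.trans (congrArg (· ≫ p) hl.symm)
      · exact (const_comp_precomp _ _).trans (congrArg _ hr))
  refine ⟨c.pt, c.π.app l, c.π.app r, (c.w fl).trans (c.w fr).symm, fun T _ X h₁ h₂ h => ?_⟩
  let H : ∀ j, T ⥤ (X ⟶ D.obj j) := fun j => match j with
    | ⟨.left⟩ => h₁
    | ⟨.right⟩ => h₂
    | ⟨.one⟩ => h₂ ⋙ postcomp X g
  obtain ⟨y, hy, hu⟩ := hc T X H (by
      rintro ⟨_ | _ | _⟩ ⟨_ | _ | _⟩ ⟨_ | _⟩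
      · exact comp_postcomp_id _
      · exact h
      · exact comp_postcomp_id _
      · rfl
      · exact comp_postcomp_id _)
  refine ⟨y, ⟨hy l, hy r⟩, fun y' hy' => hu y' ?_⟩
  rintro ⟨_ | _ | _⟩
  · refine Eq.trans ?_ (congrArg (· ⋙ postcomp X g) hy'.2)
    refine Eq.trans ?_ (comp_postcomp_postcomp _ _ _).symm
    exact congrArg (fun f => y' ⋙ postcomp X f) (c.w fr).symm
  · exact hy'.1
  · exact hy'.2

end Flexible

/-! ### Limits of towers -/

section Tower

/-- The composite of two isomorphisms, given by functors on the walking isomorphism. -/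
def FreeIso.trans {C : Type*} [Category* C] (P Q : FreeIso.{v} ⥤ C) (h : P.obj .tgt = Q.obj .src) :
    FreeIso.{v} ⥤ C :=
  FreeIso.ofIso (FreeIso.toIso P ≪≫ eqToIso h ≪≫ FreeIso.toIso Q)

theorem FreeIso.trans_comp_eq_const {C B : Type*} [Category* C] [Category* B]
    {P Q : FreeIso.{v} ⥤ C} (h : P.obj .tgt = Q.obj .src) (F : C ⥤ B) {c : B}
    (hP : P ⋙ F = (Functor.const _).obj c) (hQ : Q ⋙ F = (Functor.const _).obj c) :
    FreeIso.trans P Q h ⋙ F = (Functor.const _).obj c := by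
  refine FreeIso.functor_ext (Functor.congr_obj hP .src) ?_ (Functor.congr_obj hQ .tgt)
  have eP : HEq (F.map (P.map (Chaotic.hom FreeIso.src FreeIso.tgt))) (𝟙 c) :=
    heq_map_of_eq hP (Chaotic.hom FreeIso.src FreeIso.tgt)
  have eQ : HEq (F.map (Q.map (Chaotic.hom FreeIso.src FreeIso.tgt))) (𝟙 c) :=
    heq_map_of_eq hQ (Chaotic.hom FreeIso.src FreeIso.tgt)
  have hP₀ : F.obj (P.obj .src) = c := Functor.congr_obj hP .src
  have hP₁ : F.obj (P.obj .tgt) = c := Functor.congr_obj hP .tgt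
  have hQ₀ : F.obj (Q.obj .src) = c := Functor.congr_obj hQ .src
  have hQ₁ : F.obj (Q.obj .tgt) = c := Functor.congr_obj hQ .tgt
  change HEq (F.map (P.map _ ≫ eqToHom h ≫ Q.map _)) (𝟙 c)
  rw [F.map_comp, F.map_comp, eqToHom_map]
  refine (heq_comp_of_heq hP₀ hP₁ hQ₁ eP (heq_comp_of_heq hP₁ hQ₀ hQ₁ (g' := 𝟙 c) (f' := 𝟙 c)
    ?_ eQ)).trans (heq_of_eq ?_)
  · exact (eqToHom_heq_id_cod _ _ _).trans (heq_id_of_eq hQ₀)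
  · rw [Category.comp_id, Category.comp_id]

variable {K : Type u} [Bicategory.{v, v} K] [Bicategory.Strict K]

/-- The limit of a tower of normal isofibrations is obtained from the pseudolimit of the tower by
replacing its projections recursively by isomorphic ones, using the liftings of isomorphisms. -/
theorem HasFlexibleLimits.exists_isTwoLimit_tower (hK : HasFlexibleLimits K) (F : ℕᵒᵖ ⥤ K)
    (s : ∀ n : ℕ, NormalLifting (F.map (homOfLE n.le_succ).op)) :
    ∃ c : Cone F, IsTwoLimit c := by
  have := hK.isIdempotentComplete
  let J := AsSmall.{v} ℕᵒᵖ
  let D : J ⥤ K := AsSmall.down ⋙ F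
  obtain ⟨L, ξ, hξ⟩ := hK.exists_isWeightedTwoLimit _ (isFlexible_pseudoWeight J) D
  let o (n : ℕ) : J := ⟨op n⟩
  let st (n : ℕ) : o (n + 1) ⟶ o n := ⟨(homOfLE n.le_succ).op⟩
  let a (n : ℕ) : L ⟶ F.obj (op n) := (ξ (o n)).obj ⟨⟨o n, 𝟙 (o n)⟩⟩
  let β (n : ℕ) : FreeIso.{v} ⥤ (L ⟶ F.obj (op n)) :=
    Chaotic.pair ⟨o (n + 1), st n⟩ ⟨o n, 𝟙 (o n)⟩ ⋙ ξ (o n)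
  have hβ (n : ℕ) : (β n).obj .src = a (n + 1) ≫ F.map (homOfLE n.le_succ).op :=
    hξ.pseudoWeight_obj (st n)
  -- `Ψ n` is an isomorphism from `a n` to the new projection, lifted from the composite of the
  -- structural isomorphism `β (n - 1)` with `Ψ (n - 1)`
  let Ψ (n : ℕ) : { Ψ : FreeIso.{v} ⥤ (L ⟶ F.obj (op n)) // Ψ.obj .src = a n } :=
    Nat.rec ⟨(Functor.const _).obj (a 0), rfl⟩ (fun n Φ =>
      ⟨(s n).lift (a (n + 1)) (FreeIso.trans (β n) Φ.1 Φ.2.symm) (hβ n), (s n).lift_src _ _ _⟩) n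
  have hΨ (n : ℕ) : (Ψ (n + 1)).1 =
    (s n).lift (a (n + 1)) (FreeIso.trans (β n) (Ψ n).1 (Ψ n).2.symm) (hβ n) := rfl
  have hst (n : ℕ) : (Ψ (n + 1)).1.obj .tgt ≫ F.map (homOfLE n.le_succ).op = (Ψ n).1.obj .tgt :=
    Functor.congr_obj ((s n).lift_postcomp _ (FreeIso.trans (β n) (Ψ n).1 (Ψ n).2.symm) (hβ n)) .tgt
  have hmap (n k : ℕ) : (Ψ (n + k)).1.obj .tgt ≫ F.map (homOfLE (Nat.le_add_right n k)).op =
      (Ψ n).1.obj .tgt := by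
    induction k with
    | zero => exact (congrArg (_ ≫ ·) (F.map_id _)).trans (Strict.comp_id _)
    | succ k ih =>
      have e : (homOfLE (Nat.le_add_right n (k + 1))).op =
        (homOfLE (n + k).le_succ).op ≫ (homOfLE (Nat.le_add_right n k)).op := Subsingleton.elim _ _
      rw [e, F.map_comp, ← Strict.assoc]
      exact (congrArg (· ≫ _) (hst (n + k))).trans ih
  obtain ⟨c, hc⟩ := hξ.exists_isTwoLimit (fun j => ⟨⟨j, 𝟙 j⟩⟩)
    (fun j => (Ψ (AsSmall.down.obj j).unop).1.obj .tgt)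
    (by
      rintro ⟨⟨m⟩⟩ ⟨⟨n⟩⟩ ⟨f⟩
      obtain ⟨k, rfl⟩ := Nat.exists_eq_add_of_le (leOfHom f.unop)
      exact hmap n k)
    (fun j => (Ψ (AsSmall.down.obj j).unop).1) (fun j => (Ψ (AsSmall.down.obj j).unop).2)
    (fun _ => rfl) (by
      rintro X x c hc hx ⟨⟨n⟩⟩
      induction n with
      | zero => exact (const_comp_precomp _ _).trans (congrArg _ (Functor.congr_obj (hx (o 0)) _))
      | succ n ih =>
        have ha : x ≫ a (n + 1) = c (o (n + 1)) := Functor.congr_obj (hx (o (n + 1))) _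
        have e : (FreeIso.trans (β n) (Ψ n).1 (Ψ n).2.symm ⋙ precomp _ x).obj .src =
            (x ≫ a (n + 1)) ≫ F.map (homOfLE n.le_succ).op := by
          change x ≫ (β n).obj .src = _
          rw [hβ, Strict.assoc]
        refine ((s n).lift_precomp x _ (FreeIso.trans (β n) (Ψ n).1 (Ψ n).2.symm) (hβ n) e).trans
          (((s n).lift_eq_const ?_ e).trans (congrArg _ ha))
        have e₁ : β n ⋙ precomp _ x = (Functor.const _).obj (c (o n)) :=
          FreeIso.comp_const _ _ (hx (o n)) (Chaotic.pair _ _)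
        refine (FreeIso.trans_comp_eq_const _ _ e₁ ih).trans (congrArg _ ?_)
        exact (hc (st n)).symm.trans (congrArg (· ≫ _) ha.symm))
  refine ⟨⟨c.pt, ⟨fun j => c.π.app ⟨j⟩, fun i j f => c.π.naturality (X := ⟨i⟩) (Y := ⟨j⟩) ⟨f⟩⟩⟩,
    fun T _ X h hh => ?_⟩
  obtain ⟨y, hy, hu⟩ := hc T X (fun j => h (AsSmall.down.obj j)) (fun f => hh f.down)
  exact ⟨y, fun j => hy ⟨j⟩, fun y' hy' => hu y' fun j => hy' (AsSmall.down.obj j)⟩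

end Tower

/-! ### The 2-cosmos structure given by flexible limits -/

section Cosmos

variable {K : Type u} [Bicategory.{v, v} K] [Bicategory.Strict K]

/-- Powers preserve normal isofibrations: this is the case of an empty category in
`normalLifting_leibniz`. -/
theorem IsTwoPower.normalLifting {D : Type*} [Category* D] {A B P Q : K} {p : A ⟶ B}
    (s : NormalLifting p) {ξ : D ⥤ (P ⟶ A)} (hξ : IsTwoPower ξ) {ζ : D ⥤ (Q ⟶ B)}
    (hζ : IsTwoPower ζ) (m : P ⟶ Q) (hm : ∀ d, ξ.obj d ≫ p = m ≫ ζ.obj d)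
    {c : Cone (Functor.empty.{v} K)} (hc : IsTwoLimit c) : Nonempty (NormalLifting m) := by
  have ex {T : Type v} [Category.{v} T] (X : K) : Nonempty (T ⥤ (X ⟶ c.pt)) :=
    (hc T X (fun j => j.as.elim) fun {i} => i.as.elim).exists.nonempty
  have ext {T : Type v} [Category.{v} T] {X : K} (y y' : T ⥤ (X ⟶ c.pt)) : y = y' :=
    hc.functor_ext fun j => j.as.elim
  have hpow {C : K} (θ : Discrete PEmpty.{1} ⥤ (c.pt ⟶ C)) : IsTwoPower θ := fun T _ X G => by
    obtain ⟨y⟩ := ex (T := T) X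
    exact ⟨y, Functor.hext (fun x => x.2.as.elim) fun x => x.2.as.elim, fun y' _ => ext _ _⟩
  obtain ⟨q⟩ := ex (T := FreeIso.{v}) Q
  have hQ : IsTwoPullback (q.obj .src) (𝟙 Q) (𝟙 c.pt) (q.obj .src) :=
    ⟨(Strict.comp_id _).trans (Strict.id_comp _).symm, fun T _ X h₁ h₂ _ =>
      ⟨h₂, ⟨ext _ _, comp_postcomp_id _⟩, fun y hy => (comp_postcomp_id y).symm.trans hy.2⟩⟩
  exact normalLifting_leibniz (Discrete.functor PEmpty.elim) (fun x => x.as.elim) s hξ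
    (hpow (Discrete.functor PEmpty.elim)) hζ (ξBC := Discrete.functor PEmpty.elim) hQ m
    (fun x => x.as.elim) (fun d => by rw [Strict.comp_id, hm]) (fun x => x.as.elim)
    (fun x => x.as.elim)

/-- Leibniz powers in `n K` by monomorphisms of simplicial sets are Leibniz powers in the
2-category `K` by functors which are injective on objects. -/
theorem normalIsofibrations_of_isLeibnizPower {X Y : SSet.{v}} (i : X ⟶ Y) [Mono i] {A B P Q : K}
    (hpb : ∀ {A B B' : K} (p : A ⟶ B) (g : B' ⟶ B) (_ : NormalLifting p),
      ∃ c : Cone (cospan p g), IsTwoLimit c)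
    {t : Cone (Functor.empty.{v} K)} (ht : IsTwoLimit t)
    (p : A ⟶ B) (ℓ : P ⟶ Q) (hp : normalIsofibrations K p)
    (h : letI := nerveEnrichment K; IsLeibnizPower i p ℓ) : normalIsofibrations K ℓ := by
  let _ := nerveEnrichment K
  obtain ⟨s⟩ := (normalIsofibrations_iff p).1 hp
  obtain ⟨AX, BX, BY, cAY, cAX, cBX, cBY, Ai, pY, pX, Bi, fst, snd, hAY, hAX, hBX, hBY, hAi, hpY,
    hpX, hBi, hQ, rfl, rfl⟩ := h
  have hid (Z : SSet.{v}) (z : SSet.hoFunctor.obj Z) :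
      (SSet.hoFunctor.map (𝟙 Z)).toFunctor.obj z = z :=
    Functor.congr_obj (congrArg Cat.Hom.toFunctor (SSet.hoFunctor.map_id Z)) z
  have eX d := Functor.congr_obj hpX.comp_eq d
  have eY d := Functor.congr_obj hpY.comp_eq d
  have eA d := Functor.congr_obj hAi.comp_eq d
  have eB d := Functor.congr_obj hBi.comp_eq d
  have eX' d : ((toNerveEquiv X (AX ⟶ A)).symm cAX).obj d ≫ p =
      pX ≫ ((toNerveEquiv X (BX ⟶ B)).symm cBX).obj d := by
    refine Eq.trans ?_ (eX d)
    exact congrArg (fun z => ((toNerveEquiv X (AX ⟶ A)).symm cAX).obj z ≫ p) (hid X d).symm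
  obtain ⟨sX⟩ := IsTwoPower.normalLifting s hAX.isTwoPower hBX.isTwoPower pX eX' ht
  obtain ⟨c, hc⟩ := hpb pX Bi sX
  refine (normalIsofibrations_iff ℓ).2 (normalLifting_leibniz (SSet.hoFunctor.map i).toFunctor
    (hoFunctor_map_obj_injective i) s hAY.isTwoPower hAX.isTwoPower hBY.isTwoPower
    (isTwoPullback_of_isTwoLimit (hc.of_isLimit hQ.isLimit)) ℓ (fun d => ?_) (fun d => ?_) eX'
    (fun d => ?_))
  · exact (Strict.comp_id _).symm.trans (eA d)
  · refine Eq.trans ?_ (eY d)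
    exact congrArg (fun z => ((toNerveEquiv Y (P ⟶ A)).symm cAY).obj z ≫ p) (hid Y d).symm
  · exact (Strict.comp_id _).symm.trans (eB d)

/-- In a 2-category with flexible limits, the normal isofibrations are the isofibrations of a
Cauchy-complete 2-cosmos. -/
theorem HasFlexibleLimits.isCauchyCompleteTwoCosmos (hK : HasFlexibleLimits K) :
    IsCauchyCompleteTwoCosmos (normalIsofibrations K) := by
  let _ := nerveEnrichment K
  have hpb {A B B' : K} (p : A ⟶ B) (g : B' ⟶ B) (s : NormalLifting p) :
      ∃ c : Cone (cospan p g), IsTwoLimit c := by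
    obtain ⟨P, fst, snd, h⟩ := hK.exists_isTwoPullback p g s
    exact ⟨_, h.isTwoLimit⟩
  refine
    { comp_mem := ⟨fun f g hf hg => ?_⟩
      iso_mem := fun A B f hf => ?_
      quasicategory := fun A B => inferInstanceAs (SSet.Quasicategory (nerve (A ⟶ B)))
      isofibration := fun A {B B'} p hp => ?_
      hasProducts := ⟨fun I => ⟨fun F => ?_⟩⟩
      hasPowers := fun X A => ?_
      hasPullbacks := fun p g hp => ?_
      hasTowerLimits := fun F hF => ?_
      pullback_mem := ⟨fun sq hg => ?_⟩
      product_mem := fun I => ⟨fun X₁ X₂ c₁ c₂ h₁ h₂ f hf φ hφ => ?_⟩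
      tower_mem := fun F c hF hc n => ?_
      leibniz_mem := fun {X Y} i _ {A B} p {P Q} ℓ hp h =>
        normalIsofibrations_of_isLeibnizPower i hpb
          (hK.exists_isTwoLimit_discrete (Functor.empty.{v} K)).choose_spec p ℓ hp h
      terminal_mem := fun {A T} f hT => ?_
      splitIdempotents := hK.isIdempotentComplete
      retract_mem := ⟨fun {X Y Z W f g} h hg => ?_⟩ }
  · obtain ⟨s⟩ := (normalIsofibrations_iff f).1 hf
    obtain ⟨t⟩ := (normalIsofibrations_iff g).1 hg
    exact (normalIsofibrations_iff _).2 (s.comp t)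
  · have : IsIso f := hf
    exact (normalIsofibrations_iff _).2
      (NormalLifting.of_iso f (inv f) (IsIso.hom_inv_id f) (IsIso.inv_hom_id f))
  · obtain ⟨s⟩ := (normalIsofibrations_iff p).1 hp
    rw [eHomWhiskerLeft_eq_nerveMap]
    exact isQCatIsofibration_nerveMap _ fun x β h =>
      ⟨s.lift x β h, s.lift_src x β h, s.lift_postcomp x β h⟩
  · obtain ⟨c, hc⟩ := hK.exists_isTwoLimit_discrete F
    exact hasConicalLimit_of_isTwoLimit hc
  · obtain ⟨P, ξ, h⟩ := hK.exists_isTwoPower (SSet.hoFunctor.obj X) A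
    exact ⟨P, _, isPower_toNerveEquiv h⟩
  · obtain ⟨s⟩ := (normalIsofibrations_iff p).1 hp
    obtain ⟨c, hc⟩ := hpb p g s
    exact hasConicalLimit_of_isTwoLimit hc
  · obtain ⟨c, hc⟩ := hK.exists_isTwoLimit_tower F
      fun n => ((normalIsofibrations_iff _).1 (hF n)).some
    exact hasConicalLimit_of_isTwoLimit hc
  · obtain ⟨s⟩ := (normalIsofibrations_iff _).1 hg
    obtain ⟨c, hc⟩ := hpb _ _ s
    exact (normalIsofibrations_iff _).2
      ((isTwoPullback_of_isTwoLimit (hc.of_isLimit sq.isLimit)).normalLifting s)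
  · obtain ⟨d₁, hd₁⟩ := hK.exists_isTwoLimit_discrete X₁
    obtain ⟨d₂, hd₂⟩ := hK.exists_isTwoLimit_discrete X₂
    exact (normalIsofibrations_iff φ).2
      ((isTwoProduct_of_isTwoLimit (hd₁.of_isLimit h₁)).normalLifting
      (isTwoProduct_of_isTwoLimit (hd₂.of_isLimit h₂)) (fun i => f.app ⟨i⟩)
      (fun i => ((normalIsofibrations_iff _).1 (hf ⟨i⟩)).some) φ fun i => hφ ⟨i⟩)
  · have s n := ((normalIsofibrations_iff _).1 (hF n)).some
    obtain ⟨d, hd⟩ := hK.exists_isTwoLimit_tower F s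
    exact (normalIsofibrations_iff _).2 ((hd.of_isLimit hc).normalLifting_tower s n)
  · obtain ⟨d, hd⟩ := hK.exists_isTwoLimit_discrete (Functor.empty.{v} K)
    let c : Cone (Functor.empty.{v} K) := ⟨T, ⟨fun j => j.as.elim, fun j => j.as.elim⟩⟩
    have hc : IsLimit c :=
      ⟨fun s => hT.from s.pt, fun s j => j.as.elim, fun s m _ => hT.hom_ext _ _⟩
    exact (normalIsofibrations_iff f).2 (NormalLifting.of_subsingleton f fun X =>
      ⟨fun x y => (hd.of_isLimit hc).functor_ext fun j => j.as.elim⟩)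
  · obtain ⟨s⟩ := (normalIsofibrations_iff g).1 hg
    exact (normalIsofibrations_iff f).2 (s.of_retract h.i.left h.r.left h.i.right h.r.right
      h.i_w h.r_w h.left.retract h.right.retract)

end Cosmos

/-! ### Limits in a 2-cosmos -/

section CosmosLimits

variable {K : Type u} [Bicategory.{v, v} K] [Bicategory.Strict K]

variable (K) in
/-- The limits in the 2-category `K` which are part of the structure of a 2-cosmos on the normal
isofibrations, apart from the limits of towers. -/
structure HasCosmosLimits : Prop where
  product {I : Type v} (A : I → K) : ∃ (P : K) (π : ∀ i, P ⟶ A i), IsTwoProduct π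
  power (C : Type v) [Category.{v} C] (A : K) : ∃ (P : K) (ξ : C ⥤ (P ⟶ A)), IsTwoPower ξ
  pullback {A B B' : K} (p : A ⟶ B) (g : B' ⟶ B) (_ : NormalLifting p) :
    ∃ (P : K) (fst : P ⟶ A) (snd : P ⟶ B'), IsTwoPullback fst snd p g

theorem IsCauchyCompleteTwoCosmos.hasCosmosLimits
    (h : IsCauchyCompleteTwoCosmos (normalIsofibrations K)) : HasCosmosLimits K := by
  let _ := nerveEnrichment K
  refine ⟨fun A => ?_, fun C _ A => ?_, fun p g s => ?_⟩
  · have := h.hasProducts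
    exact ⟨_, _, isTwoProduct_of_isTwoLimit
      (isTwoLimit_limitCone (Discrete.functor A))⟩
  · obtain ⟨P, c, hc⟩ := h.hasPowers (nerve C) A
    obtain ⟨p, q, hpq, hqp⟩ := exists_hoFunctor_nerve_iso C
    refine ⟨P, q ⋙ (toNerveEquiv _ _).symm c, fun T _ X G => ?_⟩
    refine (existsUnique_congr fun y => ?_).1 (hc.isTwoPower T X ((𝟭 T).prod p ⋙ G))
    constructor
    · intro e
      change (𝟭 T).prod q ⋙ hcomp y ((toNerveEquiv _ _).symm c) = G
      rw [e]
      change (𝟭 T).prod (q ⋙ p) ⋙ G = G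
      rw [hqp]; rfl
    · rintro rfl
      change _ = hcomp y ((p ⋙ q) ⋙ (toNerveEquiv _ _).symm c)
      rw [hpq]; rfl
  · have := h.hasPullbacks p g ((normalIsofibrations_iff p).2 ⟨s⟩)
    exact ⟨_, _, _, isTwoPullback_of_isTwoLimit
      (isTwoLimit_limitCone (cospan p g))⟩

/-- Restriction `B ^ D ⟶ B ^ C` along a functor `F : C ⥤ D` which is injective on objects is a
normal isofibration: it is the Leibniz power of `B ⟶ 1` by `F`. -/
theorem IsTwoPower.normalLifting_restrict {I : Type v} [IsEmpty I] {O : K} {A : I → K}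
    {π : ∀ i, O ⟶ A i} (hO : IsTwoProduct π) {C D : Type v} [Category.{v} C] [Category.{v} D]
    (F : C ⥤ D) (hF : Function.Injective F.obj) {B PC PD : K} {ξC : C ⥤ (PC ⟶ B)}
    (hC : IsTwoPower ξC) {ξD : D ⥤ (PD ⟶ B)} (hD : IsTwoPower ξD) (q : PD ⟶ PC)
    (hq : ∀ c, ξD.obj (F.obj c) = q ≫ ξC.obj c) : Nonempty (NormalLifting q) := by
  have ex (T : Type v) [Category.{v} T] (X : K) : Nonempty (T ⥤ (X ⟶ O)) :=
    (hO T X fun i => isEmptyElim i).exists.nonempty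
  have ext {T : Type v} [Category.{v} T] {X : K} (y y' : T ⥤ (X ⟶ O)) : y = y' :=
    hO.functor_ext fun i => isEmptyElim i
  have ext' {X : K} (y y' : X ⟶ O) : y = y' := hO.hom_ext fun i => isEmptyElim i
  obtain ⟨b⟩ := ex FreeIso.{v} B
  obtain ⟨c⟩ := ex FreeIso.{v} PC
  have hpow (D : Type v) [Category.{v} D] : IsTwoPower ((Functor.const D).obj (𝟙 O)) :=
    fun T _ X G => by
      obtain ⟨y⟩ := ex T X
      exact ⟨y, ext _ _, fun y' _ => ext _ _⟩
  have hQ : IsTwoPullback (𝟙 PC) (c.obj .src) (c.obj .src) (𝟙 O) :=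
    ⟨ext' _ _, fun T _ X h₁ h₂ _ => ⟨h₁, ⟨comp_postcomp_id _, ext _ _⟩,
      fun y hy => (comp_postcomp_id y).symm.trans hy.1⟩⟩
  obtain ⟨s⟩ := NormalLifting.of_subsingleton (b.obj .src) fun X => ⟨ext⟩
  exact normalLifting_leibniz F hF s hD hC (hpow D) (ξBC := (Functor.const C).obj (𝟙 O)) hQ q
    (fun c => by rw [Strict.comp_id, hq]) (fun _ => ext' _ _) (fun _ => ext' _ _) fun _ => ext' _ _

theorem IsTwoPower.exists_hom {W : Type*} [Category* W] {A P : K} {ξ : W ⥤ (P ⟶ A)}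
    (hξ : IsTwoPower ξ) {X : K} (G : W ⥤ (X ⟶ A)) : ∃ x : X ⟶ P, ξ ⋙ precomp A x = G := by
  obtain ⟨y, hy, -⟩ := hξ FreeIso.{v} X (CategoryTheory.Prod.snd _ _ ⋙ G)
  exact ⟨y.obj .src, by rw [← const_prod'_hcomp, hy]; rfl⟩

theorem IsTwoProduct.exists_hom {I : Type*} {A : I → K} {P : K} {π : ∀ i, P ⟶ A i}
    (hP : IsTwoProduct π) {X : K} (f : ∀ i, X ⟶ A i) : ∃ x : X ⟶ P, ∀ i, x ≫ π i = f i := by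
  obtain ⟨y, hy, -⟩ := hP FreeIso.{v} X fun i => (Functor.const _).obj (f i)
  exact ⟨y.obj .src, fun i => Functor.congr_obj (hy i) .src⟩

/-- Functors `C i ⥤ K(L, B i)` can be extended universally along functors `F i : C i ⥤ D i` which
are injective on objects.  The universal object is the pullback of a map into the product of the
powers `B i ^ C i` along the product of the restrictions `B i ^ D i ⟶ B i ^ C i`. -/
theorem HasCosmosLimits.exists_extension (hK : HasCosmosLimits K) {I : Type v} {L : K} {B : I → K}
    {C D : I → Type v} [∀ i, Category.{v} (C i)] [∀ i, Category.{v} (D i)] (F : ∀ i, C i ⥤ D i)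
    (hF : ∀ i, Function.Injective (F i).obj) (H : ∀ i, C i ⥤ (L ⟶ B i)) :
    ∃ (M : K) (k : M ⟶ L) (G : ∀ i, D i ⥤ (M ⟶ B i)),
      (∀ i, F i ⋙ G i = H i ⋙ precomp (B i) k) ∧
      ∀ (T : Type v) [Category.{v} T] (X : K) (y : T ⥤ (X ⟶ L)) (g : ∀ i, T × D i ⥤ (X ⟶ B i)),
        (∀ i, (𝟭 T).prod (F i) ⋙ g i = hcomp y (H i)) →
          ∃! z : T ⥤ (X ⟶ M), z ⋙ postcomp X k = y ∧ ∀ i, hcomp z (G i) = g i := by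
  choose PC ξC hC using fun i => hK.power (C i) (B i)
  choose PD ξD hD using fun i => hK.power (D i) (B i)
  choose q hq using fun i => (hC i).exists_hom (F i ⋙ ξD i)
  choose h hh using fun i => (hC i).exists_hom (H i)
  obtain ⟨QC, πC, hπC⟩ := hK.product PC
  obtain ⟨QD, πD, hπD⟩ := hK.product PD
  obtain ⟨O, π, hO⟩ := hK.product (PEmpty.elim : PEmpty.{v + 1} → K)
  have s (i : I) := Classical.choice (IsTwoPower.normalLifting_restrict hO (F i) (hF i) (hC i)
    (hD i) (q i) fun c => (Functor.congr_obj (hq i) c).symm)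
  obtain ⟨Q, hQ⟩ := hπC.exists_hom fun i => πD i ≫ q i
  obtain ⟨h', hh'⟩ := hπC.exists_hom h
  obtain ⟨t⟩ := hπD.normalLifting hπC q s Q hQ
  obtain ⟨M, d, k, hM⟩ := hK.pullback Q h' t
  refine ⟨M, k, fun i => ξD i ⋙ precomp (B i) (d ≫ πD i), fun i => ?_, fun T _ X y g hg => ?_⟩
  · rw [← Functor.assoc, ← hq, ← hh, comp_precomp_precomp, comp_precomp_precomp, Strict.assoc,
      ← hQ, ← Strict.assoc, hM.w, Strict.assoc, hh']
  · choose e he heu using fun i => hD i T X (g i)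
    obtain ⟨e', he', heu'⟩ := hπD T X e
    have hw : e' ⋙ postcomp X Q = y ⋙ postcomp X h' := by
      refine hπC.functor_ext fun i => (hC i).functor_ext ?_
      rw [comp_postcomp_postcomp, comp_postcomp_postcomp, hQ, hh', ← comp_postcomp_postcomp, he',
        ← hcomp_precomp, ← hcomp_precomp, hq, hh, ← hg, ← he]
      rfl
    refine (existsUnique_congr fun z => ?_).1 (hM.existsUnique T X e' y hw)
    rw [and_comm]
    refine and_congr_right fun _ => ⟨?_, fun hz => heu' _ fun i => heu i _ ?_⟩
    · rintro rfl i
      rw [hcomp_precomp, ← comp_postcomp_postcomp, he', he]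
    · rw [← hz i, hcomp_precomp, ← comp_postcomp_postcomp]

end CosmosLimits

/-! ### Parallel arrows -/

/-- The category with two objects `src` and `tgt` whose non-identity morphisms are a set `A` of
parallel morphisms `src ⟶ tgt`. -/
inductive WalkingArrows (A : Type v) : Type v
  | src
  | tgt

namespace WalkingArrows

variable {A : Type v}

/-- The morphisms of `WalkingArrows A`. -/
protected def Hom : WalkingArrows A → WalkingArrows A → Type v
  | src, src => PUnit
  | src, tgt => A
  | tgt, src => PEmpty
  | tgt, tgt => PUnit

instance : Category.{v} (WalkingArrows A) where
  Hom := WalkingArrows.Hom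
  id x := match x with
    | src => PUnit.unit
    | tgt => PUnit.unit
  comp {x y z} f g := match x, y, z, f, g with
    | src, src, _, _, g => g
    | src, tgt, tgt, f, _ => f
    | tgt, tgt, _, _, g => g
  id_comp {x y} f := by cases x <;> rfl
  comp_id {x y} f := by cases x <;> cases y <;> first | rfl | cases f
  assoc {x y z w} f g h := by
    cases x <;> cases y <;> cases z <;> cases w <;> first | rfl | cases f | cases g

/-- The morphism of `WalkingArrows A` given by an element of `A`. -/
def arrow (a : A) : (src : WalkingArrows A) ⟶ tgt := a

variable {C : Type*} [Category* C]

/-- The functor given by a family of parallel morphisms. -/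
def lift {X Y : C} (f : A → (X ⟶ Y)) : WalkingArrows A ⥤ C where
  obj x := match x with
    | src => X
    | tgt => Y
  map {x y} m := match x, y, m with
    | src, src, _ => 𝟙 X
    | src, tgt, a => f a
    | tgt, tgt, _ => 𝟙 Y
  map_id x := by cases x <;> rfl
  map_comp {x y z} m n := by
    cases x <;> cases y <;> cases z <;>
      first
      | exact PEmpty.elim m
      | exact PEmpty.elim n
      | exact (Category.id_comp _).symm
      | exact (Category.comp_id _).symm

theorem functor_ext {F G : WalkingArrows A ⥤ C} (h₀ : F.obj src = G.obj src)
    (h₁ : F.obj tgt = G.obj tgt) (h : ∀ a, HEq (F.map (arrow a)) (G.map (arrow a))) : F = G := by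
  refine Functor.hext (fun x => by cases x <;> assumption) fun x y m => ?_
  rcases x with _ | _ <;> rcases y with _ | _
  · obtain rfl : m = 𝟙 _ := rfl
    rw [F.map_id, G.map_id]; exact heq_id_of_eq h₀
  · exact h m
  · exact PEmpty.elim m
  · obtain rfl : m = 𝟙 _ := rfl
    rw [F.map_id, G.map_id]; exact heq_id_of_eq h₁

theorem exists_eq_lift (F : WalkingArrows PUnit.{v + 1} ⥤ C) {X Y : C} (h₀ : F.obj src = X)
    (h₁ : F.obj tgt = Y) : ∃ α : X ⟶ Y, F = lift fun _ => α := by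
  subst h₀ h₁
  exact ⟨F.map (arrow ⟨⟩), functor_ext rfl rfl fun _ => HEq.rfl⟩

theorem lift_comp {D : Type*} [Category* D] {X Y : C} (f : A → (X ⟶ Y)) (F : C ⥤ D) :
    lift f ⋙ F = lift fun a => F.map (f a) :=
  functor_ext rfl rfl fun _ => HEq.rfl

end WalkingArrows

/-! ### Equifiers and freely adjoined functors -/

section Equifiers

variable {K : Type u} [Bicategory.{v, v} K] [Bicategory.Strict K]

/-- A 2-cosmos has equifiers: an equifier of parallel 2-cells is an extension of the functor on
two parallel arrows that they define to the category with one arrow. -/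
theorem HasCosmosLimits.exists_equifier (hK : HasCosmosLimits K) {I : Type v} {L : K} {B : I → K}
    (u v : ∀ i, L ⟶ B i) (α β : ∀ i, u i ⟶ v i) :
    ∃ (M : K) (k : M ⟶ L), (∀ i, k ◁ α i = k ◁ β i) ∧
      ∀ (T : Type v) [Category.{v} T] (X : K) (y : T ⥤ (X ⟶ L)),
        (∀ t i, y.obj t ◁ α i = y.obj t ◁ β i) → ∃! z : T ⥤ (X ⟶ M), z ⋙ postcomp X k = y := by
  let F : WalkingArrows (ULift.{v} Bool) ⥤ WalkingArrows PUnit.{v + 1} :=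
    WalkingArrows.lift fun _ => WalkingArrows.arrow ⟨⟩
  -- a section of `F`: it shows that the extension is determined by the first arrow
  let S : WalkingArrows PUnit.{v + 1} ⥤ WalkingArrows (ULift.{v} Bool) :=
    WalkingArrows.lift fun _ => WalkingArrows.arrow ⟨false⟩
  have hSF : S ⋙ F = 𝟭 _ := WalkingArrows.functor_ext rfl rfl fun _ => HEq.rfl
  let H (i : I) : WalkingArrows (ULift.{v} Bool) ⥤ (L ⟶ B i) :=
    WalkingArrows.lift fun b => cond b.down (β i) (α i)
  obtain ⟨M, k, G, hG, hu⟩ := hK.exists_extension (fun _ : I => F)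
    (fun _ => by rintro (_ | _) (_ | _) h <;> first | rfl | cases h) H
  have hG' (i : I) : G i = (WalkingArrows.lift fun _ => α i) ⋙ precomp (B i) k :=
    calc G i = (S ⋙ F) ⋙ G i := by rw [hSF]; rfl
      _ = (S ⋙ H i) ⋙ precomp (B i) k := congrArg (S ⋙ ·) (hG i)
      _ = (WalkingArrows.lift fun _ => α i) ⋙ precomp (B i) k :=
        congrArg (· ⋙ precomp (B i) k) (WalkingArrows.lift_comp _ _)
  refine ⟨M, k, fun i => ?_, fun T _ X y hy => ?_⟩
  · have h₁ := heq_map_of_eq (hG i) (WalkingArrows.arrow ⟨false⟩)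
    have h₂ := heq_map_of_eq (hG i) (WalkingArrows.arrow ⟨true⟩)
    exact eq_of_heq (h₁.symm.trans h₂)
  · obtain ⟨z, ⟨hz, -⟩, hzu⟩ := hu T X y
      (fun i => hcomp y (WalkingArrows.lift fun _ => α i)) fun i => by
        refine Functor.hext (by rintro ⟨t, (_ | _)⟩ <;> rfl) ?_
        rintro ⟨t, (_ | _)⟩ ⟨t', (_ | _)⟩ ⟨m, n⟩
        · exact HEq.rfl
        · rcases n with ⟨_ | _⟩
          · exact HEq.rfl
          · exact heq_of_eq (congrArg (y.map m ▷ u i ≫ ·) (hy t' i))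
        · exact PEmpty.elim n
        · exact HEq.rfl
    refine ⟨z, hz, fun z' hz' => hzu z' ⟨hz', fun i => ?_⟩⟩
    rw [hG', hcomp_precomp, hz']

theorem HasCosmosLimits.exists_equifier_heq (hK : HasCosmosLimits K) {I : Type v} {L : K}
    {B : I → K} {u u' v v' : ∀ i, L ⟶ B i} (hu : u = u') (hv : v = v') (α : ∀ i, u i ⟶ v i)
    (β : ∀ i, u' i ⟶ v' i) :
    ∃ (M : K) (k : M ⟶ L), (∀ i, HEq (k ◁ α i) (k ◁ β i)) ∧
      ∀ (T : Type v) [Category.{v} T] (X : K) (y : T ⥤ (X ⟶ L)),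
        (∀ t i, HEq (y.obj t ◁ α i) (y.obj t ◁ β i)) →
          ∃! z : T ⥤ (X ⟶ M), z ⋙ postcomp X k = y := by
  subst hu hv
  simpa only [heq_eq_eq] using hK.exists_equifier u v α β

/-- Objects of the hom-categories `K(L, B i)` can be extended universally to functors on
categories `C i` having them as values at the objects. -/
theorem HasCosmosLimits.exists_functor (hK : HasCosmosLimits K) {I : Type v} {L : K} {B : I → K}
    {C : I → Type v} [∀ i, Category.{v} (C i)] (φ : ∀ i, C i → (L ⟶ B i)) :
    ∃ (M : K) (k : M ⟶ L) (G : ∀ i, C i ⥤ (M ⟶ B i)), (∀ i c, (G i).obj c = k ≫ φ i c) ∧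
      ∀ (T : Type v) [Category.{v} T] (X : K) (y : T ⥤ (X ⟶ L)) (g : ∀ i, T × C i ⥤ (X ⟶ B i)),
        (∀ i c, Functor.prod' (𝟭 T) ((Functor.const T).obj c) ⋙ g i = y ⋙ postcomp X (φ i c)) →
          ∃! z : T ⥤ (X ⟶ M), z ⋙ postcomp X k = y ∧ ∀ i, hcomp z (G i) = g i := by
  obtain ⟨M, k, G, hG, hu⟩ := hK.exists_extension
    (fun i => (Discrete.functor id : Discrete (C i) ⥤ C i))
    (fun i => by rintro ⟨c⟩ ⟨c'⟩ (rfl : c = c'); rfl) fun i => Discrete.functor (φ i)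
  refine ⟨M, k, G, fun i c => Functor.congr_obj (hG i) ⟨c⟩, fun T _ X y g hg =>
    hu T X y g fun i => ?_⟩
  refine Functor.hext (fun ⟨t, ⟨c⟩⟩ => Functor.congr_obj (hg i c) t) ?_
  rintro ⟨t, ⟨c⟩⟩ ⟨t', ⟨c'⟩⟩ ⟨m, n⟩
  obtain rfl : c = c' := Discrete.eq_of_hom n
  obtain rfl : n = 𝟙 _ := Subsingleton.elim _ _
  refine HEq.trans (heq_of_eq ?_) ((heq_map_of_eq (hg i c) m).trans (heq_of_eq ?_))
  · change (g i).map _ = (g i).map _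
    exact congrArg (fun n : c ⟶ c => (g i).map ((m, n) : (t, c) ⟶ (t', c)))
      ((Discrete.functor id).map_id ⟨c⟩)
  · change _ = y.map m ▷ φ i c ≫ y.obj t' ◁ (Discrete.functor (φ i)).map (𝟙 _)
    refine ((congrArg (y.map m ▷ φ i c ≫ ·) ?_).trans (Category.comp_id _)).symm
    exact (congrArg (y.obj t' ◁ ·) ((Discrete.functor (φ i)).map_id ⟨c⟩)).trans
      (whiskerLeft_id _ _)

end Equifiers

/-! ### A free cover of a weight -/

section Cover

theorem eqToHom_comp_comp_eqToHom_heq {C : Type*} [Category* C] {X X' Y Y' : C} (hX : X = X')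
    (f : X' ⟶ Y') (hY : Y' = Y) : HEq (eqToHom hX ≫ f ≫ eqToHom hY) f := by
  subst hX hY; simp

theorem heq_toNatTrans_app {C D : Cat.{v, u}} {F F' G G' : C ⟶ D} (hF : F = F') (hG : G = G')
    {α : F ⟶ G} {α' : F' ⟶ G'} (h : HEq α α') {c c' : C} (hc : c = c') :
    HEq (α.toNatTrans.app c) (α'.toNatTrans.app c') := by
  subst hF hG hc; cases h; rfl

theorem heq_of_toNatTrans_app {C D : Cat.{v, u}} {F F' G G' : C ⟶ D} (hF : F = F') (hG : G = G')
    {α : F ⟶ G} {α' : F' ⟶ G'} (h : ∀ c, HEq (α.toNatTrans.app c) (α'.toNatTrans.app c)) :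
    HEq α α' := by
  subst hF hG
  exact heq_of_eq (Cat.Hom₂.ext (NatTrans.ext (funext fun c => eq_of_heq (h c))))

theorem map₂_whiskerLeft_heq {B C : Type*} [Bicategory B] [Bicategory C]
    (F : StrictPseudofunctor B C) {a b c : B} (f : a ⟶ b) {g g' : b ⟶ c} (η : g ⟶ g') :
    HEq (F.map₂ (f ◁ η)) (F.map f ◁ F.map₂ η) := by
  rw [F.map₂_whisker_left, F.mapComp_eq_eqToIso, F.mapComp_eq_eqToIso]
  exact eqToHom_comp_comp_eqToHom_heq (F.map_comp _ _) _ (F.map_comp _ _).symm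

theorem map₂_whiskerRight_heq {B C : Type*} [Bicategory B] [Bicategory C]
    (F : StrictPseudofunctor B C) {a b c : B} {f f' : a ⟶ b} (η : f ⟶ f') (g : b ⟶ c) :
    HEq (F.map₂ (η ▷ g)) (F.map₂ η ▷ F.map g) := by
  rw [F.map₂_whisker_right, F.mapComp_eq_eqToIso, F.mapComp_eq_eqToIso]
  exact eqToHom_comp_comp_eqToHom_heq (F.map_comp _ _) _ (F.map_comp _ _).symm

variable {J : Type v} [Bicategory.{v, v} J] [Bicategory.Strict J]
  (W : StrictPseudofunctor J Cat.{v, v})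

/-- The value at `b` of the free cover of the weight `W`: its objects are the pairs of a 1-cell
`f : a ⟶ b` and an object `x` of `W a`, and its morphisms are those between the objects
`W f x` of `W b`. -/
abbrev CoverObj (b : J) : Type v :=
  InducedCategory (W.obj b) fun z : Σ a, (a ⟶ b) × W.obj a => (W.map z.2.1).toFunctor.obj z.2.2

namespace CoverObj

variable {W}

/-- The object of the free cover of a weight given by a 1-cell `f : a ⟶ b` and an object of
`W a`. -/
def mk {a b : J} (f : a ⟶ b) (x : W.obj a) : CoverObj W b := ⟨a, f, x⟩

theorem map_comp_obj {a b c : J} (f : a ⟶ b) (g : b ⟶ c) (x : W.obj a) :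
    (W.map (f ≫ g)).toFunctor.obj x = (W.map g).toFunctor.obj ((W.map f).toFunctor.obj x) :=
  Functor.congr_obj (congrArg Cat.Hom.toFunctor (W.map_comp f g)) x

variable (W) in
/-- The projection from the free cover of a weight. -/
abbrev proj (b : J) : CoverObj W b ⥤ W.obj b :=
  inducedFunctor _

/-- The action of a 1-cell on the free cover of a weight. -/
def map {b c : J} (g : b ⟶ c) : CoverObj W b ⥤ CoverObj W c where
  obj z := ⟨z.1, z.2.1 ≫ g, z.2.2⟩
  map m := InducedCategory.homMk (eqToHom (map_comp_obj _ _ _) ≫ (W.map g).toFunctor.map m.hom ≫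
    eqToHom (map_comp_obj _ _ _).symm)
  map_id z := by
    ext
    change eqToHom _ ≫ (W.map g).toFunctor.map (𝟙 _) ≫ eqToHom _ = 𝟙 _
    simp
  map_comp m n := by
    ext
    change eqToHom _ ≫ (W.map g).toFunctor.map (m.hom ≫ n.hom) ≫ eqToHom _ =
      (eqToHom _ ≫ (W.map g).toFunctor.map m.hom ≫ eqToHom _) ≫
      (eqToHom _ ≫ (W.map g).toFunctor.map n.hom ≫ eqToHom _)
    simp

theorem map_comp_proj {b c : J} (g : b ⟶ c) :
    map g ⋙ proj W c = proj W b ⋙ (W.map g).toFunctor :=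
  CategoryTheory.Functor.ext (fun _ => map_comp_obj _ _ _) fun _ _ _ => rfl

/-- The action of a 2-cell on the free cover of a weight. -/
def map₂ {b c : J} {g g' : b ⟶ c} (η : g ⟶ g') : (map g : CoverObj W b ⥤ _) ⟶ map g' where
  app z := InducedCategory.homMk (eqToHom (map_comp_obj _ _ _) ≫
    (W.map₂ η).toNatTrans.app ((proj W b).obj z) ≫ eqToHom (map_comp_obj _ _ _).symm)
  naturality z z' m := by
    ext
    have h₀ (z : CoverObj W b) {g : b ⟶ c} := map_comp_obj z.2.1 g z.2.2
    refine eq_of_heq (HEq.trans (heq_comp_of_heq (h₀ z) (h₀ z') (h₀ z')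
      (eqToHom_comp_comp_eqToHom_heq _ _ _) (eqToHom_comp_comp_eqToHom_heq _ _ _)) (HEq.trans
      (heq_of_eq ((W.map₂ η).toNatTrans.naturality m.hom)) (heq_comp_of_heq (h₀ z) (h₀ z) (h₀ z')
      (eqToHom_comp_comp_eqToHom_heq _ _ _) (eqToHom_comp_comp_eqToHom_heq _ _ _)).symm))

theorem map₂_app_heq {b c : J} {g g' : b ⟶ c} (η : g ⟶ g') (z : CoverObj W b) :
    HEq ((map₂ η).app z).hom ((W.map₂ η).toNatTrans.app ((proj W b).obj z)) :=
  eqToHom_comp_comp_eqToHom_heq _ _ _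

theorem functor_ext {b : J} {C : Type*} [Category* C] {F G : C ⥤ CoverObj W b}
    (h : ∀ c, F.obj c = G.obj c) (h' : F ⋙ proj W b = G ⋙ proj W b) : F = G :=
  functor_eq_of_comp_faithful _ inferInstance h h'

theorem map_id (b : J) : map (𝟙 b) = 𝟭 (CoverObj W b) :=
  functor_ext (fun z => Sigma.ext rfl (heq_of_eq (Prod.ext (Strict.comp_id z.2.1) rfl))) (by
    rw [map_comp_proj, W.map_id]; rfl)

theorem map_comp {a b c : J} (f : a ⟶ b) (g : b ⟶ c) :
    map (f ≫ g) = (map f : CoverObj W a ⥤ _) ⋙ map g :=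
  functor_ext (fun z => Sigma.ext rfl (heq_of_eq (Prod.ext (Strict.assoc z.2.1 f g).symm rfl))) (by
    rw [map_comp_proj, W.map_comp, Functor.assoc, map_comp_proj, ← Functor.assoc, map_comp_proj]
    rfl)

end CoverObj

/-- The free cover of a weight `W`. -/
def coverWeight : StrictPseudofunctor J Cat.{v, v} :=
  StrictPseudofunctor.mk''
    { obj := fun b => Cat.of (CoverObj W b)
      map := fun g => (CoverObj.map g).toCatHom
      map₂ := fun η => (CoverObj.map₂ η).toCatHom₂
      map_id := fun b => Cat.ext (CoverObj.map_id b)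
      map_comp := fun f g => Cat.ext (CoverObj.map_comp f g)
      map₂_id := fun {b c} g => Cat.Hom₂.ext (NatTrans.ext (funext fun z =>
        InducedCategory.hom_ext (eq_of_heq ((CoverObj.map₂_app_heq _ _).trans (by
          rw [PrelaxFunctor.map₂_id]
          exact heq_id_of_eq (CoverObj.map_comp_obj _ _ _).symm)))))
      map₂_comp := fun {b c f g h} η θ => Cat.Hom₂.ext (NatTrans.ext (funext fun z =>
        InducedCategory.hom_ext (eq_of_heq ((CoverObj.map₂_app_heq _ _).trans (by
          rw [PrelaxFunctor.map₂_comp]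
          have h₀ {g : b ⟶ c} := (CoverObj.map_comp_obj z.2.1 g z.2.2).symm
          exact heq_comp_of_heq h₀ h₀ h₀ (CoverObj.map₂_app_heq η z).symm
            (CoverObj.map₂_app_heq θ z).symm)))))
      map₂_whisker_left := fun {a b c} f {g g'} η => Cat.Hom₂.ext (NatTrans.ext (funext fun z => by
        refine InducedCategory.hom_ext (eq_of_heq ((CoverObj.map₂_app_heq _ _).trans ?_))
        have e {g : b ⟶ c} : (CoverObj.map (W := W) (f ≫ g)).toCatHom =
            (CoverObj.map f).toCatHom ≫ (CoverObj.map g).toCatHom := Cat.ext (CoverObj.map_comp f g)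
        refine (heq_toNatTrans_app (W.map_comp f g) (W.map_comp f g')
          (map₂_whiskerLeft_heq W f η) rfl).trans (HEq.symm ?_)
        have h := heq_toNatTrans_app e e (eqToHom_comp_comp_eqToHom_heq e
          ((CoverObj.map f).toCatHom ◁ (CoverObj.map₂ (W := W) η).toCatHom₂) e.symm) (Eq.refl z)
        refine (heq_map_of_heq (CoverObj.proj W c)
          (Functor.congr_obj (CoverObj.map_comp (W := W) f g) z)
          (Functor.congr_obj (CoverObj.map_comp (W := W) f g') z) h).trans ?_
        exact (CoverObj.map₂_app_heq η _).trans
          (heq_toNatTrans_app rfl rfl HEq.rfl (CoverObj.map_comp_obj _ _ _))))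
      map₂_whisker_right := fun {a b c f f'} η g => Cat.Hom₂.ext (NatTrans.ext (funext fun z => by
        refine InducedCategory.hom_ext (eq_of_heq ((CoverObj.map₂_app_heq _ _).trans ?_))
        have e {f : a ⟶ b} : (CoverObj.map (W := W) (f ≫ g)).toCatHom =
            (CoverObj.map f).toCatHom ≫ (CoverObj.map g).toCatHom := Cat.ext (CoverObj.map_comp f g)
        refine (heq_toNatTrans_app (W.map_comp f g) (W.map_comp f' g)
          (map₂_whiskerRight_heq W η g) rfl).trans (HEq.symm ?_)
        have h := heq_toNatTrans_app e e (eqToHom_comp_comp_eqToHom_heq e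
          ((CoverObj.map₂ (W := W) η).toCatHom₂ ▷ (CoverObj.map g).toCatHom) e.symm) (Eq.refl z)
        refine (heq_map_of_heq (CoverObj.proj W c)
          (Functor.congr_obj (CoverObj.map_comp (W := W) f g) z)
          (Functor.congr_obj (CoverObj.map_comp (W := W) f' g) z) h).trans ?_
        exact (eqToHom_comp_comp_eqToHom_heq _ _ _).trans (heq_map_of_heq (W.map g).toFunctor
          (CoverObj.map_comp_obj _ _ _) (CoverObj.map_comp_obj _ _ _)
          (CoverObj.map₂_app_heq η z)))) }

/-- The projection from the free cover of a weight. -/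
def coverWeight.proj : TwoNatTrans (coverWeight W) W where
  app b := (CoverObj.proj W b).toCatHom
  naturality g := Cat.ext (CoverObj.map_comp_proj g)
  naturality₂ {b c g g'} η := by
    have e {g : b ⟶ c} : (CoverObj.map (W := W) g).toCatHom ≫ (CoverObj.proj W c).toCatHom =
        (CoverObj.proj W b).toCatHom ≫ W.map g := Cat.ext (CoverObj.map_comp_proj g)
    refine (eq_comp_eqToHom_iff_heq e).2 (HEq.trans ?_ (eqToHom_comp_heq _ e).symm)
    exact heq_of_toNatTrans_app e e fun z => CoverObj.map₂_app_heq η z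

end Cover

/-! ### Limits weighted by covers -/

section

variable {J : Type v} [Bicategory.{v, v} J] [Bicategory.Strict J]
  {K : Type u} [Bicategory.{v, v} K] [Bicategory.Strict K]

/-- The functors `Γ a : T × W a ⥤ K(X, D a)` form a functor from `T` to the category of cylinders
from `W` to `D` with vertex `X`. -/
structure IsCylinderFunctor (W : StrictPseudofunctor J Cat.{v, v}) (D : StrictPseudofunctor J K)
    {T : Type v} [Category.{v} T] {X : K} (Γ : ∀ a, T × W.obj a ⥤ (X ⟶ D.obj a)) : Prop where
  naturality {a b : J} (f : a ⟶ b) :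
    (𝟭 T).prod (W.map f).toFunctor ⋙ Γ b = Γ a ⋙ postcomp X (D.map f)
  naturality₂ {a b : J} {f g : a ⟶ b} (η : f ⟶ g) (t : T) (w : W.obj a) :
    HEq ((Functor.prod' ((Functor.const _).obj t) (𝟭 _) ⋙ Γ b).map
      ((W.map₂ η).toNatTrans.app w)) ((Γ a).obj (t, w) ◁ D.map₂ η)

/-- The cylinder `ξ` induces, for every `X`, a bijection between functors from a small category
`T` to `K(X, L)` and functors from `T` to the category of cylinders with vertex `X`. -/
def IsWeightedLimitOnFunctors {W : StrictPseudofunctor J Cat.{v, v}} {D : StrictPseudofunctor J K}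
    {L : K} (ξ : Cylinder W D L) : Prop :=
  ∀ (T : Type v) [Category.{v} T] (X : K) (Γ : ∀ a, T × W.obj a ⥤ (X ⟶ D.obj a)),
    IsCylinderFunctor W D Γ → ∃! y : T ⥤ (X ⟶ L), ∀ a, hcomp y (ξ.app a) = Γ a

variable {W : StrictPseudofunctor J Cat.{v, v}} {D : StrictPseudofunctor J K}

/-- The cylinder which is the value at `t` of a functor to the category of cylinders. -/
def IsCylinderFunctor.cylinder {T : Type v} [Category.{v} T] {X : K}
    {Γ : ∀ a, T × W.obj a ⥤ (X ⟶ D.obj a)} (h : IsCylinderFunctor W D Γ) (t : T) :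
    Cylinder W D X where
  app a := Functor.prod' ((Functor.const _).obj t) (𝟭 _) ⋙ Γ a
  naturality f :=
    congrArg (fun F => Functor.prod' ((Functor.const _).obj t) (𝟭 _) ⋙ F) (h.naturality f)
  naturality₂ η w := h.naturality₂ η t w

/-- The two naturality conditions of a cylinder, combined in one equation. -/
theorem Cylinder.map_comp_heq {X : K} (ζ : Cylinder W D X) {a b : J} {f g : a ⟶ b} (η : f ⟶ g)
    {w w' : W.obj a} (m : w ⟶ w') :
    HEq ((ζ.app b).map ((W.map₂ η).toNatTrans.app w ≫ (W.map g).toFunctor.map m))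
      ((ζ.app a).obj w ◁ D.map₂ η ≫ (ζ.app a).map m ▷ D.map g) := by
  have e {f : a ⟶ b} (w : W.obj a) := Functor.congr_obj (ζ.naturality f) w
  rw [CategoryTheory.Functor.map_comp]
  exact heq_comp_of_heq (e w) (e w) (e w') (ζ.naturality₂ η w)
    (heq_map_of_eq (ζ.naturality g) m)

theorem prod'_const_prod {T A B : Type*} [Category* T] [Category* A] [Category* B] (F : A ⥤ B)
    (a : A) : Functor.prod' (𝟭 T) ((Functor.const T).obj a) ⋙ (𝟭 T).prod F =
      Functor.prod' (𝟭 T) ((Functor.const T).obj (F.obj a)) :=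
  Functor.hext (fun _ => rfl) fun _ _ _ => heq_of_eq (Prod.ext rfl (F.map_id a))

/-- The 2-cells and morphisms on which the compatibility of a family of functors on the free
cover of a weight with the 1-cells and 2-cells of `J` is tested. -/
structure CoverObj.Test (W : StrictPseudofunctor J Cat.{v, v}) : Type v where
  {b c : J}
  {f f' : b ⟶ c}
  η : f ⟶ f'
  {z z' : CoverObj W b}
  m : z ⟶ z'

/-- Limits weighted by the free cover of a weight `W` are constructed from a product of values of
the diagram, indexed by the objects of the categories `W a`, by adjoining the values of a
cylinder at the morphisms and then by imposing the equations between 2-cells that make it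
functorial in the diagram. -/
theorem HasCosmosLimits.exists_cover_limit (hK : HasCosmosLimits K)
    (W : StrictPseudofunctor J Cat.{v, v}) (D : StrictPseudofunctor J K) :
    ∃ (L : K) (ξ : Cylinder (coverWeight W) D L), IsWeightedLimitOnFunctors ξ := by
  -- the values of a cylinder on the free cover at the objects, determined by their values at the
  -- pairs `(𝟙 a, x)`
  obtain ⟨L, π, hπ⟩ := hK.product fun i : Σ a, W.obj a => D.obj i.1
  let φ (b : J) (z : CoverObj W b) : L ⟶ D.obj b := π ⟨z.1, z.2.2⟩ ≫ D.map z.2.1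
  have hφ {b c : J} (f : b ⟶ c) (z : CoverObj W b) :
      φ c ((CoverObj.map f).obj z) = φ b z ≫ D.map f :=
    (congrArg (π ⟨z.1, z.2.2⟩ ≫ ·) (D.map_comp z.2.1 f)).trans (Strict.assoc _ _ _).symm
  -- its values at the morphisms
  obtain ⟨M, k, G, hG, hGu⟩ := hK.exists_functor φ
  have hGn {b c : J} (f : b ⟶ c) (z : CoverObj W b) :
      (G c).obj ((CoverObj.map f).obj z) = (G b).obj z ≫ D.map f := by
    rw [hG, hG, hφ]; exact (Strict.assoc _ _ _).symm
  -- the equations for its compatibility with 2-cells; identity 2-cells `η` give naturality in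
  -- 1-cells, identity morphisms `m` give naturality in 2-cells
  obtain ⟨N, l, hl, hlu⟩ := hK.exists_equifier_heq (I := CoverObj.Test W)
    (u := fun i => (G i.c).obj ((CoverObj.map i.f).obj i.z))
    (u' := fun i => (G i.b).obj i.z ≫ D.map i.f)
    (v := fun i => (G i.c).obj ((CoverObj.map i.f').obj i.z'))
    (v' := fun i => (G i.b).obj i.z' ≫ D.map i.f')
    (funext fun i => hGn i.f i.z) (funext fun i => hGn i.f' i.z')
    (fun i => (G i.c).map ((CoverObj.map₂ i.η).app i.z ≫ (CoverObj.map i.f').map i.m))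
    (fun i => (G i.b).obj i.z ◁ D.map₂ i.η ≫ (G i.b).map i.m ▷ D.map i.f')
  let ξ : Cylinder (coverWeight W) D N :=
    { app := fun b => G b ⋙ precomp (D.obj b) l
      naturality := @fun b c f => by
        refine Functor.hext (fun z => ?_) fun z z' m => ?_
        · exact (congrArg (l ≫ ·) (hGn f z)).trans (Strict.assoc _ _ _).symm
        · have h := hl { η := 𝟙 f, m := m }
          have h₁ : (CoverObj.map₂ (𝟙 f)).app z ≫ (CoverObj.map f).map m =
              (CoverObj.map f).map m := by
            have := congrArg Cat.Hom₂.toNatTrans ((coverWeight W).map₂_id f)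
            exact (congrArg (· ≫ _) (NatTrans.congr_app this z)).trans (Category.id_comp _)
          have h₂ : (G b).obj z ◁ D.map₂ (𝟙 f) ≫ (G b).map m ▷ D.map f = (G b).map m ▷ D.map f := by
            rw [PrelaxFunctor.map₂_id, whiskerLeft_id]; exact Category.id_comp _
          dsimp only at h
          rw [h₁, h₂] at h
          exact h.trans (whisker_assoc_heq _ _ _).symm
      naturality₂ := @fun b c f f' η (z : CoverObj W b) => by
        have h := hl { η := η, m := 𝟙 z }
        have h₁ : (CoverObj.map₂ η).app z ≫ (CoverObj.map f').map (𝟙 z) =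
            (CoverObj.map₂ η).app z := by
          rw [CategoryTheory.Functor.map_id]; exact Category.comp_id _
        have h₂ : (G b).obj z ◁ D.map₂ η ≫ (G b).map (𝟙 z) ▷ D.map f' =
            (G b).obj z ◁ D.map₂ η := by
          rw [CategoryTheory.Functor.map_id, id_whiskerRight]; exact Category.comp_id _
        dsimp only at h
        rw [h₁, h₂] at h
        exact h.trans (comp_whiskerLeft_heq _ _ _).symm }
  refine ⟨N, ξ, fun T _ X Γ' hΓ => ?_⟩
  let Γ (b : J) : T × CoverObj W b ⥤ (X ⟶ D.obj b) := Γ' b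
  obtain ⟨y₀, hy₀, hy₀u⟩ := hπ T X fun i => Functor.prod' (𝟭 T)
    ((Functor.const T).obj (CoverObj.mk (𝟙 _) i.2)) ⋙ Γ i.1
  have hΓφ (b : J) (z : CoverObj W b) :
      Functor.prod' (𝟭 T) ((Functor.const T).obj z) ⋙ Γ b = y₀ ⋙ postcomp X (φ b z) := by
    rw [← comp_postcomp_postcomp, hy₀]
    have hz : z = (CoverObj.map z.2.1).obj (CoverObj.mk (𝟙 _) z.2.2) :=
      Sigma.ext rfl (heq_of_eq (Prod.ext (Strict.id_comp _).symm rfl))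
    have h₁ : Functor.prod' (𝟭 T) ((Functor.const T).obj z) ⋙ Γ b =
        Functor.prod' (𝟭 T) ((Functor.const T).obj (CoverObj.mk (𝟙 _) z.2.2)) ⋙
          (𝟭 T).prod (CoverObj.map z.2.1) ⋙ Γ b :=
      (congrArg (fun z' => Functor.prod' (𝟭 T) ((Functor.const T).obj z') ⋙ Γ b) hz).trans
        (congrArg (· ⋙ Γ b) (prod'_const_prod _ _).symm)
    refine h₁.trans ?_
    exact congrArg (fun F => Functor.prod' (𝟭 T)
      ((Functor.const T).obj (CoverObj.mk (𝟙 _) z.2.2)) ⋙ F) (hΓ.naturality z.2.1)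
  obtain ⟨y₁, ⟨hy₁, hy₁Γ⟩, hy₁u⟩ := hGu T X y₀ Γ hΓφ
  refine (existsUnique_congr fun z => ?_).1 (hlu T X y₁ fun t i => ?_)
  · constructor
    · rintro rfl b
      change hcomp z (G b ⋙ precomp (D.obj b) l) = _
      rw [hcomp_precomp, hy₁Γ]
    · intro hz
      have hz' (b : J) : hcomp (z ⋙ postcomp X l) (G b) = Γ b := by
        rw [← hcomp_precomp]; exact hz b
      refine hy₁u _ ⟨hy₀u _ fun i => ?_, hz'⟩
      have h : φ i.1 (CoverObj.mk (𝟙 _) i.2) = π i :=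
        (congrArg (π i ≫ ·) (D.map_id i.1)).trans (Strict.comp_id _)
      refine Eq.trans ?_ (congrArg (Functor.prod' (𝟭 T)
        ((Functor.const T).obj (CoverObj.mk (𝟙 _) i.2)) ⋙ ·) (hz' i.1))
      rw [prod'_const_hcomp, comp_postcomp_postcomp _ k, hG, h]
  · have e (b : J) : G b ⋙ precomp (D.obj b) (y₁.obj t) = (hΓ.cylinder t).app b := by
      rw [← const_prod'_hcomp, hy₁Γ]; rfl
    have e' (b : J) (z : CoverObj W b) := Functor.congr_obj (e b) z
    refine (heq_map_of_eq (e i.c) _).trans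
      (((hΓ.cylinder t).map_comp_heq i.η i.m).trans (HEq.symm ?_))
    have h {b c : J} (z : CoverObj W b) (f : b ⟶ c) : y₁.obj t ≫ (G b).obj z ≫ D.map f =
        ((hΓ.cylinder t).app b).obj z ≫ D.map f :=
      (Strict.assoc _ _ _).symm.trans (congrArg (· ≫ D.map f) (e' b z))
    rw [Bicategory.whiskerLeft_comp]
    refine heq_comp_of_heq (h _ _) (h _ _) (h _ _) ?_ ?_
    · exact (comp_whiskerLeft_heq _ _ _).symm.trans (heq_whiskerLeft rfl rfl HEq.rfl (e' _ _))
    · exact (whisker_assoc_heq _ _ _).symm.trans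
        (heq_whiskerRight (e' _ _) (e' _ _) (heq_map_of_eq (e i.b) i.m) rfl)

end

/-! ### Limits weighted by flexible weights -/

section

variable {J : Type v} [Bicategory.{v, v} J] [Bicategory.Strict J]
  {K : Type u} [Bicategory.{v, v} K] [Bicategory.Strict K]
  {W : StrictPseudofunctor J Cat.{v, v}} {D : StrictPseudofunctor J K}

/-- The composite of a cylinder with a 1-cell. -/
def Cylinder.precomp {L X : K} (ξ : Cylinder W D L) (x : X ⟶ L) : Cylinder W D X where
  app a := ξ.app a ⋙ Bicategory.precomp (D.obj a) x
  naturality f := by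
    rw [comp_precomp_postcomp, ← ξ.naturality]; rfl
  naturality₂ {a b f g} η w :=
    (heq_whiskerLeft (Functor.congr_obj (ξ.naturality f) w) (Functor.congr_obj (ξ.naturality g) w)
      (ξ.naturality₂ η w) rfl).trans (comp_whiskerLeft_heq _ _ _).symm

/-- The composite of a 2-natural transformation of weights with a cylinder. -/
def Cylinder.restrict {V : StrictPseudofunctor J Cat.{v, v}} (s : TwoNatTrans V W) {X : K}
    (ζ : Cylinder W D X) : Cylinder V D X where
  app a := (s.app a).toFunctor ⋙ ζ.app a
  naturality {a b} f := by
    have h := congrArg Cat.Hom.toFunctor (s.naturality f)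
    exact (congrArg (· ⋙ ζ.app b) h).trans
      (congrArg ((s.app a).toFunctor ⋙ ·) (ζ.naturality f))
  naturality₂ {a b f g} η x := by
    have e (f : a ⟶ b) := Functor.congr_obj (congrArg Cat.Hom.toFunctor (s.naturality f)) x
    have h := (eq_comp_eqToHom_iff_heq _).1 (s.naturality₂ η)
    have h' := h.trans (eqToHom_comp_heq _ (s.naturality f))
    refine (heq_map_of_heq (ζ.app b) (e f) (e g)
      (heq_toNatTrans_app (s.naturality f) (s.naturality g) h' (Eq.refl x))).trans ?_
    exact ζ.naturality₂ η _

theorem IsCylinderFunctor.of_cylinder {T : Type v} [Category.{v} T] {X : K}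
    {Γ : ∀ a, T × W.obj a ⥤ (X ⟶ D.obj a)}
    (h : ∀ {a b : J} (f : a ⟶ b),
      (𝟭 T).prod (W.map f).toFunctor ⋙ Γ b = Γ a ⋙ postcomp X (D.map f))
    (ζ : T → Cylinder W D X)
    (hζ : ∀ t a, Functor.prod' ((Functor.const _).obj t) (𝟭 _) ⋙ Γ a = (ζ t).app a) :
    IsCylinderFunctor W D Γ :=
  ⟨h, fun {a b f g} η t w => by
    refine (heq_map_of_eq (hζ t b) _).trans (((ζ t).naturality₂ η w).trans ?_)
    have := Functor.congr_obj (hζ t a) w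
    change (Γ a).obj (t, w) = _ at this
    rw [this]⟩

theorem IsCylinderFunctor.restrict {V : StrictPseudofunctor J Cat.{v, v}} (s : TwoNatTrans V W)
    {T : Type v} [Category.{v} T] {X : K} {Γ : ∀ a, T × W.obj a ⥤ (X ⟶ D.obj a)}
    (h : IsCylinderFunctor W D Γ) :
    IsCylinderFunctor V D fun a => (𝟭 T).prod (s.app a).toFunctor ⋙ Γ a :=
  .of_cylinder (fun {a b} f => by
    have h' := congrArg Cat.Hom.toFunctor (s.naturality f)
    exact (congrArg (fun F => (𝟭 T).prod F ⋙ Γ b) h').trans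
      (congrArg ((𝟭 T).prod (s.app a).toFunctor ⋙ ·) (h.naturality f)))
    (fun t => (h.cylinder t).restrict s) fun _ _ => rfl

theorem IsCylinderFunctor.snd {T : Type v} [Category.{v} T] {X : K} (ζ : Cylinder W D X) :
    IsCylinderFunctor W D fun a => CategoryTheory.Prod.snd T _ ⋙ ζ.app a :=
  .of_cylinder (fun f => congrArg (CategoryTheory.Prod.snd T _ ⋙ ·) (ζ.naturality f))
    (fun _ => ζ) fun _ _ => rfl

theorem IsWeightedLimitOnFunctors.existsUnique_hom {L : K} {ξ : Cylinder W D L}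
    (hξ : IsWeightedLimitOnFunctors ξ) {X : K} (ζ : Cylinder W D X) :
    ∃! x : X ⟶ L, ∀ a, ζ.app a = ξ.app a ⋙ Bicategory.precomp (D.obj a) x := by
  obtain ⟨y, hy, hyu⟩ := hξ FreeIso.{v} X _ (.snd ζ)
  refine ⟨y.obj .src, fun a => ?_, fun x hx => ?_⟩
  · rw [← const_prod'_hcomp, hy]; rfl
  · refine Functor.congr_obj (hyu ((Functor.const _).obj x) fun a => ?_) FreeIso.src
    rw [const_hcomp, hx]

theorem heq_of_app {A B : Type*} [Category* A] [Category* B] {F F' G G' : A ⥤ B} (hF : F = F')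
    (hG : G = G') {α : F ⟶ G} {α' : F' ⟶ G'} (h : ∀ c, HEq (α.app c) (α'.app c)) : HEq α α' := by
  subst hF hG
  exact heq_of_eq (NatTrans.ext (funext fun c => eq_of_heq (h c)))

theorem const_prod'_uncurry {T A B : Type*} [Category* T] [Category* A] [Category* B]
    (F : T ⥤ A ⥤ B) (t : T) :
    Functor.prod' ((Functor.const A).obj t) (𝟭 A) ⋙ Functor.uncurry.obj F = F.obj t :=
  Functor.hext (fun _ => rfl) fun w w' n => heq_of_eq <| by
    change (F.map (𝟙 t)).app w ≫ (F.obj t).map n = (F.obj t).map n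
    rw [F.map_id, NatTrans.id_app, Category.id_comp]

/-- A 2-cell `α` induces a modification `Γ` of cylinders if and only if the functors on the
walking arrow given by `α` and by `Γ` correspond to each other. -/
theorem hcomp_lift_eq_uncurry_iff {A : Type*} [Category* A] {X L B : K} (ξ : A ⥤ (L ⟶ B))
    {x y : X ⟶ L} (α : x ⟶ y) (Γ : ξ ⋙ precomp B x ⟶ ξ ⋙ precomp B y) :
    hcomp (WalkingArrows.lift fun _ : PUnit.{v + 1} => α) ξ =
        Functor.uncurry.obj (WalkingArrows.lift fun _ : PUnit.{v + 1} => Γ) ↔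
      ∀ w, Γ.app w = α ▷ ξ.obj w := by
  constructor
  · intro h w
    have h' := eq_of_heq (heq_map_of_eq h
      ((WalkingArrows.arrow ⟨⟩, 𝟙 w) : (WalkingArrows.src, w) ⟶ (WalkingArrows.tgt, w)))
    change α ▷ ξ.obj w ≫ y ◁ ξ.map (𝟙 w) = Γ.app w ≫ y ◁ ξ.map (𝟙 w) at h'
    rw [ξ.map_id, whiskerLeft_id] at h'
    exact ((Category.comp_id _).symm.trans h'.symm).trans (Category.comp_id _)
  · intro h
    refine Functor.hext (by rintro ⟨(_ | _), w⟩ <;> rfl) ?_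
    rintro ⟨(_ | _), w⟩ ⟨(_ | _), w'⟩ ⟨m, n⟩
    · exact heq_of_eq (congrArg (· ≫ x ◁ ξ.map n) (id_whiskerRight x (ξ.obj w)))
    · exact heq_of_eq (congrArg (· ≫ y ◁ ξ.map n) (h w).symm)
    · exact PEmpty.elim m
    · exact heq_of_eq (congrArg (· ≫ y ◁ ξ.map n) (id_whiskerRight y (ξ.obj w)))

/-- The universal property of a weighted limit is tested on functors from the walking arrow and
from the walking isomorphism. -/
theorem IsWeightedLimitOnFunctors.isWeightedLimit {L : K} {ξ : Cylinder W D L}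
    (hξ : IsWeightedLimitOnFunctors ξ) : IsWeightedLimit ξ where
  existsUnique_hom _ ζ := hξ.existsUnique_hom ζ
  existsUnique_hom₂ {X} x y Γ hΓ := by
    let Λ (a : J) : WalkingArrows PUnit.{v + 1} × W.obj a ⥤ (X ⟶ D.obj a) :=
      Functor.uncurry.obj (WalkingArrows.lift fun _ => Γ a)
    have hΛ : IsCylinderFunctor W D Λ := by
      refine .of_cylinder (fun {a b} f => ?_)
        (fun t => match t with
          | .src => ξ.precomp x
          | .tgt => ξ.precomp y) ?_
      · have key : (WalkingArrows.lift fun _ : PUnit.{v + 1} => Γ b) ⋙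
            (Functor.whiskeringLeft _ _ _).obj (W.map f).toFunctor =
            (WalkingArrows.lift fun _ => Γ a) ⋙
              (Functor.whiskeringRight _ _ _).obj (postcomp X (D.map f)) := by
          refine WalkingArrows.functor_ext ((ξ.precomp x).naturality f)
            ((ξ.precomp y).naturality f) fun _ => ?_
          exact heq_of_app ((ξ.precomp x).naturality f) ((ξ.precomp y).naturality f) (hΓ f)
        have := congrArg Functor.uncurry.obj key
        refine Eq.trans ?_ (this.trans ?_)
        · exact Functor.hext (fun _ => rfl) fun _ _ _ => HEq.rfl
        · exact Functor.hext (fun _ => rfl) fun _ _ _ =>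
            heq_of_eq ((postcomp X (D.map f)).map_comp _ _).symm
      · rintro (_ | _) a
        · exact const_prod'_uncurry _ _
        · exact const_prod'_uncurry _ _
    have obj {x : X ⟶ L} {z : X ⟶ L} (h : ∀ a, ξ.app a ⋙ Bicategory.precomp (D.obj a) z =
        ξ.app a ⋙ Bicategory.precomp (D.obj a) x) : z = x :=
      (hξ.existsUnique_hom (ξ.precomp x)).unique (fun a => (h a).symm) fun _ => rfl
    obtain ⟨z, hz, hzu⟩ := hξ _ X Λ hΛ
    obtain ⟨α, rfl⟩ := WalkingArrows.exists_eq_lift z (X := x) (Y := y)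
      (obj fun a => by rw [← const_prod'_hcomp, hz]; exact const_prod'_uncurry _ _)
      (obj fun a => by rw [← const_prod'_hcomp, hz]; exact const_prod'_uncurry _ _)
    refine ⟨α, fun a => (hcomp_lift_eq_uncurry_iff _ _ _).1 (hz a), fun β hβ => ?_⟩
    have := hzu _ fun a => (hcomp_lift_eq_uncurry_iff (ξ.app a) β (Γ a)).2 (hβ a)
    exact eq_of_heq (heq_map_of_eq this (WalkingArrows.arrow ⟨⟩))

/-- Limits weighted by `W` are obtained by splitting idempotents from limits weighted by a weight
of which `W` is a retract. -/
theorem IsWeightedLimitOnFunctors.exists_of_retract [IsIdempotentComplete K]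
    {E : StrictPseudofunctor J Cat.{v, v}} (w : TwoNatTrans W E) (p : TwoNatTrans E W)
    (hwp : ∀ a, w.app a ≫ p.app a = 𝟙 _) {L : K} {ξ : Cylinder E D L}
    (hξ : IsWeightedLimitOnFunctors ξ) :
    ∃ (M : K) (ζ : Cylinder W D M), IsWeightedLimitOnFunctors ζ := by
  have hwp' (a : J) : (w.app a).toFunctor ⋙ (p.app a).toFunctor = 𝟭 _ :=
    congrArg Cat.Hom.toFunctor (hwp a)
  -- the idempotent of `L` induced by the idempotent `p ≫ w` of `E`
  obtain ⟨e, he, -⟩ := hξ.existsUnique_hom ((ξ.restrict w).restrict p)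
  have hext {X : K} {x x' : X ⟶ L} (h : ∀ a, ξ.app a ⋙ Bicategory.precomp (D.obj a) x =
        ξ.app a ⋙ Bicategory.precomp (D.obj a) x') : x = x' :=
      (hξ.existsUnique_hom (ξ.precomp x')).unique (fun a => (h a).symm) fun _ => rfl
  have hee : e ≫ e = e := hext fun a => by
    rw [← comp_precomp_precomp, ← he]
    change (p.app a).toFunctor ⋙ (w.app a).toFunctor ⋙ ξ.app a ⋙ Bicategory.precomp _ e = _
    rw [← he]
    exact congrArg (fun F => (p.app a).toFunctor ⋙ F ⋙ (w.app a).toFunctor ⋙ ξ.app a) (hwp' a)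
  obtain ⟨M, t, s, hts, hst⟩ := IsIdempotentComplete.idempotents_split L e hee
  have hte : t ≫ e = t := by rw [← hst, ← Strict.assoc, hts, Strict.id_comp]
  refine ⟨M, (ξ.precomp t).restrict w, fun T _ X Γ hΓ => ?_⟩
  have hh {X : K} (y : T ⥤ (X ⟶ L)) (a : J) : hcomp (y ⋙ postcomp X e) (ξ.app a) =
      (𝟭 T).prod (p.app a).toFunctor ⋙ (𝟭 T).prod (w.app a).toFunctor ⋙ hcomp y (ξ.app a) := by
    rw [← hcomp_precomp, ← he]; rfl
  have hm {X : K} (z : T ⥤ (X ⟶ M)) (a : J) : hcomp z (((ξ.precomp t).restrict w).app a) =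
      (𝟭 T).prod (w.app a).toFunctor ⋙ hcomp (z ⋙ postcomp X t) (ξ.app a) := by
    rw [← hcomp_precomp]; rfl
  obtain ⟨y, hy, hyu⟩ := hξ T X _ (hΓ.restrict p)
  have hwΓ (a : J) : (𝟭 T).prod (w.app a).toFunctor ⋙ hcomp y (ξ.app a) = Γ a := by
    rw [hy]
    exact congrArg (fun F => (𝟭 T).prod F ⋙ Γ a) (hwp' a)
  have hye : y ⋙ postcomp X e = y := hyu _ fun a => by rw [hh, hwΓ]
  refine ⟨y ⋙ postcomp X s, fun a => ?_, fun z hz => ?_⟩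
  · rw [hm, comp_postcomp_postcomp, hst, hye, hwΓ]
  · have : z ⋙ postcomp X t = y := hyu _ fun a => by
      rw [← hte, ← comp_postcomp_postcomp, hh, ← hm, hz]
    rw [← this, comp_postcomp_postcomp, hts, comp_postcomp_id]

/-- A flexible weight is a retract of its free cover, by the lifting property against the projection
of the cover. -/
theorem IsCauchyCompleteTwoCosmos.hasFlexibleLimits
    (h : IsCauchyCompleteTwoCosmos (normalIsofibrations K)) : HasFlexibleLimits K := by
  intro J _ _ W hW D
  have hI : IsIdempotentComplete K := by
    let _ := nerveEnrichment K
    exact h.splitIdempotents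
  let u : TwoNatTrans W W :=
    { app := fun a => 𝟙 _
      naturality := fun f => (Strict.comp_id _).trans (Strict.id_comp _).symm
      naturality₂ := fun η => by
        refine (eq_comp_eqToHom_iff_heq _).2 ((whiskerRight_id_heq _).trans ?_)
        exact (id_whiskerLeft_heq _).symm.trans (eqToHom_comp_heq _ _).symm }
  obtain ⟨w, hw⟩ := hW _ _ (coverWeight.proj W) (fun a => ⟨InducedCategory.full _,
    InducedCategory.faithful _, fun x => ⟨CoverObj.mk (𝟙 a) x,
      Functor.congr_obj (congrArg Cat.Hom.toFunctor (W.map_id a)) x⟩⟩) u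
  obtain ⟨L, ξ, hξ⟩ := h.hasCosmosLimits.exists_cover_limit W D
  obtain ⟨M, ζ, hζ⟩ := hξ.exists_of_retract w (coverWeight.proj W) hw
  exact ⟨M, ζ, hζ.isWeightedLimit⟩

end

theorem theorem4p3 {K : Type u} [Bicategory.{v, v} K] [Bicategory.Strict K] :
    HasFlexibleLimits K ↔ IsCauchyCompleteTwoCosmos (normalIsofibrations K) :=
  ⟨HasFlexibleLimits.isCauchyCompleteTwoCosmos, IsCauchyCompleteTwoCosmos.hasFlexibleLimits⟩
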